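/- **Conventions.** Let $W$ be a vector space over $\mathbb C$ and $\mathcal E^{o}(W)=\mathrm{Hom}(W,W((x^{-1})))$, a vector space over the field $\mathbb C((x^{-1}))$; $1_W\in\mathcal E^{o}(W)$ is the identity operator of $W$. Here $W((x_1^{-1},\dots,x_r^{-1}))$ is the space of formal series with coefficients in $W$ in which the exponents of all variables are bounded above. A finite sequence $a_1(x),\dots,a_r(x)$ in $\mathcal E^{o}(W)$ is *quasi-compatible* if there is a nonzero polynomial $p(x_1,x_2)\in\mathbb C[x_1,x_2]$ with $$\Big(\prod_{1\le i<j\le r}p(x_i,x_j)\Big)a_1(x_1)\cdots a_r(x_r)\in \mathrm{Hom}(W,W((x_1^{-1},\dots,x_r^{-1}))),$$ and *compatible* if this holds with $p=(x_1-x_2)^k$ for some integer $k\ge 0$. A subset of $\mathcal E^{o}(W)$ is quasi-compatible (compatible) if all its finite sequences are. For a quasi-compatible pair $(a(x),b(x))$ set $$Y_{\mathcal E^{o}}(a(x),x_0)b(x)=\iota\big(1/p(x_0+x,x)\big)\,\big(p(x_1,x)a(x_1)b(x)\big)\big|_{x_1=x+x_0}=\sum_{n\in\mathbb Z}a(x)_nb(x)\,x_0^{-n-1}\in\mathcal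 E^{o}(W)((x_0)),$$ where $p\neq0$ is any polynomial with $p(x_1,x_2)a(x_1)b(x_2)\in\mathrm{Hom}(W,W((x_1^{-1},x_2^{-1})))$, powers of $x+x_0$ are expanded in nonnegative powers of $x_0$, and $\iota$ is the expansion in $\mathbb C((x^{-1}))((x_0))$ (the result does not depend on $p$). A quasi-compatible subspace $U$ is *closed* if $a(x)_nb(x)\in U$ for all $a(x),b(x)\in U$ and $n\in\mathbb Z$. A *nonlocal vertex algebra* is a complex vector space $V$ with a linear map $Y:V\to\mathrm{Hom}(V,V((x)))$ and a vector $\mathbf 1$ such that $Y(\mathbf 1,x)v=v$, $Y(v,x)\mathbf 1\in V[[x]]$ has constant term $v$, and for all $u,v,w\in V$ there is an integer $l\ge 0$ with $(x_0+x_2)^lY(u,x_0+x_2)Y(v,x_2)w=(x_0+x_2)^lY(Y(u,x_0)v,x_2)w$. A *quasi module-at-infinity* for $V$ is a vector space $W$ with a linear map $Y_W:V\to\mathcal E^{o}(W)$ such that $Y_W(\mathbf 1,x)=1_W$ and for all $u,v\in V$ there is a nonzero polynomial $p(x_1,x_2)$ with $p(x_1,x_2)Y_W(u,x_1)Y_W(v,x_2)\in\mathrm{Hom}(W,W((x_1^{-1},x_2^{-1})))$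 and $$p(x_0+x_2,x_2)Y_W(Y(u,x_0)v,x_2)=\big(p(x_1,x_2)Y_W(u,x_1)Y_W(v,x_2)\big)\big|_{x_1=x_2+x_0}.$$ It is a *module-at-infinity* if moreover for all $u,v$ these two conditions hold with $p=(x_1-x_2)^k$ for some integer $k\ge0$. It is *faithful* if $Y_W$ is injective. **Theorem.** 1. Every maximal quasi-compatible subspace of $\mathcal E^{o}(W)$ is closed and contains $1_W$. 2. If $V$ is a closed quasi-compatible subspace of $\mathcal E^{o}(W)$ containing $1_W$, then $(V,Y_{\mathcal E^{o}},1_W)$ is a nonlocal vertex algebra, and $W$ with $Y_W(\alpha(x),x_0)=\alpha(x_0)$ is a faithful quasi module-at-infinity for $V$; if $V$ is compatible, then $W$ is a module-at-infinity for $V$. 3. For every quasi-compatible subset $S$ of $\mathcal E^{o}(W)$ there is a unique smallest closed quasi-compatible subspace $\langle S\rangle$ of $\mathcal E^{o}(W)$ containing $S$ and $1_W$. Moreover $(\langle S\rangle,Y_{\mathcal E^{o}},1_W)$ is a nonlocal vertex algebra, and $W$ with $Y_W(\psi(x),x_0)=\psi(x_0)$ is a faithful quasi module-at-infinity for $\langle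 S\rangle$; if $S$ is compatible, then $W$ is a module-at-infinity for $\langle S\rangle$. -/

import Mathlib

namespace NonlocalVA

noncomputable section

section FormalCalculus

/-- The product of a polynomial in the variables `x_i` (`i : σ`) and a doubly infinite formal
series `∑_m F_m ∏_i x_i^{m_i}` (`m : σ → ℤ`) with coefficients in `M`.  A formal series is given
by its coefficient function `F`. -/
def polyMul {σ M : Type*} [AddCommGroup M] [Module ℂ M] (p : MvPolynomial σ ℂ) :
    ((σ → ℤ) → M) →ₗ[ℂ] ((σ → ℤ) → M) :=
  ∑ d ∈ p.support, p.coeff d • LinearMap.funLeft ℂ M (fun (m : σ → ℤ) i => m i - (d i : ℤ))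

/-- The subspace `W((x_1^{-1}, …, x_r^{-1}))` of the space of all doubly infinite formal series in
`x_1, …, x_r`: the exponents of all the variables are bounded above. -/
def LaurentAtInfinity (r : ℕ) (W : Type*) [AddCommGroup W] [Module ℂ W] :
    Submodule ℂ ((Fin r → ℤ) → W) where
  carrier := {F | ∃ N : ℤ, ∀ m, F m ≠ 0 → ∀ i, m i ≤ N}
  add_mem' := by
    rintro F G ⟨N, hN⟩ ⟨N', hN'⟩
    refine ⟨max N N', fun m hm i => ?_⟩
    by_cases hF : F m = 0
    · exact (hN' m (fun hG => hm (by simp [hF, hG])) i).trans (le_max_right _ _)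
    · exact (hN m hF i).trans (le_max_left _ _)
  zero_mem' := ⟨0, fun m hm => absurd rfl hm⟩
  smul_mem' := by
    rintro c F ⟨N, hN⟩
    exact ⟨N, fun m hm i => hN m (fun h => hm (by simp [h])) i⟩

variable {W : Type*} [AddCommGroup W] [Module ℂ W]

/-- The coefficient of `x_0^k x^n` in `F(x + x_0, x)`, where
`F(x_1, x_2) = ∑ F_{j,l} x_1^j x_2^l ∈ W((x_1^{-1}, x_2^{-1}))` and `(x + x_0)^j` is expanded in
nonnegative powers of `x_0`.  Only finitely many terms are nonzero. -/
def diagCoeff (F : (Fin 2 → ℤ) → W) (k : ℕ) (n : ℤ) : W :=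
  ∑ᶠ j : ℤ, (Ring.choose j k) • F ![j, n + k - j]

theorem finite_diag {F : (Fin 2 → ℤ) → W} (hF : F ∈ LaurentAtInfinity 2 W) (k : ℕ) (n : ℤ) :
    (Function.support fun j : ℤ => (Ring.choose j k) • F ![j, n + k - j]).Finite := by
  obtain ⟨N, hN⟩ := hF
  refine (Set.finite_Icc (n + k - N) N).subset fun j hj => ?_
  have h : F ![j, n + k - j] ≠ 0 := fun h => hj (by simp [h])
  have h0 := hN _ h 0
  have h1 := hN _ h 1
  simp at h0 h1
  constructor <;> omega

theorem diagCoeff_bdd {F : (Fin 2 → ℤ) → W} (hF : F ∈ LaurentAtInfinity 2 W) (k : ℕ) :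
    BddBelow (Function.support fun l : ℤ => diagCoeff F k (-l)) := by
  obtain ⟨N, hN⟩ := hF
  refine ⟨k - 2 * N, fun l hl => ?_⟩
  obtain ⟨j, hj⟩ : ∃ j : ℤ, (Ring.choose j k) • F ![j, -l + k - j] ≠ 0 := by
    by_contra! h
    exact hl (finsum_eq_zero_of_forall_eq_zero h)
  have h : F ![j, -l + k - j] ≠ 0 := fun h => hj (by simp [h])
  have h0 := hN _ h 0
  have h1 := hN _ h 1
  simp at h0 h1
  omega

/-- The coefficient of `x_0^k` in `F(x + x_0, x)`, as an element of `W((x^{-1}))`.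
Here and below, `W((x^{-1}))` is the space of Laurent series in the variable `x^{-1}`, so the
coefficient of `x^n` is the Hahn series coefficient with index `-n`. -/
def diagSubst (k : ℕ) : LaurentAtInfinity 2 W →ₗ[ℂ] HahnModule ℤ ℂ W where
  toFun F := HahnModule.of ℂ
    (HahnSeries.ofSuppBddBelow (fun l : ℤ => diagCoeff F.1 k (-l)) (diagCoeff_bdd F.2 k))
  map_add' F G := by
    ext l
    simp only [HahnModule.of_symm_add, Equiv.symm_apply_apply, HahnSeries.coeff_add,
      HahnSeries.coeff_ofSuppBddBelow, diagCoeff, Submodule.coe_add, Pi.add_apply, smul_add]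
    exact finsum_add_distrib (finite_diag F.2 k (-l)) (finite_diag G.2 k (-l))
  map_smul' c F := by
    ext l
    change ∑ᶠ j : ℤ, (Ring.choose j k) • (c • F.1 ![j, -l + k - j]) =
      c • ∑ᶠ j : ℤ, (Ring.choose j k) • F.1 ![j, -l + k - j]
    rw [smul_finsum' c (finite_diag F.2 k (-l))]
    exact finsum_congr fun j => smul_comm _ _ _

/-- The field `ℂ((x^{-1}))` of Laurent series in `x^{-1}`. -/
def LaurentInf : Type := LaurentSeries ℂ

instance : Field LaurentInf := inferInstanceAs (Field (LaurentSeries ℂ))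

/-- The embedding of `ℂ` into `ℂ((x^{-1}))`. -/
def LaurentInf.C : ℂ →+* LaurentInf := (HahnSeries.C : ℂ →+* LaurentSeries ℂ)

/-- The element `x` of `ℂ((x^{-1}))`. -/
def LaurentInf.x : LaurentInf := (HahnSeries.single (-1) 1 : LaurentSeries ℂ)

/-- The map sending a polynomial `p(x_1, x_2)` to the image of `p(x_0 + x, x)` in the field
`ℂ((x^{-1}))((x_0))`.  The outer Laurent series variable is `x_0`. -/
def iotaDiag : MvPolynomial (Fin 2) ℂ →+* LaurentSeries LaurentInf :=
  let x₀ : LaurentSeries LaurentInf := HahnSeries.single 1 1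
  let x : LaurentSeries LaurentInf := HahnSeries.C LaurentInf.x
  MvPolynomial.eval₂Hom (HahnSeries.C.comp LaurentInf.C) ![x₀ + x, x]

end FormalCalculus

section FieldsAtInfinity

/-- The space `ℰᵒ(W) = Hom(W, W((x^{-1})))`. -/
abbrev EInf (W : Type*) [AddCommGroup W] [Module ℂ W] := W →ₗ[ℂ] HahnModule ℤ ℂ W

variable {W : Type*} [AddCommGroup W] [Module ℂ W]

/-- `ℰᵒ(W)` is a vector space over `ℂ((x^{-1}))`, by multiplication of Laurent series. -/
instance : Module LaurentInf (EInf W) := inferInstanceAs (Module (LaurentSeries ℂ) (EInf W))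

/-- The coefficient of `x^n` in `a(x) ∈ ℰᵒ(W)`, an endomorphism of `W`. -/
def EInf.coeffX (a : EInf W) (n : ℤ) : Module.End ℂ W := HVertexOperator.coeff a (-n)

/-- The identity operator `1_W`, viewed as a constant series in `ℰᵒ(W)`. -/
def EInf.idW (W : Type*) [AddCommGroup W] [Module ℂ W] : EInf W where
  toFun w := HahnModule.of ℂ (HahnSeries.single 0 w)
  map_add' v w := by rw [HahnSeries.single_add, HahnModule.of_add]
  map_smul' c w := by
    ext l
    change (HahnSeries.single 0 (c • w)).coeff l = c • (HahnSeries.single 0 w).coeff l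
    by_cases h : l = 0
    · simp [h]
    · simp [HahnSeries.coeff_single_of_ne h]

/-- The formal series `a_1(x_1) a_2(x_2) ⋯ a_r(x_r) w`, depending linearly on `w`. -/
def productSeries {r : ℕ} (a : Fin r → EInf W) : W →ₗ[ℂ] ((Fin r → ℤ) → W) :=
  LinearMap.pi fun m => (List.ofFn fun i => (a i).coeffX (m i)).prod

/-- `(∏_{i<j} p(x_i, x_j)) a_1(x_1) ⋯ a_r(x_r) w`. -/
def clearedProduct {r : ℕ} (p : MvPolynomial (Fin 2) ℂ) (a : Fin r → EInf W) :
    W →ₗ[ℂ] ((Fin r → ℤ) → W) :=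
  polyMul (∏ i : Fin r, ∏ j ∈ Finset.Ioi i, MvPolynomial.rename ![i, j] p) ∘ₗ productSeries a

/-- `(∏_{i<j} p(x_i, x_j)) a_1(x_1) ⋯ a_r(x_r) ∈ Hom(W, W((x_1^{-1}, …, x_r^{-1})))`. -/
abbrev CompatibleVia {r : ℕ} (p : MvPolynomial (Fin 2) ℂ) (a : Fin r → EInf W) : Prop :=
  ∀ w, clearedProduct p a w ∈ LaurentAtInfinity r W

/-- Quasi-compatible finite sequences. -/
def QuasiCompatibleSeq {r : ℕ} (a : Fin r → EInf W) : Prop :=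
  ∃ p : MvPolynomial (Fin 2) ℂ, p ≠ 0 ∧ CompatibleVia p a

/-- Compatible finite sequences. -/
def CompatibleSeq {r : ℕ} (a : Fin r → EInf W) : Prop :=
  ∃ k : ℕ, CompatibleVia ((MvPolynomial.X 0 - MvPolynomial.X 1) ^ k) a

/-- Quasi-compatible subsets of `ℰᵒ(W)`: all finite sequences in `S` (repetitions allowed) are
quasi-compatible. -/
def QuasiCompatible (S : Set (EInf W)) : Prop :=
  ∀ (r : ℕ) (a : Fin r → EInf W), (∀ i, a i ∈ S) → QuasiCompatibleSeq a

/-- Compatible subsets of `ℰᵒ(W)`. -/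
def Compatible (S : Set (EInf W)) : Prop :=
  ∀ (r : ℕ) (a : Fin r → EInf W), (∀ i, a i ∈ S) → CompatibleSeq a

/-- The space `ℰᵒ(W)((x_0))`.  As `ℰᵒ(W)` is a vector space over `ℂ((x^{-1}))`, this is a vector
space over the field `ℂ((x^{-1}))((x_0))`. -/
abbrev EInfLaurent (W : Type*) [AddCommGroup W] [Module ℂ W] :=
  HahnModule ℤ LaurentInf (EInf W)

/-- `(p(x_1, x) a(x_1) b(x))|_{x_1 = x + x_0} ∈ ℰᵒ(W)[[x_0]]`. -/
def substProduct (p : MvPolynomial (Fin 2) ℂ) (a b : EInf W) (h : CompatibleVia p ![a, b]) :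
    EInfLaurent W :=
  HahnModule.of LaurentInf (HahnSeries.ofSuppBddBelow
    (fun k : ℤ => if 0 ≤ k then
      diagSubst k.toNat ∘ₗ
        LinearMap.codRestrict (LaurentAtInfinity 2 W) (clearedProduct p ![a, b]) h
      else 0)
    ⟨0, fun k hk => by by_contra h0; exact hk (if_neg h0)⟩)

/-- `Y_{ℰᵒ}(a(x), x_0) b(x) = ι(1 / p(x_0 + x, x)) (p(x_1, x) a(x_1) b(x))|_{x_1 = x + x_0}` for a
quasi-compatible pair `(a(x), b(x))`, where `p` is any nonzero polynomial with
`p(x_1, x_2) a(x_1) b(x_2) ∈ Hom(W, W((x_1^{-1}, x_2^{-1})))`; the result does not depend on the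
choice of `p`.  (For pairs that are not quasi-compatible the value `0` is a convention.) -/
def YE (a b : EInf W) : EInfLaurent W :=
  open Classical in
  if h : QuasiCompatibleSeq ![a, b] then
    (iotaDiag h.choose)⁻¹ • substProduct h.choose a b h.choose_spec.2
  else 0

/-- `a(x)_n b(x)`: the coefficient of `x_0^{-n-1}` in `Y_{ℰᵒ}(a(x), x_0) b(x)`. -/
def nthProduct (a b : EInf W) (n : ℤ) : EInf W :=
  ((HahnModule.of LaurentInf).symm (YE a b)).coeff (-n - 1)

/-- The closed quasi-compatible subspaces of `ℰᵒ(W)`. -/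
structure IsClosedQuasiCompatible (U : Submodule ℂ (EInf W)) : Prop where
  quasiCompatible : QuasiCompatible (U : Set (EInf W))
  closed : ∀ a ∈ U, ∀ b ∈ U, ∀ n : ℤ, nthProduct a b n ∈ U

end FieldsAtInfinity

section NonlocalVertexAlgebras

/-- The coefficient of `x_0^p x_2^q` (`p = m 0`, `q = m 1`) in `Y(u, x_0 + x_2) Y(v, x_2) w`, where
`(x_0 + x_2)^j` is expanded in nonnegative powers of `x_2`.  Only finitely many terms are
nonzero. -/
def iterateLeft {V : Type*} [AddCommGroup V] [Module ℂ V] (Y : V →ₗ[ℂ] VertexOperator ℂ V)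
    (u v w : V) (m : Fin 2 → ℤ) : V :=
  ∑ᶠ i : ℕ, (Ring.choose (m 0 + i) i) •
    HVertexOperator.coeff (Y u) (m 0 + i) (HVertexOperator.coeff (Y v) (m 1 - i) w)

/-- The coefficient of `x_0^p x_2^q` (`p = m 0`, `q = m 1`) in `Y(Y(u, x_0) v, x_2) w`. -/
def iterateRight {V : Type*} [AddCommGroup V] [Module ℂ V] (Y : V →ₗ[ℂ] VertexOperator ℂ V)
    (u v w : V) (m : Fin 2 → ℤ) : V :=
  HVertexOperator.coeff (Y (HVertexOperator.coeff (Y u) (m 0) v)) (m 1) w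

/-- Nonlocal vertex algebra structures on a complex vector space `V`.  A vertex operator is a
linear map `V → V((x))`. -/
structure NonlocalVertexAlgebra (V : Type*) [AddCommGroup V] [Module ℂ V] where
  Y : V →ₗ[ℂ] VertexOperator ℂ V
  vac : V
  vac_left : ∀ v, Y vac v = HahnModule.of ℂ (HahnSeries.single 0 v)
  creation_regular : ∀ v, ∀ n < 0, HVertexOperator.coeff (Y v) n vac = 0
  creation : ∀ v, HVertexOperator.coeff (Y v) 0 vac = v
  weak_assoc : ∀ u v w, ∃ l : ℕ,
    polyMul ((MvPolynomial.X 0 + MvPolynomial.X 1) ^ l) (iterateLeft Y u v w) =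
      polyMul ((MvPolynomial.X 0 + MvPolynomial.X 1) ^ l) (iterateRight Y u v w)

variable {V : Type*} [AddCommGroup V] [Module ℂ V] {W : Type*} [AddCommGroup W] [Module ℂ W]

/-- `Y_W(s(x_0), x_2) ∈ ℰᵒ(W)((x_0))` for `s(x_0) ∈ V((x_0))`: the map `Y_W` is applied to every
coefficient of `s`. -/
def mapCoeff (YW : V →ₗ[ℂ] EInf W) (s : HahnModule ℤ ℂ V) : EInfLaurent W :=
  HahnModule.of LaurentInf (((HahnModule.of ℂ).symm s).map YW)

/-- `p(x_1, x_2) Y_W(u, x_1) Y_W(v, x_2) ∈ Hom(W, W((x_1^{-1}, x_2^{-1})))` and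
`p(x_0 + x_2, x_2) Y_W(Y(u, x_0) v, x_2) = (p(x_1, x_2) Y_W(u, x_1) Y_W(v, x_2))|_{x_1 = x_2 + x_0}`.
The factor `p(x_0 + x_2, x_2)` acts through `ℂ((x_2^{-1}))((x_0))`; for `p = (x_1 - x_2)^k` it is
`x_0^k`. -/
def AssociativeVia (A : NonlocalVertexAlgebra V) (YW : V →ₗ[ℂ] EInf W)
    (p : MvPolynomial (Fin 2) ℂ) (u v : V) : Prop :=
  ∃ h : CompatibleVia p ![YW u, YW v],
    iotaDiag p • mapCoeff YW (A.Y u v) = substProduct p (YW u) (YW v) h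

/-- `(W, Y_W)` is a (left) quasi module-at-infinity for the nonlocal vertex algebra `V`. -/
structure IsQuasiModuleAtInfinity (A : NonlocalVertexAlgebra V) (YW : V →ₗ[ℂ] EInf W) : Prop where
  map_vac : YW A.vac = EInf.idW W
  assoc : ∀ u v, ∃ p : MvPolynomial (Fin 2) ℂ, p ≠ 0 ∧ AssociativeVia A YW p u v

/-- `(W, Y_W)` is a (left) module-at-infinity for the nonlocal vertex algebra `V`. -/
structure IsModuleAtInfinity (A : NonlocalVertexAlgebra V) (YW : V →ₗ[ℂ] EInf W) : Prop
    extends IsQuasiModuleAtInfinity A YW where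
  assoc_pow : ∀ u v, ∃ k : ℕ, AssociativeVia A YW ((MvPolynomial.X 0 - MvPolynomial.X 1) ^ k) u v

/-- The nonlocal vertex algebra `A` on the subspace `U` of `ℰᵒ(W)` is `(U, Y_{ℰᵒ}, 1_W)`. -/
def IsYEStructure (U : Submodule ℂ (EInf W)) (A : NonlocalVertexAlgebra U) : Prop :=
  (A.vac : EInf W) = EInf.idW W ∧ ∀ a b : U, mapCoeff U.subtype (A.Y a b) = YE (a : EInf W) b

end NonlocalVertexAlgebras

end

end NonlocalVA

open NonlocalVA

/-! Series are treated as coefficient functions on which polynomials act by shifts, and `binomOp`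
substitutes a binomial expansion of x_i + x_j for x_i. By Pascal's rule this substitution turns
multiplication by q into multiplication by q with x_i + x_j in place of x_i (`binomOp_polyMul`).
Hence `YE` is characterized without division: p(x_0 + x, x) times it is the substituted cleared
product (`polyMul_toSeries_YE`, `eq_YE`). What remains is to cancel polynomials from series with
one-sided support. Up to a power of x_0, a nonzero polynomial is f(x) + x_0 s with f ≠ 0. In lowest
x_0-order only f(x) acts, and f(x) is injective on series bounded above in x.

Closure. In a sequence, let a coefficient of Y(a, x_0)b replace the adjacent pair a, b. The factors
linking b to the other entries form the wing polynomial. Modulo x_1 - x, the wing in x agrees with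
the wing in x_1, and x_1 - x becomes x_0 under the substitution. A high power of the wing therefore
supplies the factors missing for a, up to a high power of x_0 that does not reach the coefficient
considered. Induction on the x_0-exponent, cancelling f(x) each time, gives
`compatibleVia_update_yCoeff`. The new clearing polynomial is a power of the old one, so
compatibility and quasi-compatibility are handled together through a submonoid of polynomials
(`CompatibleFor`). Adjoining 1_W, adjoining coefficients and taking spans all preserve
`CompatibleFor`, so maximal subspaces contain 1_W and are closed. By Zorn's lemma S lies in a
maximal subspace, so the intersection defining ⟨S⟩ inherits its compatibility.

Weak associativity. The cleared triple product G is a genuine Laurent series at infinity. Both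
iterated vertex operators, multiplied by the same polynomial, become expansions of G
(`polyMul_rightSeries`, `polyMul_leftSeries`). These expansions agree by Vandermonde's identity
(`binomOp_comp`). The polynomial is x_0^l x_2^l (x_0 + x_2)^l times a factor equal to a nonzero f(x)
at x_0 = x_2 = 0. That factor and the monomials cancel, leaving (x_0 + x_2)^l
(`exists_polyMul_leftSeries_eq`).

The module identities are the defining equation of `YE` itself, with the same p. -/

namespace NonlocalVA

noncomputable section

open Function

set_option linter.unusedSectionVars false

/-! ### Polynomials acting on doubly infinite series. -/

section PolynomialAction

variable {σ τ M M' : Type*} [AddCommGroup M] [Module ℂ M] [AddCommGroup M'] [Module ℂ M']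

theorem polyMul_apply (p : MvPolynomial σ ℂ) (F : (σ → ℤ) → M) (m : σ → ℤ) :
    polyMul p F m = ∑ d ∈ p.support, p.coeff d • F (fun i => m i - (d i : ℤ)) := by
  simp [polyMul, LinearMap.sum_apply, Finset.sum_apply, LinearMap.funLeft_apply]

theorem polyMul_apply_of_subset (p : MvPolynomial σ ℂ) {s : Finset (σ →₀ ℕ)}
    (hs : p.support ⊆ s) (F : (σ → ℤ) → M) (m : σ → ℤ) :
    polyMul p F m = ∑ d ∈ s, p.coeff d • F (fun i => m i - (d i : ℤ)) := by
  rw [polyMul_apply]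
  refine Finset.sum_subset hs fun d _ hd => ?_
  rw [MvPolynomial.notMem_support_iff.mp hd, zero_smul]

theorem polyMul_add (p q : MvPolynomial σ ℂ) (F : (σ → ℤ) → M) :
    polyMul (p + q) F = polyMul p F + polyMul q F := by
  classical
  funext m
  rw [Pi.add_apply, polyMul_apply_of_subset _ MvPolynomial.support_add,
    polyMul_apply_of_subset p Finset.subset_union_left,
    polyMul_apply_of_subset q Finset.subset_union_right, ← Finset.sum_add_distrib]
  exact Finset.sum_congr rfl fun d _ => by rw [MvPolynomial.coeff_add, add_smul]

theorem polyMul_monomial (d : σ →₀ ℕ) (c : ℂ) (F : (σ → ℤ) → M) :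
    polyMul (MvPolynomial.monomial d c) F = fun m => c • F (fun i => m i - (d i : ℤ)) := by
  classical
  funext m
  rw [polyMul_apply_of_subset _ MvPolynomial.support_monomial_subset]
  simp

theorem polyMul_C (c : ℂ) (F : (σ → ℤ) → M) : polyMul (MvPolynomial.C c) F = c • F := by
  rw [← MvPolynomial.monomial_zero', polyMul_monomial]
  funext m
  simp

@[simp]
theorem polyMul_one (F : (σ → ℤ) → M) : polyMul (1 : MvPolynomial σ ℂ) F = F := by
  rw [← MvPolynomial.C_1, polyMul_C, one_smul]

theorem polyMul_mul (p q : MvPolynomial σ ℂ) (F : (σ → ℤ) → M) :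
    polyMul (p * q) F = polyMul p (polyMul q F) := by
  induction p using MvPolynomial.induction_on' with
  | add p p' hp hp' => rw [add_mul, polyMul_add, hp, hp', polyMul_add]
  | monomial d c =>
    induction q using MvPolynomial.induction_on' with
    | add q q' hq hq' => rw [mul_add, polyMul_add, hq, hq', polyMul_add, map_add]
    | monomial e b =>
      simp only [MvPolynomial.monomial_mul, polyMul_monomial]
      funext m
      rw [smul_smul]
      congr 2
      funext i
      simp
      ring

theorem polyMul_comm (p q : MvPolynomial σ ℂ) (F : (σ → ℤ) → M) :
    polyMul p (polyMul q F) = polyMul q (polyMul p F) := by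
  rw [← polyMul_mul, mul_comm, polyMul_mul]

theorem polyMul_X [DecidableEq σ] (i : σ) (F : (σ → ℤ) → M) :
    polyMul (MvPolynomial.X i) F = fun m => F (Function.update m i (m i - 1)) := by
  rw [MvPolynomial.X, polyMul_monomial]
  funext m
  rw [one_smul]
  congr 1
  funext j
  by_cases h : j = i
  · subst h; simp
  · simp [h, Finsupp.single_eq_of_ne]

theorem polyMul_X_apply [DecidableEq σ] (i : σ) (F : (σ → ℤ) → M) (m : σ → ℤ) :
    polyMul (MvPolynomial.X i) F m = F (Function.update m i (m i - 1)) :=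
  congrFun (polyMul_X i F) m

/-- Every support condition used below is shown stable under polynomials by checking single
variables only. -/
theorem polyMul_mem (D : Submodule ℂ ((σ → ℤ) → M))
    (hD : ∀ i, ∀ F ∈ D, polyMul (MvPolynomial.X i) F ∈ D) (p : MvPolynomial σ ℂ)
    {F : (σ → ℤ) → M} (hF : F ∈ D) : polyMul p F ∈ D := by
  induction p using MvPolynomial.induction_on generalizing F with
  | C c => rw [polyMul_C]; exact D.smul_mem c hF
  | add p q hp hq => rw [polyMul_add]; exact D.add_mem (hp hF) (hq hF)
  | mul_X p i hp => rw [polyMul_mul]; exact hp (hD i F hF)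

theorem polyMul_map (g : M →ₗ[ℂ] M') (p : MvPolynomial σ ℂ) (F : (σ → ℤ) → M) (m : σ → ℤ) :
    polyMul p (fun n => g (F n)) m = g (polyMul p F m) := by
  simp [polyMul_apply]

/-- Restricting a series to the variables indexed by `τ`, all the other exponents being fixed. -/
theorem polyMul_rename {ρ : τ → σ} (hρ : Function.Injective ρ) (q : MvPolynomial τ ℂ)
    (F : (σ → ℤ) → M) (n : τ → ℤ) (m : σ → ℤ) :
    polyMul (MvPolynomial.rename ρ q) F (Function.extend ρ n m) =
      polyMul q (fun n => F (Function.extend ρ n m)) n := by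
  classical
  induction q using MvPolynomial.induction_on generalizing F n with
  | C c => simp [polyMul_C]
  | add p q hp hq => simp [polyMul_add, hp, hq]
  | mul_X p i hp =>
    rw [map_mul, MvPolynomial.rename_X, polyMul_mul, polyMul_mul, hp]
    refine congrFun (congrArg (polyMul p) ?_) n
    funext n
    simp only [polyMul_X]
    congr 1
    funext s
    by_cases hs : ∃ t, ρ t = s
    · obtain ⟨t, rfl⟩ := hs
      rw [hρ.extend_apply]
      by_cases ht : t = i
      · subst ht; simp [hρ.extend_apply]
      · rw [Function.update_of_ne (hρ.ne ht), hρ.extend_apply, hρ.extend_apply,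
          Function.update_of_ne ht]
    · have : s ≠ ρ i := fun h => hs ⟨i, h.symm⟩
      rw [Function.update_of_ne this, Function.extend_apply' _ _ _ hs,
        Function.extend_apply' _ _ _ hs]

end PolynomialAction

/-! ### Substitution of binomial expansions. -/

section PascalOperators

variable {σ M M' : Type*} [DecidableEq σ] [AddCommGroup M] [Module ℂ M] [AddCommGroup M']
  [Module ℂ M']

/-- The algebra map `x_i ↦ x_i + x_j`. -/
def substAdd (i j : σ) : MvPolynomial σ ℂ →ₐ[ℂ] MvPolynomial σ ℂ :=
  MvPolynomial.aeval (update MvPolynomial.X i (MvPolynomial.X i + MvPolynomial.X j))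

theorem substAdd_X_self (i j : σ) :
    substAdd i j (MvPolynomial.X i) = MvPolynomial.X i + MvPolynomial.X j := by
  simp [substAdd]

theorem substAdd_X_of_ne {i k : σ} (j : σ) (h : k ≠ i) :
    substAdd i j (MvPolynomial.X k) = MvPolynomial.X k := by
  simp [substAdd, h]

theorem substAdd_rename {τ : Type*} [DecidableEq τ] {ρ : τ → σ} (hρ : Injective ρ) (i j : τ)
    (q : MvPolynomial τ ℂ) :
    substAdd (ρ i) (ρ j) (MvPolynomial.rename ρ q) = MvPolynomial.rename ρ (substAdd i j q) := by
  suffices h : (substAdd (ρ i) (ρ j)).comp (MvPolynomial.rename ρ) =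
      (MvPolynomial.rename ρ).comp (substAdd i j) from DFunLike.congr_fun h q
  refine MvPolynomial.algHom_ext fun k => ?_
  by_cases hk : k = i
  · subst hk; simp [substAdd_X_self]
  · simp [substAdd_X_of_ne, hk, hρ.ne hk]

/-- The operator on formal series which substitutes a binomial expansion of `x_i + x_j` for `x_i`;
`c l k` is the coefficient of `x_i^k x_j^{l-k}` in the expansion of `(x_i + x_j)^l`. -/
def binomOp (c : ℤ → ℤ → ℤ) (i j : σ) (F : (σ → ℤ) → M) : (σ → ℤ) → M := fun m =>
  ∑ᶠ l : ℤ, c l (m i) • F (update (update m i l) j (m j + m i - l))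

/-- The series to which `binomOp c i j` can be applied: all the sums are finite. -/
def binomDom (c : ℤ → ℤ → ℤ) (i j : σ) (M : Type*) [AddCommGroup M] [Module ℂ M] :
    Submodule ℂ ((σ → ℤ) → M) where
  carrier := {F | ∀ m : σ → ℤ,
    (support fun l : ℤ => c l (m i) • F (update (update m i l) j (m j + m i - l))).Finite}
  add_mem' := by
    intro F G hF hG m
    refine ((hF m).union (hG m)).subset fun l hl => ?_
    by_contra h
    simp only [Set.mem_union, mem_support, not_or, not_not] at h
    exact hl (by simp [smul_add, h.1, h.2])
  zero_mem' := by intro m; simp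
  smul_mem' := by
    intro a F hF m
    refine (hF m).subset fun l hl h => hl ?_
    change c l (m i) • (a • F _) = 0
    rw [smul_comm]
    exact (congrArg (a • ·) h).trans (smul_zero a)

variable {c : ℤ → ℤ → ℤ} {i j : σ}

theorem binomOp_add {F G : (σ → ℤ) → M} (hF : F ∈ binomDom c i j M) (hG : G ∈ binomDom c i j M) :
    binomOp c i j (F + G) = binomOp c i j F + binomOp c i j G := by
  funext m
  simp only [binomOp, Pi.add_apply, smul_add]
  exact finsum_add_distrib (hF m) (hG m)

theorem binomOp_smul (a : ℂ) {F : (σ → ℤ) → M} (hF : F ∈ binomDom c i j M) :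
    binomOp c i j (a • F) = a • binomOp c i j F := by
  funext m
  simp only [binomOp, Pi.smul_apply]
  rw [smul_finsum' a (hF m)]
  exact finsum_congr fun l => smul_comm _ _ _

/-- Pascal's rule for the coefficients of a binomial expansion. -/
def IsPascal (c : ℤ → ℤ → ℤ) : Prop := ∀ l k, c (l + 1) k = c l (k - 1) + c l k

/-- Pascal's rule splits each term of the sum into two, one with the exponent of x_i lowered and one
with that of x_j lowered. After the shift l ↦ l - 1 these are the two summands of (x_i + x_j) times
the substituted series. -/
theorem binomOp_X_self (hc : IsPascal c) (hij : i ≠ j) {F : (σ → ℤ) → M}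
    (hF : F ∈ binomDom c i j M) :
    polyMul (MvPolynomial.X i) F ∈ binomDom c i j M ∧
      binomOp c i j (polyMul (MvPolynomial.X i) F) =
        polyMul (MvPolynomial.X i + MvPolynomial.X j) (binomOp c i j F) := by
  have key : ∀ (m : σ → ℤ) (l : ℤ), c l (m i) •
      polyMul (MvPolynomial.X i) F (update (update m i l) j (m j + m i - l)) =
      c (l - 1) ((update m i (m i - 1)) i) • F (update (update (update m i (m i - 1)) i (l - 1)) j
        ((update m i (m i - 1)) j + (update m i (m i - 1)) i - (l - 1))) +
      c (l - 1) ((update m j (m j - 1)) i) • F (update (update (update m j (m j - 1)) i (l - 1)) j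
        ((update m j (m j - 1)) j + (update m j (m j - 1)) i - (l - 1))) := by
    intro m l
    have h := hc (l - 1) (m i)
    rw [sub_add_cancel] at h
    have e1 : update (update (update m i (m i - 1)) i (l - 1)) j
        ((update m i (m i - 1)) j + (update m i (m i - 1)) i - (l - 1)) =
        update (update m i (l - 1)) j (m j + m i - l) := by
      rw [update_idem, update_self, update_of_ne hij.symm]
      congr 1; ring
    have e2 : update (update (update m j (m j - 1)) i (l - 1)) j
        ((update m j (m j - 1)) j + (update m j (m j - 1)) i - (l - 1)) =
        update (update m i (l - 1)) j (m j + m i - l) := by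
      rw [update_self, update_of_ne hij, update_comm hij.symm, update_idem]
      congr 1; ring
    rw [e1, e2, update_self, update_of_ne hij, ← add_smul, ← h, polyMul_X_apply, update_of_ne hij,
      update_self, update_comm hij, update_idem]
    rw [update_comm hij.symm]
  have f1 : ∀ m : σ → ℤ, (support fun l : ℤ => c (l - 1) (m i) • F (update (update m i (l - 1)) j
      (m j + m i - (l - 1)))).Finite := fun m =>
    ((hF m).preimage (Equiv.subRight (1 : ℤ)).injective.injOn)
  constructor
  · intro m
    refine ((f1 (update m i (m i - 1))).union (f1 (update m j (m j - 1)))).subset fun l hl => ?_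
    by_contra h
    simp only [Set.mem_union, mem_support, not_or, not_not] at h
    exact hl ((key m l).trans (by rw [h.1, h.2, add_zero]))
  · funext m
    have g1 : ∀ m : σ → ℤ, ∑ᶠ l : ℤ, c (l - 1) (m i) • F (update (update m i (l - 1)) j
        (m j + m i - (l - 1))) = binomOp c i j F m := fun m =>
      finsum_comp_equiv (Equiv.subRight (1 : ℤ))
        (f := fun l => c l (m i) • F (update (update m i l) j (m j + m i - l)))
    rw [polyMul_add, Pi.add_apply, polyMul_X_apply, polyMul_X_apply, ← g1, ← g1, ← finsum_add_distrib
      (f1 _) (f1 _)]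
    exact finsum_congr fun l => key m l

theorem binomOp_X_right (hij : i ≠ j) {F : (σ → ℤ) → M} (hF : F ∈ binomDom c i j M) :
    polyMul (MvPolynomial.X j) F ∈ binomDom c i j M ∧
      binomOp c i j (polyMul (MvPolynomial.X j) F) =
        polyMul (MvPolynomial.X j) (binomOp c i j F) := by
  have key : ∀ (m : σ → ℤ) (l : ℤ), c l (m i) •
      polyMul (MvPolynomial.X j) F (update (update m i l) j (m j + m i - l)) =
      c l ((update m j (m j - 1)) i) • F (update (update (update m j (m j - 1)) i l) j
        ((update m j (m j - 1)) j + (update m j (m j - 1)) i - l)) := by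
    intro m l
    rw [polyMul_X_apply, update_idem, update_self, update_of_ne hij, update_self,
      update_comm hij.symm _ _ m, update_idem]
    congr 3; ring
  constructor
  · intro m
    simp only [key]
    exact hF _
  · funext m
    rw [polyMul_X_apply]
    exact finsum_congr fun l => key m l

theorem binomOp_X_of_ne {k : σ} (hi : k ≠ i) (hj : k ≠ j) {F : (σ → ℤ) → M}
    (hF : F ∈ binomDom c i j M) :
    polyMul (MvPolynomial.X k) F ∈ binomDom c i j M ∧
      binomOp c i j (polyMul (MvPolynomial.X k) F) =
        polyMul (MvPolynomial.X k) (binomOp c i j F) := by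
  have key : ∀ (m : σ → ℤ) (l : ℤ), c l (m i) •
      polyMul (MvPolynomial.X k) F (update (update m i l) j (m j + m i - l)) =
      c l ((update m k (m k - 1)) i) • F (update (update (update m k (m k - 1)) i l) j
        ((update m k (m k - 1)) j + (update m k (m k - 1)) i - l)) := by
    intro m l
    rw [polyMul_X_apply, update_of_ne hj, update_of_ne hi, update_of_ne hi.symm, update_of_ne hj.symm,
      update_comm hi _ _ m, update_comm hj]
  constructor
  · intro m
    simp only [key]
    exact hF _
  · funext m
    rw [polyMul_X_apply]
    exact finsum_congr fun l => key m l

theorem binomOp_X (hc : IsPascal c) (hij : i ≠ j) (k : σ) {F : (σ → ℤ) → M}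
    (hF : F ∈ binomDom c i j M) :
    polyMul (MvPolynomial.X k) F ∈ binomDom c i j M ∧
      binomOp c i j (polyMul (MvPolynomial.X k) F) =
        polyMul (substAdd i j (MvPolynomial.X k)) (binomOp c i j F) := by
  by_cases hi : k = i
  · subst hi; rw [substAdd_X_self]; exact binomOp_X_self hc hij hF
  rw [substAdd_X_of_ne j hi]
  by_cases hj : k = j
  · subst hj; exact binomOp_X_right hij hF
  · exact binomOp_X_of_ne hi hj hF

theorem polyMul_mem_binomDom (hc : IsPascal c) (hij : i ≠ j) (q : MvPolynomial σ ℂ)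
    {F : (σ → ℤ) → M} (hF : F ∈ binomDom c i j M) : polyMul q F ∈ binomDom c i j M :=
  polyMul_mem _ (fun k _ hF => (binomOp_X hc hij k hF).1) q hF

theorem binomOp_polyMul (hc : IsPascal c) (hij : i ≠ j) (q : MvPolynomial σ ℂ)
    {F : (σ → ℤ) → M} (hF : F ∈ binomDom c i j M) :
    binomOp c i j (polyMul q F) = polyMul (substAdd i j q) (binomOp c i j F) := by
  induction q using MvPolynomial.induction_on generalizing F with
  | C a =>
    rw [polyMul_C, binomOp_smul a hF, ← MvPolynomial.algebraMap_eq, AlgHom.commutes,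
      MvPolynomial.algebraMap_eq, polyMul_C]
  | add p q hp hq =>
    rw [polyMul_add, binomOp_add (polyMul_mem_binomDom hc hij _ hF)
      (polyMul_mem_binomDom hc hij _ hF), hp hF, hq hF, map_add, polyMul_add]
  | mul_X p k hp =>
    rw [polyMul_mul, hp (binomOp_X hc hij k hF).1, (binomOp_X hc hij k hF).2, map_mul, polyMul_mul]

theorem extend_update_update {τ : Type*} [DecidableEq τ] {ρ : τ → σ} (hρ : Injective ρ)
    (i j : τ) (n : τ → ℤ) (m : σ → ℤ) (l : ℤ) :
    update (update (extend ρ n m) (ρ i) l) (ρ j)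
        ((extend ρ n m) (ρ j) + (extend ρ n m) (ρ i) - l) =
      extend ρ (update (update n i l) j (n j + n i - l)) m := by
  rw [hρ.extend_apply, hρ.extend_apply]
  funext s
  by_cases hs : ∃ t, ρ t = s
  · obtain ⟨t, rfl⟩ := hs
    rw [hρ.extend_apply]
    simp [update_apply, hρ.eq_iff, hρ.extend_apply]
  · have h : ∀ t, s ≠ ρ t := fun t h => hs ⟨t, h.symm⟩
    rw [update_of_ne (h j), update_of_ne (h i), extend_apply' _ _ _ hs, extend_apply' _ _ _ hs]

/-- `binomOp` acts on the variables `x_i`, `x_j` only. -/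
theorem binomOp_extend {τ : Type*} [DecidableEq τ] {ρ : τ → σ} (hρ : Injective ρ)
    (i j : τ) (F : (σ → ℤ) → M) (n : τ → ℤ) (m : σ → ℤ) :
    binomOp c (ρ i) (ρ j) F (extend ρ n m) =
      binomOp c i j (fun n => F (extend ρ n m)) n := by
  refine finsum_congr fun l => ?_
  rw [extend_update_update hρ i j, hρ.extend_apply]

/-- The coefficients of the expansion in nonnegative powers of `x_i`. -/
def chooseLeft (l k : ℤ) : ℤ := if 0 ≤ k then Ring.choose l k.toNat else 0

/-- The coefficients of the expansion in nonnegative powers of `x_j`. -/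
def chooseRight (l k : ℤ) : ℤ := chooseLeft l (l - k)

theorem isPascal_chooseLeft : IsPascal chooseLeft := by
  intro l k
  unfold chooseLeft
  rcases lt_trichotomy k 0 with h | rfl | h
  · rw [if_neg h.not_ge, if_neg h.not_ge, if_neg (by omega), add_zero]
  · simp
  · obtain ⟨n, rfl⟩ : ∃ n : ℕ, k = n + 1 := ⟨(k - 1).toNat, by omega⟩
    rw [if_pos h.le, if_pos (by omega), if_pos h.le, add_sub_cancel_right]
    have : ((n : ℤ) + 1).toNat = n + 1 := by omega
    rw [this, Int.toNat_natCast, Ring.choose_succ_succ]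

theorem isPascal_chooseRight : IsPascal chooseRight := by
  intro l k
  have := isPascal_chooseLeft l (l + 1 - k)
  unfold chooseRight
  rw [this, add_comm]
  congr 2 <;> ring

theorem binomOp_chooseLeft_of_neg (F : (σ → ℤ) → M) {m : σ → ℤ} (hm : m i < 0) :
    binomOp chooseLeft i j F m = 0 := by
  refine finsum_eq_zero_of_forall_eq_zero fun l => ?_
  rw [chooseLeft, if_neg (not_le.mpr hm), zero_smul]

theorem binomOp_map (g : M →ₗ[ℂ] M') {F : (σ → ℤ) → M} (hF : F ∈ binomDom c i j M) (m : σ → ℤ) :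
    binomOp c i j (fun n => g (F n)) m = g (binomOp c i j F m) := by
  unfold binomOp
  have h := AddMonoidHom.map_finsum g.toAddMonoidHom (hF m)
  refine Eq.trans ?_ h.symm
  exact finsum_congr fun l => (map_zsmul g.toAddMonoidHom _ _).symm

end PascalOperators

/-! ### Laurent series at infinity and products of operators. -/

section LaurentAtInfinity

variable {W : Type*} [AddCommGroup W] [Module ℂ W] {r : ℕ}

theorem polyMul_mem_laurentAtInfinity (p : MvPolynomial (Fin r) ℂ) {F : (Fin r → ℤ) → W}
    (hF : F ∈ LaurentAtInfinity r W) : polyMul p F ∈ LaurentAtInfinity r W := by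
  refine polyMul_mem _ (fun i F hF => ?_) p hF
  obtain ⟨N, hN⟩ := hF
  refine ⟨N + 1, fun m hm k => ?_⟩
  rw [polyMul_X_apply] at hm
  have := hN _ hm k
  by_cases hk : k = i
  · subst hk; rw [update_self] at this; omega
  · rw [update_of_ne hk] at this; omega

theorem laurentAtInfinity_le_binomDom (c : ℤ → ℤ → ℤ) {i j : Fin r} (hij : i ≠ j) :
    LaurentAtInfinity r W ≤ binomDom c i j W := by
  rintro F ⟨N, hN⟩ m
  refine (Set.finite_Icc (m j + m i - N) N).subset fun l hl => ?_
  have h : F (update (update m i l) j (m j + m i - l)) ≠ 0 := fun h => hl (by simp [h])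
  have h0 := hN _ h i
  have h1 := hN _ h j
  rw [update_of_ne hij, update_self] at h0
  rw [update_self] at h1
  constructor <;> omega

theorem CompatibleVia.of_dvd {p q : MvPolynomial (Fin 2) ℂ} (hpq : p ∣ q) {a : Fin r → EInf W}
    (h : CompatibleVia p a) : CompatibleVia q a := by
  obtain ⟨s, rfl⟩ := hpq
  intro w
  have := polyMul_mem_laurentAtInfinity
    (∏ i : Fin r, ∏ j ∈ Finset.Ioi i, MvPolynomial.rename ![i, j] s) (h w)
  rw [clearedProduct, LinearMap.comp_apply, ← polyMul_mul] at this
  rw [clearedProduct, LinearMap.comp_apply]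
  convert this using 2
  simp only [map_mul, Finset.prod_mul_distrib]
  rw [mul_comm]

theorem productSeries_apply (a : Fin r → EInf W) (w : W) (m : Fin r → ℤ) :
    productSeries a w m = (List.ofFn fun i => (a i).coeffX (m i)).prod w := rfl

theorem productSeries_pair (a b : EInf W) (w : W) (m : Fin 2 → ℤ) :
    productSeries ![a, b] w m = a.coeffX (m 0) (b.coeffX (m 1) w) := by
  simp [productSeries_apply]

theorem clearedProduct_pair (p : MvPolynomial (Fin 2) ℂ) (a b : EInf W) (w : W) :
    clearedProduct p ![a, b] w = polyMul p (productSeries ![a, b] w) := by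
  rw [clearedProduct, LinearMap.comp_apply]
  congr 1
  have h0 : Finset.Ioi (0 : Fin 2) = {1} := rfl
  have h1 : Finset.Ioi (1 : Fin 2) = ∅ := rfl
  rw [Fin.prod_univ_two, h0, h1, Finset.prod_singleton, Finset.prod_empty, mul_one]
  have : (![0, 1] : Fin 2 → Fin 2) = id := by ext i; fin_cases i <;> rfl
  rw [this, MvPolynomial.rename_id_apply]

theorem compatibleVia_pair {p : MvPolynomial (Fin 2) ℂ} {a b : EInf W} :
    CompatibleVia p ![a, b] ↔
      ∀ w, polyMul p (productSeries ![a, b] w) ∈ LaurentAtInfinity 2 W := by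
  simp only [CompatibleVia, clearedProduct_pair]

theorem coeffX_apply (a : EInf W) (n : ℤ) (w : W) :
    a.coeffX n w = ((HahnModule.of ℂ).symm (a w)).coeff (-n) := rfl

theorem EInf.ext {a b : EInf W} (h : ∀ n w, a.coeffX n w = b.coeffX n w) : a = b := by
  ext w n
  have := h (-n) w
  rwa [coeffX_apply, coeffX_apply, neg_neg] at this

theorem EInf.exists_bound (a : EInf W) (w : W) : ∃ N : ℤ, ∀ n, N < n → a.coeffX n w = 0 := by
  refine ⟨-((HahnModule.of ℂ).symm (a w)).order, fun n hn => ?_⟩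
  rw [coeffX_apply]
  exact HahnSeries.coeff_eq_zero_of_lt_order (by omega)

theorem coeffX_idW (n : ℤ) (w : W) : (EInf.idW W).coeffX n w = if n = 0 then w else 0 := by
  rw [coeffX_apply]
  change (HahnSeries.single 0 w).coeff (-n) = _
  split_ifs with h
  · simp [h]
  · rw [HahnSeries.coeff_single_of_ne (by simpa using h)]

end LaurentAtInfinity

/-! ### Elements of ℰᵒ(W)((x_0)) as series in two variables. -/

section Evaluation

variable {W : Type*} [AddCommGroup W] [Module ℂ W]

/-- The series `S(x_0, x) w` of an element `S` of `ℰᵒ(W)((x_0))` and a vector `w`. -/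
def toSeries (S : EInfLaurent W) (w : W) : (Fin 2 → ℤ) → W := fun m =>
  (((HahnModule.of LaurentInf).symm S).coeff (m 0)).coeffX (m 1) w

theorem toSeries_injective {S T : EInfLaurent W} (h : ∀ w, toSeries S w = toSeries T w) :
    S = T := by
  apply (HahnModule.of LaurentInf).symm.injective
  ext1
  funext k
  exact EInf.ext fun n w => congrFun (h w) ![k, n]

theorem toSeries_add (S T : EInfLaurent W) (w : W) :
    toSeries (S + T) w = toSeries S w + toSeries T w := rfl

theorem EInfLaurent.add_smul (f g : LaurentSeries LaurentInf) (S : EInfLaurent W) :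
    (f + g) • S = f • S + g • S :=
  Module.add_smul f g S

theorem C_smul_EInf (c : ℂ) (a : EInf W) : LaurentInf.C c • a = c • a := by
  refine LinearMap.ext fun w => ?_
  change (HahnSeries.C c : LaurentSeries ℂ) • a w = c • a w
  exact HahnModule.single_zero_smul_eq_smul ℤ

theorem coeffX_x_smul (a : EInf W) (n : ℤ) (w : W) :
    (LaurentInf.x • a).coeffX n w = a.coeffX (n - 1) w := by
  have := HahnModule.coeff_single_smul_vadd (r := (1 : ℂ)) (x := a w) (a := -(n - 1)) (b := -1)
  rw [one_smul] at this
  rw [coeffX_apply, coeffX_apply, ← this]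
  change ((HahnModule.of ℂ).symm ((HahnSeries.single (-1) 1 : LaurentSeries ℂ) • a w)).coeff _ = _
  congr 1
  simp only [vadd_eq_add]
  ring

theorem toSeries_C_smul (f : LaurentInf) (S : EInfLaurent W) (w : W) (m : Fin 2 → ℤ) :
    toSeries ((HahnSeries.C f : LaurentSeries LaurentInf) • S) w m =
      (f • ((HahnModule.of LaurentInf).symm S).coeff (m 0)).coeffX (m 1) w := by
  unfold toSeries
  congr 2
  exact HahnModule.coeff_single_zero_smul

theorem toSeries_single_smul (S : EInfLaurent W) (w : W) (m : Fin 2 → ℤ) :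
    toSeries ((HahnSeries.single 1 1 : LaurentSeries LaurentInf) • S) w m =
      toSeries S w ![m 0 - 1, m 1] := by
  have := HahnModule.coeff_single_smul_vadd (r := (1 : LaurentInf)) (x := S) (a := m 0 - 1)
    (b := (1 : ℤ))
  rw [one_smul] at this
  unfold toSeries
  simp only [Matrix.cons_val_zero, Matrix.cons_val_one]
  rw [← this]
  congr 3
  simp

/-- The bridge from the field ℂ((x⁻¹))((x_0)) to coefficient calculus: ι only ever acts through
polynomials, so it suffices to compare constants and the two variables. -/
theorem toSeries_iotaDiag_smul (p : MvPolynomial (Fin 2) ℂ) (S : EInfLaurent W) (w : W) :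
    toSeries (iotaDiag p • S) w = polyMul (substAdd 0 1 p) (toSeries S w) := by
  have hx : ∀ T : EInfLaurent W, toSeries ((HahnSeries.C LaurentInf.x : LaurentSeries LaurentInf)
      • T) w = polyMul (MvPolynomial.X 1) (toSeries T w) := by
    intro T
    funext m
    rw [toSeries_C_smul, coeffX_x_smul, polyMul_X_apply]
    simp [toSeries]
  have h0 : ∀ T : EInfLaurent W, toSeries ((HahnSeries.single 1 1 : LaurentSeries LaurentInf)
      • T) w = polyMul (MvPolynomial.X 0) (toSeries T w) := by
    intro T
    funext m
    rw [toSeries_single_smul, polyMul_X_apply]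
    simp [toSeries]
  induction p using MvPolynomial.induction_on generalizing S with
  | C c =>
    rw [← MvPolynomial.algebraMap_eq, AlgHom.commutes, MvPolynomial.algebraMap_eq, polyMul_C]
    funext m
    have : iotaDiag (MvPolynomial.C c) = HahnSeries.C (LaurentInf.C c) := by simp [iotaDiag]
    rw [this, toSeries_C_smul, C_smul_EInf]
    rfl
  | add p q hp hq => rw [map_add, EInfLaurent.add_smul, toSeries_add, hp, hq, map_add, polyMul_add]
  | mul_X p i hp =>
    rw [map_mul, mul_smul, hp, map_mul, polyMul_mul]
    congr 1
    fin_cases i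
    · have : iotaDiag (MvPolynomial.X 0) =
          HahnSeries.single 1 1 + HahnSeries.C LaurentInf.x := by simp [iotaDiag]
      simp only [Fin.zero_eta, Fin.isValue, this, substAdd_X_self, polyMul_add, EInfLaurent.add_smul,
        toSeries_add, hx, h0]
    · have : iotaDiag (MvPolynomial.X 1) = HahnSeries.C LaurentInf.x := by simp [iotaDiag]
      simp only [Fin.mk_one, Fin.isValue, this, hx]
      rw [substAdd_X_of_ne _ (by decide)]

theorem binomOp_pair (F : (Fin 2 → ℤ) → W) (m : Fin 2 → ℤ) :
    binomOp chooseLeft 0 1 F m = if 0 ≤ m 0 then diagCoeff F (m 0).toNat (m 1) else 0 := by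
  split_ifs with h
  · refine finsum_congr fun l => ?_
    rw [chooseLeft, if_pos h, Int.toNat_of_nonneg h]
    congr 2
    ext i
    fin_cases i <;> simp
  · exact binomOp_chooseLeft_of_neg F (not_le.mp h)

theorem toSeries_substProduct (p : MvPolynomial (Fin 2) ℂ) (a b : EInf W)
    (h : CompatibleVia p ![a, b]) (w : W) :
    toSeries (substProduct p a b h) w =
      binomOp chooseLeft 0 1 (polyMul p (productSeries ![a, b] w)) := by
  funext m
  rw [binomOp_pair, ← clearedProduct_pair]
  change EInf.coeffX (if 0 ≤ m 0 then _ else 0) _ _ = _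
  split_ifs with h0
  · change diagCoeff (clearedProduct p ![a, b] w) (m 0).toNat (- - m 1) = _
    rw [neg_neg]
  · rfl

end Evaluation

/-- The substitution x_i ↦ x_i - x_j is a left inverse. -/
theorem substAdd_injective {σ : Type*} [DecidableEq σ] {i j : σ} (hij : i ≠ j) :
    Injective (substAdd i j) := by
  let f : MvPolynomial σ ℂ →ₐ[ℂ] MvPolynomial σ ℂ :=
    MvPolynomial.aeval (update MvPolynomial.X i (MvPolynomial.X i - MvPolynomial.X j))
  suffices h : f.comp (substAdd i j) = AlgHom.id ℂ (MvPolynomial σ ℂ) from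
    Function.LeftInverse.injective (g := f) fun p => DFunLike.congr_fun h p
  refine MvPolynomial.algHom_ext fun k => ?_
  by_cases hk : k = i
  · subst hk; simp [f, substAdd_X_self, hij.symm]
  · simp [f, substAdd_X_of_ne, hk]

theorem iotaDiag_ne_zero {p : MvPolynomial (Fin 2) ℂ} (hp : p ≠ 0) : iotaDiag p ≠ 0 := by
  intro h
  apply hp
  apply substAdd_injective (zero_ne_one : (0 : Fin 2) ≠ 1)
  rw [map_zero]
  set q := substAdd 0 1 p
  -- Multiplying the constant series 1 by q returns the coefficients of q, so q = 0 once ι(p) acts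
  -- as zero.
  let S : EInfLaurent ℂ := HahnModule.of LaurentInf (HahnSeries.single 0 (EInf.idW ℂ))
  have hS : ∀ m, toSeries S 1 m = if m = 0 then 1 else 0 := by
    intro m
    change ((HahnSeries.single 0 (EInf.idW ℂ)).coeff (m 0)).coeffX (m 1) 1 = _
    by_cases h0 : m 0 = 0
    · rw [h0, HahnSeries.coeff_single_same, coeffX_idW]
      congr 1
      rw [eq_iff_iff]
      constructor
      · intro h1; ext i; fin_cases i <;> assumption
      · rintro rfl; rfl
    · rw [HahnSeries.coeff_single_of_ne h0, if_neg (fun h => h0 (by rw [h]; rfl))]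
      rfl
  have h1 := toSeries_iotaDiag_smul p S 1
  rw [h, show (0 : LaurentSeries LaurentInf) • S = 0 from HahnModule.zero_smul'] at h1
  ext d
  have h2 := congrFun h1 fun i => (d i : ℤ)
  rw [polyMul_apply, Finset.sum_eq_single d] at h2
  · rw [hS, if_pos (by ext i; simp), smul_eq_mul, mul_one] at h2
    rw [MvPolynomial.coeff_zero]
    exact h2.symm
  · intro e _ he
    rw [hS, if_neg, smul_zero]
    intro h3
    apply he
    ext i
    have := congrFun h3 i
    simp only [Pi.zero_apply] at this
    omega
  · intro hd
    rw [MvPolynomial.notMem_support_iff.mp hd, zero_smul]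

/-! ### Characterization of the vertex operator map, linearity and the vacuum. -/

section YE

variable {W : Type*} [AddCommGroup W] [Module ℂ W] {a b : EInf W} {p : MvPolynomial (Fin 2) ℂ}

/-- Both sides are the substituted series of p q a(x_1) b(x). This is the independence of the
clearing polynomial. -/
theorem iotaDiag_smul_substProduct (p q : MvPolynomial (Fin 2) ℂ) (hp : CompatibleVia p ![a, b])
    (hq : CompatibleVia q ![a, b]) :
    iotaDiag p • substProduct q a b hq = iotaDiag q • substProduct p a b hp := by
  have h01 : (0 : Fin 2) ≠ 1 := zero_ne_one
  refine toSeries_injective fun w => ?_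
  rw [toSeries_iotaDiag_smul, toSeries_iotaDiag_smul, toSeries_substProduct, toSeries_substProduct,
    ← binomOp_polyMul isPascal_chooseLeft h01, ← binomOp_polyMul isPascal_chooseLeft h01,
    polyMul_comm]
  · exact laurentAtInfinity_le_binomDom _ h01 (compatibleVia_pair.mp hp w)
  · exact laurentAtInfinity_le_binomDom _ h01 (compatibleVia_pair.mp hq w)

theorem iotaDiag_smul_YE (hp : p ≠ 0) (h : CompatibleVia p ![a, b]) :
    iotaDiag p • YE a b = substProduct p a b h := by
  have hq : QuasiCompatibleSeq ![a, b] := ⟨p, hp, h⟩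
  rw [YE, dif_pos hq, smul_smul, mul_comm, mul_smul,
    iotaDiag_smul_substProduct p _ h hq.choose_spec.2, smul_smul,
    inv_mul_cancel₀ (iotaDiag_ne_zero hq.choose_spec.1), one_smul]

theorem polyMul_toSeries_YE (hp : p ≠ 0) (h : CompatibleVia p ![a, b]) (w : W) :
    polyMul (substAdd 0 1 p) (toSeries (YE a b) w) =
      binomOp chooseLeft 0 1 (polyMul p (productSeries ![a, b] w)) := by
  rw [← toSeries_iotaDiag_smul, iotaDiag_smul_YE hp h, toSeries_substProduct]

/-- Uniqueness holds because ι(p) is invertible. Linearity and the left vacuum property follow by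
checking this one equation. -/
theorem eq_YE (hp : p ≠ 0) (h : CompatibleVia p ![a, b]) {S : EInfLaurent W}
    (hS : ∀ w, polyMul (substAdd 0 1 p) (toSeries S w) =
      binomOp chooseLeft 0 1 (polyMul p (productSeries ![a, b] w))) : S = YE a b := by
  have h1 : iotaDiag p • S = iotaDiag p • YE a b := by
    rw [iotaDiag_smul_YE hp h]
    refine toSeries_injective fun w => ?_
    rw [toSeries_iotaDiag_smul, toSeries_substProduct, hS]
  have h2 := congrArg ((iotaDiag p)⁻¹ • ·) h1
  simpa only [smul_smul, inv_mul_cancel₀ (iotaDiag_ne_zero hp), one_smul] using h2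

theorem mem_binomDom_of_compatibleVia (h : CompatibleVia p ![a, b]) (w : W) :
    polyMul p (productSeries ![a, b] w) ∈ binomDom chooseLeft 0 1 W :=
  laurentAtInfinity_le_binomDom _ zero_ne_one (compatibleVia_pair.mp h w)

theorem YE_add_left {a' : EInf W} (h : QuasiCompatibleSeq ![a, b])
    (h' : QuasiCompatibleSeq ![a', b]) : YE (a + a') b = YE a b + YE a' b := by
  obtain ⟨p, hp, h⟩ := h
  obtain ⟨q, hq, h'⟩ := h'
  replace h := h.of_dvd (dvd_mul_right p q)
  replace h' := h'.of_dvd (dvd_mul_left q p)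
  have hs : ∀ w, productSeries ![a + a', b] w =
      productSeries ![a, b] w + productSeries ![a', b] w := by
    intro w
    funext m
    simp only [Pi.add_apply, productSeries_pair]
    rfl
  refine (eq_YE (mul_ne_zero hp hq) ?_ fun w => ?_).symm
  · rw [compatibleVia_pair] at h h' ⊢
    intro w
    rw [hs, map_add]
    exact add_mem (h w) (h' w)
  · rw [toSeries_add, map_add, polyMul_toSeries_YE (mul_ne_zero hp hq) h,
      polyMul_toSeries_YE (mul_ne_zero hp hq) h', hs, map_add,
      binomOp_add (mem_binomDom_of_compatibleVia h w) (mem_binomDom_of_compatibleVia h' w)]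

theorem YE_add_right {b' : EInf W} (h : QuasiCompatibleSeq ![a, b])
    (h' : QuasiCompatibleSeq ![a, b']) : YE a (b + b') = YE a b + YE a b' := by
  obtain ⟨p, hp, h⟩ := h
  obtain ⟨q, hq, h'⟩ := h'
  replace h := h.of_dvd (dvd_mul_right p q)
  replace h' := h'.of_dvd (dvd_mul_left q p)
  have hs : ∀ w, productSeries ![a, b + b'] w =
      productSeries ![a, b] w + productSeries ![a, b'] w := by
    intro w
    funext m
    simp only [Pi.add_apply, productSeries_pair, ← map_add]
    rfl
  refine (eq_YE (mul_ne_zero hp hq) ?_ fun w => ?_).symm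
  · rw [compatibleVia_pair] at h h' ⊢
    intro w
    rw [hs, map_add]
    exact add_mem (h w) (h' w)
  · rw [toSeries_add, map_add, polyMul_toSeries_YE (mul_ne_zero hp hq) h,
      polyMul_toSeries_YE (mul_ne_zero hp hq) h', hs, map_add,
      binomOp_add (mem_binomDom_of_compatibleVia h w) (mem_binomDom_of_compatibleVia h' w)]

theorem toSeries_smul (c : ℂ) (S : EInfLaurent W) (w : W) :
    toSeries (HahnModule.of LaurentInf (c • (HahnModule.of LaurentInf).symm S)) w =
      c • toSeries S w := rfl

theorem YE_smul_left (c : ℂ) (h : QuasiCompatibleSeq ![a, b]) :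
    YE (c • a) b = HahnModule.of LaurentInf (c • (HahnModule.of LaurentInf).symm (YE a b)) := by
  obtain ⟨p, hp, h⟩ := h
  have hs : ∀ w, productSeries ![c • a, b] w = c • productSeries ![a, b] w := by
    intro w
    funext m
    simp only [Pi.smul_apply, productSeries_pair]
    rfl
  refine (eq_YE hp ?_ fun w => ?_).symm
  · rw [compatibleVia_pair] at h ⊢
    intro w
    rw [hs, map_smul]
    exact Submodule.smul_mem _ _ (h w)
  · rw [toSeries_smul, map_smul, polyMul_toSeries_YE hp h, hs, map_smul,
      binomOp_smul _ (mem_binomDom_of_compatibleVia h w)]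

theorem YE_smul_right (c : ℂ) (h : QuasiCompatibleSeq ![a, b]) :
    YE a (c • b) = HahnModule.of LaurentInf (c • (HahnModule.of LaurentInf).symm (YE a b)) := by
  obtain ⟨p, hp, h⟩ := h
  have hs : ∀ w, productSeries ![a, c • b] w = c • productSeries ![a, b] w := by
    intro w
    funext m
    simp only [Pi.smul_apply, productSeries_pair]
    exact map_smul (a.coeffX (m 0)) c _
  refine (eq_YE hp ?_ fun w => ?_).symm
  · rw [compatibleVia_pair] at h ⊢
    intro w
    rw [hs, map_smul]
    exact Submodule.smul_mem _ _ (h w)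
  · rw [toSeries_smul, map_smul, polyMul_toSeries_YE hp h, hs, map_smul,
      binomOp_smul _ (mem_binomDom_of_compatibleVia h w)]

theorem YE_idW_left (b : EInf W) :
    YE (EInf.idW W) b = HahnModule.of LaurentInf (HahnSeries.single 0 b) := by
  have hs : ∀ (w : W) (m : Fin 2 → ℤ), productSeries ![EInf.idW W, b] w m =
      if m 0 = 0 then b.coeffX (m 1) w else 0 := by
    intro w m
    rw [productSeries_pair, coeffX_idW]
  refine (eq_YE one_ne_zero (compatibleVia_pair.mpr fun w => ?_) fun w => ?_).symm
  · obtain ⟨N, hN⟩ := b.exists_bound w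
    rw [polyMul_one]
    refine ⟨max 0 N, fun m hm => ?_⟩
    rw [hs] at hm
    by_cases h0 : m 0 = 0
    · rw [if_pos h0] at hm
      have h1 : m 1 ≤ N := not_lt.mp fun h => hm (hN _ h)
      rw [Fin.forall_fin_two]
      exact ⟨h0.le.trans (le_max_left _ _), h1.trans (le_max_right _ _)⟩
    · rw [if_neg h0] at hm
      exact absurd rfl hm
  · rw [map_one, polyMul_one, polyMul_one]
    funext m
    unfold binomOp
    rw [finsum_eq_single _ 0]
    · rw [hs, if_pos (by simp), update_self]
      change ((HahnSeries.single 0 b).coeff (m 0)).coeffX (m 1) w = _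
      by_cases h0 : m 0 = 0
      · rw [h0, HahnSeries.coeff_single_same]
        simp [chooseLeft]
      · rw [HahnSeries.coeff_single_of_ne h0, chooseLeft]
        split_ifs with h
        · rw [Ring.choose_zero_pos ℤ (by omega), zero_smul]
          rfl
        · rw [zero_smul]
          rfl
    · intro l hl
      rw [hs, if_neg (by simpa using hl), smul_zero]

/-- Here p = 1 clears the pair, and Y(a, x_0)1_W is simply a(x + x_0). -/
theorem toSeries_YE_idW_right (a : EInf W) (w : W) (m : Fin 2 → ℤ) :
    toSeries (YE a (EInf.idW W)) w m = chooseLeft (m 1 + m 0) (m 0) • a.coeffX (m 1 + m 0) w := by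
  have hs : ∀ (w : W) (m : Fin 2 → ℤ), productSeries ![a, EInf.idW W] w m =
      if m 1 = 0 then a.coeffX (m 0) w else 0 := by
    intro w m
    rw [productSeries_pair, coeffX_idW]
    split_ifs <;> simp
  have hc : CompatibleVia 1 ![a, EInf.idW W] := by
    refine compatibleVia_pair.mpr fun w => ?_
    obtain ⟨N, hN⟩ := a.exists_bound w
    rw [polyMul_one]
    refine ⟨max 0 N, fun m hm => ?_⟩
    rw [hs] at hm
    by_cases h0 : m 1 = 0
    · rw [if_pos h0] at hm
      have h1 : m 0 ≤ N := not_lt.mp fun h => hm (hN _ h)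
      rw [Fin.forall_fin_two]
      exact ⟨h1.trans (le_max_right _ _), h0.le.trans (le_max_left _ _)⟩
    · rw [if_neg h0] at hm
      exact absurd rfl hm
  have h1 := polyMul_toSeries_YE one_ne_zero hc w
  rw [map_one, polyMul_one, polyMul_one] at h1
  rw [h1]
  unfold binomOp
  rw [finsum_eq_single _ (m 1 + m 0)]
  · rw [hs, if_pos (by simp)]
    congr 2
  · intro l hl
    rw [hs, if_neg, smul_zero]
    rw [update_self]
    omega

end YE

/-! ### Lowest-order factorization of a polynomial. -/

section Factorization

theorem mvPolynomial_algHom_sub_mem {σ A : Type*} [CommRing A] [Algebra ℂ A] (I : Ideal A)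
    (f g : MvPolynomial σ ℂ →ₐ[ℂ] A)
    (h : ∀ i, f (MvPolynomial.X i) - g (MvPolynomial.X i) ∈ I) (p : MvPolynomial σ ℂ) :
    f p - g p ∈ I := by
  have : (Ideal.Quotient.mkₐ ℂ I).comp f = (Ideal.Quotient.mkₐ ℂ I).comp g := by
    refine MvPolynomial.algHom_ext fun i => ?_
    exact Ideal.Quotient.eq.mpr (h i)
  exact Ideal.Quotient.eq.mp (DFunLike.congr_fun this p)

/-- A nonzero polynomial in `x_0, x_1` is a power of `x_0` times a polynomial which does not
vanish at `x_0 = 0`. -/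
theorem mvPolynomial_exists_eq_X_pow_mul {p : MvPolynomial (Fin 2) ℂ} (hp : p ≠ 0) :
    ∃ (l : ℕ) (q s : MvPolynomial (Fin 2) ℂ) (f : Polynomial ℂ), f ≠ 0 ∧
      p = MvPolynomial.X 0 ^ l * q ∧
      q = Polynomial.aeval (MvPolynomial.X 1) f + MvPolynomial.X 0 * s := by
  have hX : FiniteMultiplicity (MvPolynomial.X 0 : MvPolynomial (Fin 2) ℂ) p :=
    FiniteMultiplicity.of_prime_left MvPolynomial.X_prime hp
  obtain ⟨q, hq, hq'⟩ := hX.exists_eq_pow_mul_and_not_dvd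
  -- f is q at x_0 = 0. It is nonzero because all factors x_0 have been removed from q.
  let f : Polynomial ℂ := MvPolynomial.aeval ![0, Polynomial.X] q
  have h := mvPolynomial_algHom_sub_mem (Ideal.span {(MvPolynomial.X 0 : MvPolynomial (Fin 2) ℂ)})
    (AlgHom.id ℂ _) ((Polynomial.aeval (MvPolynomial.X 1)).comp
      (MvPolynomial.aeval ![0, (Polynomial.X : Polynomial ℂ)])) (by
      intro i
      rw [Ideal.mem_span_singleton]
      fin_cases i <;> simp) q
  rw [Ideal.mem_span_singleton] at h
  obtain ⟨s, hs⟩ := h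
  have hqs : q = Polynomial.aeval (MvPolynomial.X 1) f + MvPolynomial.X 0 * s := by
    rw [← hs]
    simp [f]
  refine ⟨_, q, s, f, ?_, hq, hqs⟩
  intro hf
  rw [hf, map_zero, zero_add] at hqs
  exact hq' ⟨s, hqs⟩

end Factorization

/-! ### Cancelling polynomials from series with one-sided support. -/

section Cancellation

variable {σ M : Type*} [DecidableEq σ] [AddCommGroup M] [Module ℂ M]

/-- Series in which the exponents of `x_i` are bounded above when those of the other variables
are fixed. -/
def sliceBdd (i : σ) (M : Type*) [AddCommGroup M] [Module ℂ M] :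
    Submodule ℂ ((σ → ℤ) → M) where
  carrier := {F | ∀ m, ∃ N : ℤ, ∀ n, N < n → F (update m i n) = 0}
  add_mem' := by
    intro F G hF hG m
    obtain ⟨N, hN⟩ := hF m
    obtain ⟨N', hN'⟩ := hG m
    refine ⟨max N N', fun n hn => ?_⟩
    rw [Pi.add_apply, hN n (lt_of_le_of_lt (le_max_left _ _) hn),
      hN' n (lt_of_le_of_lt (le_max_right _ _) hn), add_zero]
  zero_mem' := fun m => ⟨0, fun n _ => rfl⟩
  smul_mem' := by
    intro c F hF m
    obtain ⟨N, hN⟩ := hF m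
    exact ⟨N, fun n hn => by rw [Pi.smul_apply, hN n hn, smul_zero]⟩

theorem polyMul_mem_sliceBdd {i : σ} (p : MvPolynomial σ ℂ) {F : (σ → ℤ) → M}
    (hF : F ∈ sliceBdd i M) : polyMul p F ∈ sliceBdd i M := by
  refine polyMul_mem _ (fun k F hF => ?_) p hF
  intro m
  by_cases hk : k = i
  · subst hk
    obtain ⟨N, hN⟩ := hF m
    refine ⟨N + 1, fun n hn => ?_⟩
    rw [polyMul_X_apply, update_idem, update_self]
    exact hN _ (by omega)
  · obtain ⟨N, hN⟩ := hF (update m k (m k - 1))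
    refine ⟨N, fun n hn => ?_⟩
    rw [polyMul_X_apply, update_of_ne hk, update_comm (Ne.symm hk)]
    exact hN n hn

theorem polyMul_aeval_X (i : σ) (f : Polynomial ℂ) (F : (σ → ℤ) → M) (m : σ → ℤ) :
    polyMul (Polynomial.aeval (MvPolynomial.X i) f) F m =
      f.sum fun k c => c • F (update m i (m i - k)) := by
  have hpow : ∀ (k : ℕ) (m : σ → ℤ), polyMul (MvPolynomial.X i ^ k) F m =
      F (update m i (m i - k)) := by
    intro k
    induction k with
    | zero => intro m; simp
    | succ k ih =>
      intro m
      rw [pow_succ', polyMul_mul, polyMul_X_apply, ih, update_idem, update_self]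
      congr 2
      push_cast
      ring
  induction f using Polynomial.induction_on' with
  | add f g hf hg =>
    rw [map_add, polyMul_add, Pi.add_apply, hf, hg, Polynomial.sum_add_index]
    · intro k; rw [zero_smul]
    · intro k a b; rw [add_smul]
  | monomial k c =>
    rw [Polynomial.aeval_monomial, polyMul_mul, MvPolynomial.algebraMap_eq, polyMul_C,
      Pi.smul_apply, hpow, Polynomial.sum_monomial_index]
    rw [zero_smul]

/-- Leading-term argument. The threshold N is kept so that the lemma transfers upper bounds on
exponents as well as vanishing. -/
theorem polyMul_aeval_X_cancel {i : σ} {f : Polynomial ℂ} (hf : f ≠ 0) {F : (σ → ℤ) → M}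
    (hF : F ∈ sliceBdd i M) {m : σ → ℤ} {N : ℤ}
    (h : ∀ n, N < n → polyMul (Polynomial.aeval (MvPolynomial.X i) f) F (update m i n) = 0) :
    ∀ n, N < n → F (update m i n) = 0 := by
  by_contra! hne
  obtain ⟨B, hB⟩ := hF m
  obtain ⟨n, ⟨hn, hn0⟩, hmax⟩ := Int.exists_greatest_of_bdd
    (P := fun n => N < n ∧ F (update m i n) ≠ 0)
    ⟨B, fun n hn => not_lt.mp fun h => hn.2 (hB n h)⟩ hne
  -- At this exponent only the leading coefficient of f meets a nonzero coefficient of F, since n is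
  -- the greatest exponent above N with F nonzero.
  have h1 := h (n + f.natDegree) (by omega)
  rw [polyMul_aeval_X, Polynomial.sum_def, Finset.sum_eq_single f.natDegree] at h1
  · rw [update_idem, update_self, add_sub_cancel_right] at h1
    exact hn0 ((smul_eq_zero.mp h1).resolve_left (Polynomial.leadingCoeff_ne_zero.mpr hf))
  · intro k hk hkn
    have hk' : k < f.natDegree := lt_of_le_of_ne (Polynomial.le_natDegree_of_mem_supp k hk) hkn
    rw [update_idem, update_self]
    by_contra h0
    have := hmax (n + f.natDegree - k) ⟨by omega, fun h2 => h0 (by rw [h2, smul_zero])⟩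
    omega
  · intro hk
    rw [Polynomial.notMem_support_iff.mp hk, zero_smul]

theorem polyMul_aeval_X_cancel_apply {i : σ} {f : Polynomial ℂ} (hf : f ≠ 0) {F : (σ → ℤ) → M}
    (hF : F ∈ sliceBdd i M) {m : σ → ℤ}
    (h : ∀ n, polyMul (Polynomial.aeval (MvPolynomial.X i) f) F (update m i n) = 0) :
    F m = 0 := by
  have := polyMul_aeval_X_cancel hf hF (N := m i - 1) (fun n _ => h n) (m i) (by omega)
  rwa [update_eq_self] at this

theorem mem_laurentAtInfinity_of_polyMul_aeval_X {r : ℕ} {i : Fin r} {f : Polynomial ℂ}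
    (hf : f ≠ 0) {F : (Fin r → ℤ) → M} (hF : F ∈ sliceBdd i M)
    (h : polyMul (Polynomial.aeval (MvPolynomial.X i) f) F ∈ LaurentAtInfinity r M) :
    F ∈ LaurentAtInfinity r M := by
  obtain ⟨N, hN⟩ := h
  refine ⟨N, fun m hm k => not_lt.mp fun hk => hm ?_⟩
  by_cases hki : k = i
  · subst hki
    have := polyMul_aeval_X_cancel hf hF (m := m) (N := N) (fun n hn => by
      by_contra h0
      have := hN _ h0 k
      rw [update_self] at this
      omega) (m k) hk
    rwa [update_eq_self] at this
  · refine polyMul_aeval_X_cancel_apply hf hF fun n => ?_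
    by_contra h0
    have := hN _ h0 k
    rw [update_of_ne hki] at this
    omega

theorem polyMul_X_pow_cancel {i : σ} {l : ℕ} {F : (σ → ℤ) → M}
    (h : polyMul (MvPolynomial.X i ^ l) F = 0) : F = 0 := by
  induction l with
  | zero => simpa using h
  | succ l ih =>
    apply ih
    rw [pow_succ', polyMul_mul] at h
    funext m
    have := congrFun h (update m i (m i + 1))
    rwa [polyMul_X_apply, update_idem, update_self, add_sub_cancel_right, update_eq_self] at this

/-- Series in which only exponents of `x_i` greater than `a` occur. -/
def halfZero (i : σ) (a : ℤ) (M : Type*) [AddCommGroup M] [Module ℂ M] :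
    Submodule ℂ ((σ → ℤ) → M) where
  carrier := {F | ∀ m, m i ≤ a → F m = 0}
  add_mem' := fun hF hG m hm => by rw [Pi.add_apply, hF m hm, hG m hm, add_zero]
  zero_mem' := fun m _ => rfl
  smul_mem' := fun c F hF m hm => by rw [Pi.smul_apply, hF m hm, smul_zero]

theorem polyMul_mem_halfZero {i : σ} {a : ℤ} (p : MvPolynomial σ ℂ) {F : (σ → ℤ) → M}
    (hF : F ∈ halfZero i a M) : polyMul p F ∈ halfZero i a M := by
  refine polyMul_mem _ (fun k F hF m hm => ?_) p hF
  rw [polyMul_X_apply]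
  apply hF
  by_cases hk : i = k
  · subst hk; rw [update_self]; omega
  · rwa [update_of_ne hk]

/-- After removal of x_0^l the factor is f(x_1) + x_0 s. By induction on the exponent of x_0 the
term x_0 s sees only coefficients already known to vanish, so f(x_1) alone must be cancelled. -/
theorem polyMul_cancel {p : MvPolynomial (Fin 2) ℂ} (hp : p ≠ 0) {F : (Fin 2 → ℤ) → M} {N : ℤ}
    (hN : F ∈ halfZero 0 N M) (hF : F ∈ sliceBdd 1 M) (h : polyMul p F = 0) : F = 0 := by
  obtain ⟨l, q, s, f, hf, rfl, rfl⟩ := mvPolynomial_exists_eq_X_pow_mul hp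
  rw [polyMul_mul] at h
  replace h := polyMul_X_pow_cancel h
  suffices hk : ∀ k : ℕ, F ∈ halfZero 0 (N + k) M by
    funext m
    exact hk (m 0 - N).toNat m (by omega)
  intro k
  induction k with
  | zero => simpa using hN
  | succ k ih =>
    intro m hm
    rcases lt_or_eq_of_le hm with hm | hm
    · exact ih m (by push_cast at hm; omega)
    refine polyMul_aeval_X_cancel_apply hf hF fun n => ?_
    have h1 := congrFun h (update m 1 n)
    rw [polyMul_add, Pi.add_apply, polyMul_mul, polyMul_X_apply,
      polyMul_mem_halfZero s ih _ _, add_zero] at h1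
    · exact h1
    · rw [update_self, update_of_ne (by decide), hm]
      push_cast
      omega

/-- Series without exponents `(m_i, m_j) ≤ (a, b)`. -/
def quadrantZero (i j : σ) (a b : ℤ) (M : Type*) [AddCommGroup M] [Module ℂ M] :
    Submodule ℂ ((σ → ℤ) → M) where
  carrier := {F | ∀ m, m i ≤ a → m j ≤ b → F m = 0}
  add_mem' := fun hF hG m hm hm' => by rw [Pi.add_apply, hF m hm hm', hG m hm hm', add_zero]
  zero_mem' := fun m _ _ => rfl
  smul_mem' := fun c F hF m hm hm' => by rw [Pi.smul_apply, hF m hm hm', smul_zero]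

theorem polyMul_mem_quadrantZero {i j : σ} {a b : ℤ} (p : MvPolynomial σ ℂ) {F : (σ → ℤ) → M}
    (hF : F ∈ quadrantZero i j a b M) : polyMul p F ∈ quadrantZero i j a b M := by
  refine polyMul_mem _ (fun k F hF m hm hm' => ?_) p hF
  rw [polyMul_X_apply]
  apply hF
  · by_cases hk : i = k
    · subst hk; rw [update_self]; omega
    · rwa [update_of_ne hk]
  · by_cases hk : j = k
    · subst hk; rw [update_self]; omega
    · rwa [update_of_ne hk]

/-- Multiplication by a polynomial in `x_i, x_j, x_k` which is nonzero at `x_i = x_j = 0` is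
injective on series which are bounded below in `x_i`, and then in `x_j`, and bounded above in
`x_k`. The statement is localized at a down-closed set of exponents of `x_i` and `x_j`. -/
theorem polyMul_cancel_of_lower {i j k : σ} (hij : i ≠ j) (hik : i ≠ k) (hjk : j ≠ k)
    {f : Polynomial ℂ} (hf : f ≠ 0) (g h : MvPolynomial σ ℂ) {F : (σ → ℤ) → M}
    {N : ℤ} (hN : F ∈ halfZero i N M)
    (hN' : ∀ a, ∃ B, ∀ m, m i = a → m j ≤ B → F m = 0) (hF : F ∈ sliceBdd k M)
    {Q : ℤ → ℤ → Prop} (hQi : ∀ a b, Q a b → Q (a - 1) b) (hQj : ∀ a b, Q a b → Q a (b - 1))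
    (hu : ∀ m, Q (m i) (m j) → polyMul (Polynomial.aeval (MvPolynomial.X k) f +
      MvPolynomial.X i * g + MvPolynomial.X j * h) F m = 0) :
    ∀ m, Q (m i) (m j) → F m = 0 := by
  -- Double induction: first on the exponent of x_i from N, then on that of x_j from a bound B that
  -- depends on the exponent of x_i. The terms with x_i g and x_j h fall into quadrants already
  -- treated, leaving f(x_k).
  suffices hZ : ∀ (s : ℕ) (b : ℤ), Q (N + s) b → F ∈ quadrantZero i j (N + s) b M by
    intro m hm
    by_cases hmN : m i ≤ N
    · exact hN m hmN
    · have : N + (m i - N).toNat = m i := by omega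
      exact hZ (m i - N).toNat (m j) (by rwa [this]) m (by omega) le_rfl
  intro s
  induction s with
  | zero => intro b _ m hm _; exact hN m (by simpa using hm)
  | succ s ih =>
    obtain ⟨B, hB⟩ := hN' (N + (s + 1 : ℕ))
    have hcast : N + ((s + 1 : ℕ) : ℤ) - 1 = N + s := by push_cast; ring
    have ih' : ∀ b, Q (N + (s + 1 : ℕ)) b → F ∈ quadrantZero i j (N + s) b M := by
      intro b hb
      exact ih b (by rw [← hcast]; exact hQi _ _ hb)
    have hstep : ∀ (t : ℕ), Q (N + (s + 1 : ℕ)) (B + t) →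
        F ∈ quadrantZero i j (N + (s + 1 : ℕ)) (B + t) M := by
      intro t
      induction t with
      | zero =>
        intro hQ m hm hm'
        rcases lt_or_eq_of_le hm with hm | hm
        · exact ih' _ hQ m (by omega) hm'
        · exact hB m hm (by simpa using hm')
      | succ t iht =>
        intro hQ m hm hm'
        rcases lt_or_eq_of_le hm with hm | hm
        · exact ih' _ hQ m (by omega) hm'
        have hcast' : B + ((t + 1 : ℕ) : ℤ) - 1 = B + t := by push_cast; ring
        have hQ' := hQj _ _ hQ
        rw [hcast'] at hQ'
        rcases lt_or_eq_of_le hm' with hm' | hm'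
        · exact iht hQ' m hm.le (by omega)
        refine polyMul_aeval_X_cancel_apply hf hF fun n => ?_
        have h1 := hu (update m k n) (by rwa [update_of_ne hik, update_of_ne hjk, hm, hm'])
        rw [polyMul_add, polyMul_add, Pi.add_apply, Pi.add_apply, polyMul_mul, polyMul_mul,
          polyMul_X_apply, polyMul_X_apply,
          polyMul_mem_quadrantZero g (ih' _ hQ) _ _ _,
          polyMul_mem_quadrantZero h (iht hQ') _ _ _, add_zero, add_zero] at h1
        · exact h1
        · rw [update_of_ne hij, update_of_ne hik, hm]
        · rw [update_self, update_of_ne hjk, hm', hcast']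
        · rw [update_self, update_of_ne hik, hm, hcast]
        · rw [update_of_ne hij.symm, update_of_ne hjk, hm']
    intro b hb m hm hm'
    by_cases hbB : b ≤ B
    · rcases lt_or_eq_of_le hm with hm | hm
      · exact ih' _ hb m (by omega) hm'
      · exact hB m hm (hm'.trans hbB)
    · have : B + ((b - B).toNat : ℤ) = b := by omega
      have h1 := hstep (b - B).toNat (by rwa [this])
      rw [this] at h1
      exact h1 m hm hm'

end Cancellation

/-! ### Ordered products of operators and products over pairs of variables. -/

section Products

/-- The same outer factors L and R serve the product with one operator at position i and the product
with two adjacent ones. This is what lets identities for pairs be used inside longer products. -/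
theorem exists_prod_ofFn_update {G : Type*} [Monoid G] {r : ℕ} (i : Fin r) (g : Fin r → G) :
    ∃ L R : G, (∀ B, (List.ofFn (update g i B)).prod = L * B * R) ∧
      ∀ A B, (List.ofFn ((i.castSucc.insertNth A (update g i B) : Fin (r + 1) → G))).prod =
        L * A * B * R := by
  induction r with
  | zero => exact i.elim0
  | succ r ih =>
    induction i using Fin.cases with
    | zero =>
      refine ⟨1, (List.ofFn fun k => g k.succ).prod, fun B => ?_, fun A B => ?_⟩
      · simp [List.ofFn_succ]
      · simp only [List.ofFn_succ, Fin.castSucc_zero, List.prod_cons]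
        rw [Fin.insertNth_zero']
        simp [mul_assoc]
    | succ i =>
      obtain ⟨L, R, h1, h2⟩ := ih i (fun k => g k.succ)
      have hu : ∀ B k, update g i.succ B k.succ = update (fun k => g k.succ) i B k := by
        intro B k
        simp [update_apply]
      refine ⟨g 0 * L, R, fun B => ?_, fun A B => ?_⟩
      · simp only [List.ofFn_succ (n := r), List.prod_cons, hu]
        rw [h1 B, update_of_ne (Fin.succ_ne_zero i).symm]
        simp only [mul_assoc]
      · rw [List.ofFn_succ, List.prod_cons]
        have h0 : (Fin.insertNth i.succ.castSucc A (update g i.succ B) : Fin (r + 2) → G) 0 = g 0 := by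
          have h : (0 : Fin (r + 2)) = i.succ.castSucc.succAbove 0 := by
            rw [Fin.succAbove_of_castSucc_lt]
            · rfl
            · exact Fin.succ_pos i
          rw [h, Fin.insertNth_apply_succAbove, update_of_ne (Fin.succ_ne_zero i).symm]
        have hs : (fun k : Fin (r + 1) =>
            (Fin.insertNth i.succ.castSucc A (update g i.succ B) : Fin (r + 2) → G) k.succ) =
            Fin.insertNth i.castSucc A (update (fun k => g k.succ) i B) := by
          rw [Fin.eq_insertNth_iff]
          constructor
          · rw [← Fin.castSucc_succ, Fin.insertNth_apply_same]
          · funext k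
            simp only [Fin.removeNth]
            rw [← hu, ← Fin.succ_succAbove_succ, Fin.succ_castSucc, Fin.insertNth_apply_succAbove]
        rw [h0, hs, h2]
        simp only [mul_assoc]

theorem exists_prod_ofFn_insertNth {G : Type*} [Monoid G] {r : ℕ} (i : Fin (r + 1))
    (g : Fin r → G) :
    ∃ L R : G, L * R = (List.ofFn g).prod ∧
      ∀ A, (List.ofFn ((i.insertNth A g : Fin (r + 1) → G))).prod = L * A * R := by
  induction r with
  | zero =>
    refine ⟨1, 1, by simp, fun A => ?_⟩
    obtain rfl : i = 0 := Fin.fin_one_eq_zero i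
    simp
  | succ r ih =>
    induction i using Fin.cases with
    | zero =>
      refine ⟨1, (List.ofFn g).prod, one_mul _, fun A => ?_⟩
      rw [List.ofFn_succ, Fin.insertNth_zero']
      simp
    | succ i =>
      obtain ⟨L, R, h1, h2⟩ := ih i (fun k => g k.succ)
      refine ⟨g 0 * L, R, ?_, fun A => ?_⟩
      · rw [List.ofFn_succ, List.prod_cons, ← h1, mul_assoc]
      · rw [List.ofFn_succ, List.prod_cons]
        have h0 : (Fin.insertNth i.succ A g : Fin (r + 2) → G) 0 = g 0 := by
          have h : (0 : Fin (r + 2)) = i.succ.succAbove 0 := by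
            rw [Fin.succAbove_of_castSucc_lt]
            · rfl
            · exact Fin.succ_pos i
          rw [h, Fin.insertNth_apply_succAbove]
        have hs : (fun k : Fin (r + 1) =>
            (Fin.insertNth i.succ A g : Fin (r + 2) → G) k.succ) =
            Fin.insertNth i A (fun k => g k.succ) := by
          rw [Fin.eq_insertNth_iff]
          constructor
          · rw [Fin.insertNth_apply_same]
          · funext k
            simp only [Fin.removeNth]
            rw [← Fin.succ_succAbove_succ, Fin.insertNth_apply_succAbove]
        rw [h0, hs, h2]
        simp only [mul_assoc]

variable {r : ℕ} (p : MvPolynomial (Fin 2) ℂ)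

/-- The factor `p(x_k, x_l)` for `k < l`. -/
def pairPoly (k l : Fin r) : MvPolynomial (Fin r) ℂ :=
  if k < l then MvPolynomial.rename ![k, l] p else 1

/-- The product `∏_{i<j} p(x_i, x_j)`. -/
def pairProd (r : ℕ) : MvPolynomial (Fin r) ℂ :=
  ∏ i : Fin r, ∏ j ∈ Finset.Ioi i, MvPolynomial.rename ![i, j] p

theorem clearedProduct_apply {W : Type*} [AddCommGroup W] [Module ℂ W] (a : Fin r → EInf W)
    (w : W) : clearedProduct p a w = polyMul (pairProd p r) (productSeries a w) := rfl

/-- The product of all the factors `p(x_k, x_l)`, `k < l`, with `k = i` or `l = i`. -/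
def wingProd (i : Fin r) : MvPolynomial (Fin r) ℂ := (∏ l, pairPoly p i l) * ∏ k, pairPoly p k i

theorem pairProd_eq : pairProd p r = ∏ k, ∏ l, pairPoly p k l := by
  unfold pairProd pairPoly
  refine Finset.prod_congr rfl fun k _ => ?_
  rw [Finset.prod_ite, Finset.prod_const_one, mul_one]
  congr 1
  ext l
  simp

theorem pairProd_pow (n : ℕ) : pairProd (p ^ n) r = pairProd p r ^ n := by
  simp only [pairProd, map_pow, Finset.prod_pow]

theorem pairProd_succ (j : Fin (r + 1)) :
    pairProd p (r + 1) = (∏ l, pairPoly p j (j.succAbove l)) *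
      (∏ k, pairPoly p (j.succAbove k) j) * MvPolynomial.rename j.succAbove (pairProd p r) := by
  have h : ∀ k l : Fin r, pairPoly p (j.succAbove k) (j.succAbove l) =
      MvPolynomial.rename j.succAbove (pairPoly p k l) := by
    intro k l
    unfold pairPoly
    simp only [Fin.succAbove_lt_succAbove_iff]
    split_ifs
    · rw [MvPolynomial.rename_rename]
      congr 2
      ext t; fin_cases t <;> rfl
    · simp
  rw [pairProd_eq, pairProd_eq, Fin.prod_univ_succAbove _ j, Fin.prod_univ_succAbove _ j]
  simp only [Fin.prod_univ_succAbove _ j, h, Finset.prod_mul_distrib, map_prod]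
  have : pairPoly p j j = 1 := if_neg (lt_irrefl j)
  rw [this, one_mul, mul_assoc]

/-- Each of the two products in the wing divides `pairProd` separately. The square makes it
unnecessary to show that they involve disjoint factors. -/
theorem wingProd_dvd (i : Fin r) : wingProd p i ∣ pairProd p r ^ 2 := by
  rw [sq, pairProd_eq]
  refine mul_dvd_mul ?_ ?_
  · exact Finset.dvd_prod_of_mem (fun k => ∏ l, pairPoly p k l) (Finset.mem_univ i)
  · exact Finset.prod_dvd_prod_of_dvd _ _ fun k _ =>
      Finset.dvd_prod_of_mem (fun l => pairPoly p k l) (Finset.mem_univ i)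

/-- When position i is doubled, the full product consists of the factor of the new pair, the factors
of the old product, and a copy of the wing of i in the new variable. This copy of the wing is what
the closure argument has to produce. -/
theorem pairProd_castSucc (i : Fin r) :
    pairProd p (r + 1) = MvPolynomial.rename ![i.castSucc, i.castSucc.succAbove i] p *
      MvPolynomial.rename (update i.castSucc.succAbove i i.castSucc) (wingProd p i) *
        MvPolynomial.rename i.castSucc.succAbove (pairProd p r) := by
  rw [pairProd_succ p i.castSucc]
  congr 1
  rw [wingProd, map_mul, map_prod, map_prod, ← mul_assoc]
  have hlt : ∀ l, i.castSucc < i.castSucc.succAbove l ↔ i ≤ l := by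
    intro l
    rw [Fin.lt_succAbove_iff_le_castSucc]
    simp
  have hgt : ∀ l, i.castSucc.succAbove l < i.castSucc ↔ l < i := by
    intro l
    rw [Fin.succAbove_lt_iff_castSucc_lt]
    simp
  congr 1
  · have h : ∀ l, pairPoly p i.castSucc (i.castSucc.succAbove l) =
        (if l = i then MvPolynomial.rename ![i.castSucc, i.castSucc.succAbove i] p else 1) *
          MvPolynomial.rename (update i.castSucc.succAbove i i.castSucc) (pairPoly p i l) := by
      intro l
      unfold pairPoly
      simp only [hlt]
      by_cases hl : l = i
      · subst hl; simp
      · by_cases hil : i < l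
        · rw [if_pos hil.le, if_neg hl, if_pos hil, one_mul, MvPolynomial.rename_rename]
          congr 2
          ext t; fin_cases t <;> simp [hl]
        · rw [if_neg (fun h => hil (lt_of_le_of_ne h (Ne.symm hl))), if_neg hl, if_neg hil, one_mul,
            map_one]
    simp only [h, Finset.prod_mul_distrib, Finset.prod_ite_eq', Finset.mem_univ, if_true]
  · refine Finset.prod_congr rfl fun k _ => ?_
    unfold pairPoly
    simp only [hgt]
    split_ifs with hk
    · rw [MvPolynomial.rename_rename]
      congr 2
      ext t; fin_cases t <;> simp [hk.ne]
    · simp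

end Products

/-! ### Coefficients with respect to one variable. -/

section Slices

variable {σ τ M : Type*} [AddCommGroup M] [Module ℂ M]

theorem extend_comp_self {ρ : τ → σ} (hρ : Injective ρ) (m : σ → ℤ) :
    extend ρ (m ∘ ρ) m = m := by
  funext s
  by_cases hs : ∃ t, ρ t = s
  · obtain ⟨t, rfl⟩ := hs
    rw [hρ.extend_apply, comp_apply]
  · rw [extend_apply' _ _ _ hs]

theorem mem_binomDom_of_slices [DecidableEq σ] [DecidableEq τ] {c : ℤ → ℤ → ℤ} {ρ : τ → σ}
    (hρ : Injective ρ) {i j : τ} {F : (σ → ℤ) → M}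
    (h : ∀ m, (fun n => F (extend ρ n m)) ∈ binomDom c i j M) :
    F ∈ binomDom c (ρ i) (ρ j) M := by
  intro m
  have := h m (m ∘ ρ)
  simp only [← extend_update_update hρ, extend_comp_self hρ] at this
  exact this

/-- Polynomials free of x_i may thus be moved inside the substitution for x_i. -/
theorem substAdd_rename_of_ne [DecidableEq σ] {ρ : τ → σ} {i : σ} (j : σ) (h : ∀ t, ρ t ≠ i)
    (q : MvPolynomial τ ℂ) :
    substAdd i j (MvPolynomial.rename ρ q) = MvPolynomial.rename ρ q := by
  suffices h : (substAdd i j).comp (MvPolynomial.rename ρ) = MvPolynomial.rename ρ from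
    DFunLike.congr_fun h q
  refine MvPolynomial.algHom_ext fun k => ?_
  simp [substAdd_X_of_ne _ (h k)]

theorem insertNth_eq_extend {r : ℕ} (p : Fin (r + 1)) (k : ℤ) (n : Fin r → ℤ) :
    (p.insertNth k n : Fin (r + 1) → ℤ) = extend p.succAbove n (fun _ => k) := by
  symm
  rw [Fin.eq_insertNth_iff]
  constructor
  · rw [extend_apply']
    rintro ⟨t, ht⟩
    exact Fin.succAbove_ne p t ht
  · funext t
    exact Fin.succAbove_right_injective.extend_apply _ _ _

theorem polyMul_rename_succAbove {r : ℕ} (p : Fin (r + 1)) (q : MvPolynomial (Fin r) ℂ)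
    (F : (Fin (r + 1) → ℤ) → M) (k : ℤ) :
    (fun n => polyMul (MvPolynomial.rename p.succAbove q) F (p.insertNth k n)) =
      polyMul q (fun n => F (p.insertNth k n)) := by
  funext n
  simp only [insertNth_eq_extend]
  exact polyMul_rename Fin.succAbove_right_injective q F n _

theorem polyMul_X_insertNth {r : ℕ} (p : Fin (r + 1)) (F : (Fin (r + 1) → ℤ) → M) (k : ℤ)
    (n : Fin r → ℤ) :
    polyMul (MvPolynomial.X p) F (p.insertNth k n) = F (p.insertNth (k - 1) n) := by
  rw [polyMul_X_apply, Fin.insertNth_apply_same, Fin.update_insertNth]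

/-- Series for which the coefficients of `x_p^k`, `k ≤ e`, lie in
`W((x_1^{-1}, …, x_r^{-1}))`. -/
def sliceLaurent {r : ℕ} (p : Fin (r + 1)) (e : ℤ) (M : Type*) [AddCommGroup M] [Module ℂ M] :
    Submodule ℂ ((Fin (r + 1) → ℤ) → M) where
  carrier := {F | ∀ k ≤ e, (fun n => F (p.insertNth k n)) ∈ LaurentAtInfinity r M}
  add_mem' := fun hF hG k hk => add_mem (hF k hk) (hG k hk)
  zero_mem' := fun _ _ => zero_mem _
  smul_mem' := fun c _ hF k hk => Submodule.smul_mem _ c (hF k hk)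

variable {r : ℕ} {p : Fin (r + 1)} {e : ℤ}

theorem polyMul_X_mem_sliceLaurent {F : (Fin (r + 1) → ℤ) → M}
    (hF : F ∈ sliceLaurent p (e - 1) M) :
    polyMul (MvPolynomial.X p) F ∈ sliceLaurent p e M := by
  intro k hk
  simp only [polyMul_X_insertNth]
  exact hF (k - 1) (by omega)

theorem sliceLaurent_mono {e' : ℤ} (h : e' ≤ e) : sliceLaurent p e M ≤ sliceLaurent p e' M :=
  fun _ hF k hk => hF k (hk.trans h)

theorem polyMul_mem_sliceLaurent (q : MvPolynomial (Fin (r + 1)) ℂ) {F : (Fin (r + 1) → ℤ) → M}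
    (hF : F ∈ sliceLaurent p e M) : polyMul q F ∈ sliceLaurent p e M := by
  refine polyMul_mem _ (fun i F hF => ?_) q hF
  induction i using p.succAboveCases with
  | x => exact polyMul_X_mem_sliceLaurent (sliceLaurent_mono (by omega) hF)
  | p t =>
    intro k hk
    rw [← MvPolynomial.rename_X, polyMul_rename_succAbove]
    exact polyMul_mem_laurentAtInfinity _ (hF k hk)

theorem mem_sliceLaurent_of_X_pow (l : ℕ) {F : (Fin (r + 1) → ℤ) → M}
    (h : polyMul (MvPolynomial.X p ^ l) F ∈ sliceLaurent p (e + l) M) :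
    F ∈ sliceLaurent p e M := by
  induction l generalizing F with
  | zero => simpa using h
  | succ l ih =>
    rw [pow_succ', polyMul_mul] at h
    refine ih fun k hk => ?_
    have := h (k + 1) (by push_cast; omega)
    simpa only [polyMul_X_insertNth, add_sub_cancel_right] using this

theorem halfZero_le_sliceLaurent : halfZero p e M ≤ sliceLaurent p e M := by
  intro F hF k hk
  convert zero_mem (LaurentAtInfinity r M) using 1
  funext n
  exact hF _ (by rwa [Fin.insertNth_apply_same])

theorem polyMul_X_pow_mem_halfZero [DecidableEq σ] {i : σ} {a : ℤ} (l : ℕ) {F : (σ → ℤ) → M}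
    (hF : F ∈ halfZero i a M) : polyMul (MvPolynomial.X i ^ l) F ∈ halfZero i (a + l) M := by
  induction l with
  | zero => simpa using hF
  | succ l ih =>
    intro m hm
    rw [pow_succ', polyMul_mul, polyMul_X_apply]
    exact ih _ (by rw [update_self]; push_cast at hm; omega)

theorem binomOp_mem_sliceLaurent {F : (Fin (r + 1) → ℤ) → M}
    (hF : F ∈ LaurentAtInfinity (r + 1) M) (i : Fin r) :
    binomOp chooseLeft p (p.succAbove i) F ∈ sliceLaurent p e M := by
  obtain ⟨N, hN⟩ := hF
  intro k _
  -- Only k ≥ 0 contributes. With l ≤ N and n_i + k - l ≤ N this gives n_i ≤ 2N; the other exponents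
  -- are unchanged and at most N.
  refine ⟨max N (2 * N), fun n hn t => ?_⟩
  simp only at hn
  by_cases hk : k < 0
  · exact absurd (binomOp_chooseLeft_of_neg _ (by rwa [Fin.insertNth_apply_same])) hn
  obtain ⟨l, hl⟩ : ∃ l : ℤ, F (update (update (p.insertNth k n) p l) (p.succAbove i)
      ((p.insertNth k n : Fin (r + 1) → ℤ) (p.succAbove i) +
        (p.insertNth k n : Fin (r + 1) → ℤ) p - l)) ≠ 0 := by
    by_contra! h
    exact hn (finsum_eq_zero_of_forall_eq_zero fun l => by rw [h, smul_zero])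
  have hp := hN _ hl p
  have ht := hN _ hl (p.succAbove t)
  rw [update_of_ne (Fin.succAbove_ne p i).symm, update_self] at hp
  rw [Fin.insertNth_apply_same, Fin.insertNth_apply_succAbove] at ht
  by_cases hti : t = i
  · subst hti
    rw [update_self] at ht
    have : n t ≤ 2 * N := by omega
    exact this.trans (le_max_right _ _)
  · rw [update_of_ne (Fin.succAbove_right_injective.ne hti), update_of_ne (Fin.succAbove_ne p t),
      Fin.insertNth_apply_succAbove] at ht
    exact ht.trans (le_max_left _ _)

end Slices

/-! ### Vertex operators inserted into longer products. -/

section Replacement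

variable {W : Type*} [AddCommGroup W] [Module ℂ W]

/-- The coefficient of `x_0^k` in `Y_{ℰᵒ}(a(x), x_0) b(x)`. -/
def yCoeff (a b : EInf W) (k : ℤ) : EInf W := ((HahnModule.of LaurentInf).symm (YE a b)).coeff k

theorem toSeries_YE (a b : EInf W) (w : W) (m : Fin 2 → ℤ) :
    toSeries (YE a b) w m = (yCoeff a b (m 0)).coeffX (m 1) w := rfl

theorem exists_yCoeff_eq_zero (a b : EInf W) : ∃ N : ℤ, ∀ k ≤ N, yCoeff a b k = 0 :=
  ⟨((HahnModule.of LaurentInf).symm (YE a b)).order - 1, fun _ hk =>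
    HahnSeries.coeff_eq_zero_of_lt_order (by omega)⟩

variable {r : ℕ}

theorem productSeries_mem_sliceBdd (c : Fin r → EInf W) (i : Fin r) (w : W) :
    productSeries c w ∈ sliceBdd i W := by
  intro m
  obtain ⟨L, R, h, -⟩ := exists_prod_ofFn_update i fun k => (c k).coeffX (m k)
  obtain ⟨N, hN⟩ := (c i).exists_bound (R w)
  refine ⟨N, fun n hn => ?_⟩
  rw [productSeries_apply]
  have : (fun k => (c k).coeffX (update m i n k)) =
      update (fun k => (c k).coeffX (m k)) i ((c i).coeffX n) := by
    funext k
    by_cases hk : k = i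
    · subst hk; simp
    · simp [hk]
  rw [this, h]
  simp [hN n hn]

theorem productSeries_eq_zero (c : Fin r → EInf W) (i : Fin r) (hc : c i = 0) (w : W) :
    productSeries c w = 0 := by
  funext m
  obtain ⟨L, R, h, -⟩ := exists_prod_ofFn_update i fun k => (c k).coeffX (m k)
  have h1 := h ((c i).coeffX (m i))
  have h0 : (c i).coeffX (m i) = 0 := by rw [hc]; rfl
  rw [update_eq_self, h0] at h1
  rw [productSeries_apply, h1]
  simp

/-- The series `⋯ (Y_{ℰᵒ}(a(x), x_0) b(x)) ⋯ w`, the middle factor being at position `i`. -/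
def insertYE (c : Fin r → EInf W) (i : Fin r) (a b : EInf W) (w : W) :
    (Fin (r + 1) → ℤ) → W := fun m =>
  productSeries (update c i (yCoeff a b (m i.castSucc))) w (i.castSucc.removeNth m)

theorem insertYE_insertNth (c : Fin r → EInf W) (i : Fin r) (a b : EInf W) (w : W) (k : ℤ)
    (n : Fin r → ℤ) :
    insertYE c i a b w (i.castSucc.insertNth k n) =
      productSeries (update c i (yCoeff a b k)) w n := by
  unfold insertYE
  rw [Fin.insertNth_apply_same, Fin.removeNth_insertNth]

theorem injective_pair {s : ℕ} (p : Fin (s + 1)) (i : Fin s) :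
    Injective (![p, p.succAbove i] : Fin 2 → Fin (s + 1)) := by
  intro x y h
  fin_cases x <;> fin_cases y <;> simp_all [(Fin.succAbove_ne p i).symm, Fin.succAbove_ne p i]

/-- With all exponents but two fixed, the inserted vertex operator and the product a b are both
wrapped in the same L and R, so the defining relation for the pair carries over. -/
theorem insertYE_slice (c : Fin r → EInf W) (i : Fin r) (a b : EInf W) (w : W)
    (m : Fin (r + 1) → ℤ) : ∃ L R : Module.End ℂ W,
    ((fun n => insertYE c i a b w (extend ![i.castSucc, i.castSucc.succAbove i] n m)) =
      fun n => L (toSeries (YE a b) (R w) n)) ∧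
    ((fun n => productSeries (i.castSucc.insertNth a (update c i b)) w
        (extend ![i.castSucc, i.castSucc.succAbove i] n m)) =
      fun n => L (productSeries ![a, b] (R w) n)) := by
  set p := i.castSucc
  have hρ := injective_pair p i
  obtain ⟨L, R, h1, h2⟩ :=
    exists_prod_ofFn_update i fun k => (c k).coeffX (m (p.succAbove k))
  have e0 : ∀ n : Fin 2 → ℤ, extend ![p, p.succAbove i] n m p = n 0 := fun n =>
    hρ.extend_apply n m 0
  have e1 : ∀ n : Fin 2 → ℤ, extend ![p, p.succAbove i] n m (p.succAbove i) = n 1 := fun n =>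
    hρ.extend_apply n m 1
  have e2 : ∀ (n : Fin 2 → ℤ) (k : Fin r), k ≠ i →
      extend ![p, p.succAbove i] n m (p.succAbove k) = m (p.succAbove k) := by
    intro n k hk
    refine extend_apply' _ _ _ ?_
    rintro ⟨t, ht⟩
    fin_cases t
    · exact Fin.succAbove_ne p k ht.symm
    · exact hk (Fin.succAbove_right_injective ht).symm
  have e3 : ∀ (n : Fin 2 → ℤ) (x : EInf W) (k : Fin r),
      (update c i x k).coeffX (extend ![p, p.succAbove i] n m (p.succAbove k)) =
        update (fun k => (c k).coeffX (m (p.succAbove k))) i (x.coeffX (n 1)) k := by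
    intro n x k
    by_cases hk : k = i
    · subst hk; rw [update_self, update_self, e1]
    · rw [update_of_ne hk, update_of_ne hk, e2 n k hk]
  refine ⟨L, R, ?_, ?_⟩
  · funext n
    unfold insertYE
    rw [e0, productSeries_apply, toSeries_YE]
    refine (congrArg (fun g : Fin r → Module.End ℂ W => (List.ofFn g).prod w) (funext (e3 n _))).trans ?_
    rw [h1]
    rfl
  · funext n
    rw [productSeries_apply, productSeries_pair]
    have : (fun k => ((p.insertNth a (update c i b) : Fin (r + 1) → EInf W) k).coeffX
        (extend ![p, p.succAbove i] n m k)) =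
        p.insertNth (a.coeffX (n 0)) (update (fun k => (c k).coeffX (m (p.succAbove k))) i
          (b.coeffX (n 1))) := by
      rw [Fin.eq_insertNth_iff]
      constructor
      · rw [Fin.insertNth_apply_same, e0]
      · funext k
        simp only [Fin.removeNth]
        rw [Fin.insertNth_apply_succAbove, e3]
    rw [this, h2]
    rfl

theorem polyMul_insertYE {P : MvPolynomial (Fin 2) ℂ} (hP : P ≠ 0) (c : Fin r → EInf W)
    (i : Fin r) {a b : EInf W} (h : CompatibleVia P ![a, b]) (w : W) :
    let ρ := ![i.castSucc, i.castSucc.succAbove i]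
    let F := productSeries (i.castSucc.insertNth a (update c i b)) w
    polyMul (MvPolynomial.rename ρ P) F ∈
        binomDom chooseLeft i.castSucc (i.castSucc.succAbove i) W ∧
      polyMul (MvPolynomial.rename ρ (substAdd 0 1 P)) (insertYE c i a b w) =
        binomOp chooseLeft i.castSucc (i.castSucc.succAbove i)
          (polyMul (MvPolynomial.rename ρ P) F) := by
  intro ρ F
  have hρ : Injective ρ := injective_pair i.castSucc i
  have key : ∀ m, ∃ L R : Module.End ℂ W,
      (∀ n, insertYE c i a b w (extend ρ n m) = L (toSeries (YE a b) (R w) n)) ∧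
      ∀ n, polyMul (MvPolynomial.rename ρ P) F (extend ρ n m) =
        L (polyMul P (productSeries ![a, b] (R w)) n) := by
    intro m
    obtain ⟨L, R, h1, h2⟩ := insertYE_slice c i a b w m
    refine ⟨L, R, congrFun h1, fun n => ?_⟩
    rw [polyMul_rename hρ, ← polyMul_map]
    exact congrFun (congrArg (polyMul P) h2) n
  constructor
  · refine mem_binomDom_of_slices hρ (i := 0) (j := 1) fun m => ?_
    obtain ⟨L, R, -, h2⟩ := key m
    simp only [h2]
    intro n
    refine (mem_binomDom_of_compatibleVia h (R w) n).subset fun l hl h0 => hl ?_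
    simp only at h0 ⊢
    rw [← map_zsmul, h0, map_zero]
  · funext m
    obtain ⟨L, R, h1, h2⟩ := key m
    have e := extend_comp_self hρ m
    rw [← e, polyMul_rename hρ]
    change _ = binomOp chooseLeft (ρ 0) (ρ 1) _ _
    rw [binomOp_extend hρ]
    simp only [h1, h2]
    rw [polyMul_map, binomOp_map _ (mem_binomDom_of_compatibleVia h _), polyMul_toSeries_YE hP h]

end Replacement

/-! ### Replacing a pair by a coefficient of its vertex operator. -/

section Closure

variable {W : Type*} [AddCommGroup W] [Module ℂ W] {r : ℕ}

theorem rename_wingProd_sub_mem (P : MvPolynomial (Fin 2) ℂ) (i : Fin r) :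
    ∃ R, MvPolynomial.rename i.castSucc.succAbove (wingProd P i) =
      (MvPolynomial.X i.castSucc - MvPolynomial.X (i.castSucc.succAbove i)) * R +
        MvPolynomial.rename (update i.castSucc.succAbove i i.castSucc) (wingProd P i) := by
  have h := mvPolynomial_algHom_sub_mem (Ideal.span {(MvPolynomial.X i.castSucc -
    MvPolynomial.X (i.castSucc.succAbove i) : MvPolynomial (Fin (r + 1)) ℂ)})
    (MvPolynomial.rename i.castSucc.succAbove)
    (MvPolynomial.rename (update i.castSucc.succAbove i i.castSucc)) (fun k => by
      rw [Ideal.mem_span_singleton, MvPolynomial.rename_X, MvPolynomial.rename_X]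
      by_cases hk : k = i
      · subst hk
        rw [update_self]
        exact ⟨-1, by ring⟩
      · rw [update_of_ne hk, sub_self]
        exact dvd_zero _) (wingProd P i)
  rw [Ideal.mem_span_singleton] at h
  obtain ⟨R, hR⟩ := h
  exact ⟨R, by rw [← hR, sub_add_cancel]⟩

/-- The wing in x is D R + A, where A is the wing in x_1 and D = x_1 - x. In its (N+1)-st power, all
terms but (D R)^(N+1) contain A and so complete the clearing product of the longer sequence. The
remaining term acquires x_0^(N+1) and is invisible up to x_0^N. -/
theorem polyMul_insertYE_mem_sliceLaurent {P : MvPolynomial (Fin 2) ℂ} (hP : P ≠ 0)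
    (c : Fin r → EInf W) (i : Fin r) {a b : EInf W} (h : CompatibleVia P ![a, b])
    (hF : CompatibleVia P (i.castSucc.insertNth a (update c i b) : Fin (r + 1) → EInf W))
    (w : W) (N : ℕ) :
    polyMul (MvPolynomial.rename ![i.castSucc, i.castSucc.succAbove i] (substAdd 0 1 P))
      (polyMul (MvPolynomial.rename i.castSucc.succAbove
        (pairProd P r * wingProd P i ^ (N + 1))) (insertYE c i a b w)) ∈
      sliceLaurent i.castSucc N W := by
  obtain ⟨hD, hE⟩ := polyMul_insertYE hP c i h w
  set p := i.castSucc
  set F := productSeries (p.insertNth a (update c i b) : Fin (r + 1) → EInf W) w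
  have hpi : p ≠ p.succAbove i := (Fin.succAbove_ne p i).symm
  have hG : polyMul (pairProd P (r + 1)) F ∈ LaurentAtInfinity (r + 1) W := hF w
  obtain ⟨R, hR⟩ := rename_wingProd_sub_mem P i
  set A := MvPolynomial.rename (update p.succAbove i p) (wingProd P i)
  set D := (MvPolynomial.X p - MvPolynomial.X (p.succAbove i) : MvPolynomial (Fin (r + 1)) ℂ)
  obtain ⟨B, hB⟩ : A ∣ (D * R + A) ^ (N + 1) - (D * R) ^ (N + 1) := by
    simpa using sub_dvd_pow_sub_pow (D * R + A) (D * R) (N + 1)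
  rw [polyMul_comm, hE, ← substAdd_rename_of_ne (p.succAbove i) (Fin.succAbove_ne p),
    ← binomOp_polyMul isPascal_chooseLeft hpi _ hD, map_mul, map_pow, hR,
    eq_add_of_sub_eq hB, mul_add, polyMul_add, binomOp_add
      (polyMul_mem_binomDom isPascal_chooseLeft hpi _ hD)
      (polyMul_mem_binomDom isPascal_chooseLeft hpi _ hD)]
  refine add_mem ?_ ?_
  · have : polyMul (MvPolynomial.rename p.succAbove (pairProd P r) * (A * B))
        (polyMul (MvPolynomial.rename ![p, p.succAbove i] P) F) =
        polyMul B (polyMul (pairProd P (r + 1)) F) := by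
      rw [← polyMul_mul, ← polyMul_mul, pairProd_castSucc P i]
      refine congrArg (fun q => polyMul q F) ?_
      change _ = B * (MvPolynomial.rename ![p, p.succAbove i] P * A *
        MvPolynomial.rename p.succAbove (pairProd P r))
      ring
    rw [this]
    exact binomOp_mem_sliceLaurent (polyMul_mem_laurentAtInfinity B hG) i
  · rw [mul_pow, mul_left_comm, polyMul_mul, binomOp_polyMul isPascal_chooseLeft hpi _
      (polyMul_mem_binomDom isPascal_chooseLeft hpi _ hD), map_pow, map_sub, substAdd_X_self,
      substAdd_X_of_ne _ (Fin.succAbove_ne p i), add_sub_cancel_right]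
    refine halfZero_le_sliceLaurent ?_
    -- The expansion has no negative powers of x_0, hence the bound -1, which the factor x_0^(N+1)
    -- raises to N.
    have h0 := polyMul_X_pow_mem_halfZero (i := p) (a := -1) (N + 1)
      (F := binomOp chooseLeft p (p.succAbove i) (polyMul
        (MvPolynomial.rename p.succAbove (pairProd P r) * R ^ (N + 1))
          (polyMul (MvPolynomial.rename ![p, p.succAbove i] P) F)))
      (fun m hm => binomOp_chooseLeft_of_neg _ (by omega))
    convert h0 using 2
    push_cast
    ring

/-- The exponent n depends on k: each further coefficient of Y(a, x_0)b may need a higher power of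
the wing. It suffices that the result is still a power of P. -/
theorem compatibleVia_update_yCoeff {P : MvPolynomial (Fin 2) ℂ} (hP : P ≠ 0)
    (c : Fin r → EInf W) (i : Fin r) {a b : EInf W} (h : CompatibleVia P ![a, b])
    (hF : CompatibleVia P (i.castSucc.insertNth a (update c i b) : Fin (r + 1) → EInf W))
    (k : ℤ) : ∃ n : ℕ, CompatibleVia (P ^ n) (update c i (yCoeff a b k)) := by
  obtain ⟨l, q, s, f, hf, hPl, hq⟩ := mvPolynomial_exists_eq_X_pow_mul
    (p := substAdd 0 1 P) (by
      rw [Ne, map_eq_zero_iff _ (substAdd_injective zero_ne_one)]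
      exact hP)
  obtain ⟨k₀, hk₀⟩ := exists_yCoeff_eq_zero a b
  set p := i.castSucc with hp
  set ρ := ![p, p.succAbove i]
  let Q : ℕ → MvPolynomial (Fin r) ℂ := fun N => pairProd P r * wingProd P i ^ (N + 1)
  have hC : ∀ w, insertYE c i a b w ∈ halfZero p k₀ W := by
    intro w m hm
    unfold insertYE
    rw [productSeries_eq_zero _ i (by rw [update_self]; exact hk₀ _ hm)]
    rfl
  have hφ : MvPolynomial.rename ρ (substAdd 0 1 P) = MvPolynomial.X p ^ l *
      (MvPolynomial.rename p.succAbove (Polynomial.aeval (MvPolynomial.X i) f) +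
        MvPolynomial.X p * MvPolynomial.rename ρ s) := by
    rw [hPl, hq]
    simp [ρ, ← Polynomial.aeval_algHom_apply]
  -- Induction from the lowest x_0-exponent k₀: the relation reads f(x) H + x_0 s H, the second
  -- summand is controlled by the previous coefficients, and f(x) is then cancelled.
  have main : ∀ t : ℕ, ∃ N, ∀ w, polyMul (MvPolynomial.rename p.succAbove (Q N))
      (insertYE c i a b w) ∈ sliceLaurent p (k₀ + t) W := by
    intro t
    induction t with
    | zero =>
      refine ⟨0, fun w => ?_⟩
      rw [Nat.cast_zero, add_zero]
      exact polyMul_mem_sliceLaurent _ (halfZero_le_sliceLaurent (hC w))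
    | succ t ih =>
      obtain ⟨N, hN⟩ := ih
      -- The summand l pays for dividing by x_0^l below.
      set N' := max N (k₀ + (t + 1 : ℕ) + l).toNat
      refine ⟨N', fun w => ?_⟩
      set H := polyMul (MvPolynomial.rename p.succAbove (Q N')) (insertYE c i a b w) with hH
      have h1 : H ∈ sliceLaurent p (k₀ + t) W := by
        have : Q N' = wingProd P i ^ (N' - N) * Q N := by
          have : N' + 1 = (N' - N) + (N + 1) := by
            have := le_max_left N (k₀ + (t + 1 : ℕ) + l).toNat
            omega
          simp only [Q]
          rw [this, pow_add]
          ring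
        rw [hH, this, map_mul, polyMul_mul]
        exact polyMul_mem_sliceLaurent _ (hN w)
      have h2 := polyMul_insertYE_mem_sliceLaurent hP c i h hF w N'
      rw [hφ, polyMul_mul] at h2
      have h3 := mem_sliceLaurent_of_X_pow l (e := k₀ + (t + 1 : ℕ)) (sliceLaurent_mono (by
        have := le_max_right N (k₀ + (t + 1 : ℕ) + l).toNat
        omega) h2)
      rw [polyMul_add, polyMul_mul] at h3
      have h4 := (Submodule.add_mem_iff_left _ (polyMul_X_mem_sliceLaurent
        (sliceLaurent_mono (by push_cast; omega) (polyMul_mem_sliceLaurent _ h1)))).mp h3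
      intro k' hk'
      have h5 := h4 k' hk'
      rw [polyMul_rename_succAbove] at h5
      refine mem_laurentAtInfinity_of_polyMul_aeval_X hf ?_ h5
      rw [polyMul_rename_succAbove]
      refine polyMul_mem_sliceBdd _ ?_
      simp only [hp, insertYE_insertNth]
      exact productSeries_mem_sliceBdd _ i w
  obtain ⟨N, hN⟩ := main (k - k₀).toNat
  -- 2N + 3 = 1 + 2(N + 1): one factor for `pairProd` and two for each of the N + 1 wings.
  refine ⟨2 * N + 3, fun w => ?_⟩
  rw [clearedProduct_apply]
  have hQ : Q N ∣ pairProd (P ^ (2 * N + 3)) r := by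
    rw [pairProd_pow, show 2 * N + 3 = 1 + 2 * (N + 1) by ring, pow_add, pow_one, pow_mul]
    exact mul_dvd_mul_left _ (pow_dvd_pow_of_dvd (wingProd_dvd P i) _)
  obtain ⟨T, hT⟩ := hQ
  rw [hT, mul_comm, polyMul_mul]
  refine polyMul_mem_laurentAtInfinity _ ?_
  have := hN w k (by omega)
  rw [polyMul_rename_succAbove] at this
  simpa only [hp, insertYE_insertNth] using this

/-- `1_W` may be inserted into a sequence. -/
theorem compatibleVia_insertNth_idW {P : MvPolynomial (Fin 2) ℂ} {c : Fin r → EInf W}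
    (h : CompatibleVia P c) (j : Fin (r + 1)) :
    CompatibleVia P (j.insertNth (EInf.idW W) c : Fin (r + 1) → EInf W) := by
  intro w
  rw [clearedProduct_apply, pairProd_succ P j, polyMul_mul]
  refine polyMul_mem_laurentAtInfinity _ ?_
  -- Inserting 1_W adds a variable that occurs only with exponent 0.
  have hs : ∀ k, (fun n => productSeries (j.insertNth (EInf.idW W) c : Fin (r + 1) → EInf W) w
      (j.insertNth k n)) = if k = 0 then productSeries c w else 0 := by
    intro k
    funext n
    obtain ⟨L, R, h1, h2⟩ := exists_prod_ofFn_insertNth j fun t => (c t).coeffX (n t)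
    have : (fun t => ((j.insertNth (EInf.idW W) c : Fin (r + 1) → EInf W) t).coeffX
        ((j.insertNth k n : Fin (r + 1) → ℤ) t)) =
        j.insertNth ((EInf.idW W).coeffX k) fun t => (c t).coeffX (n t) := by
      rw [Fin.eq_insertNth_iff]
      constructor
      · rw [Fin.insertNth_apply_same, Fin.insertNth_apply_same]
      · funext t
        simp only [Fin.removeNth, Fin.insertNth_apply_succAbove]
    rw [productSeries_apply, this, h2]
    simp only [Module.End.mul_apply, coeffX_idW]
    split_ifs
    · rw [productSeries_apply, ← h1]
      rfl
    · simp
  obtain ⟨N, hN⟩ := h w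
  refine ⟨max 0 N, fun m hm => ?_⟩
  obtain ⟨k, n, rfl⟩ : ∃ k n, m = j.insertNth k n := ⟨m j, j.removeNth m, by simp⟩
  have h1 := congrFun (polyMul_rename_succAbove j (pairProd P r)
    (productSeries (j.insertNth (EInf.idW W) c : Fin (r + 1) → EInf W) w) k) n
  rw [h1, hs] at hm
  split_ifs at hm with hk
  · intro t
    induction t using j.succAboveCases with
    | x => rw [Fin.insertNth_apply_same, hk]; exact le_max_left _ _
    | p t => rw [Fin.insertNth_apply_succAbove]; exact (hN n hm t).trans (le_max_right _ _)
  · simp at hm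

end Closure

/-! ### Maximal and generated subspaces. -/

section CompatibleFor

variable {W : Type*} [AddCommGroup W] [Module ℂ W]

/-- All finite sequences in `S` are compatible via a polynomial in `M`. This covers
quasi-compatible and compatible sets. -/
def CompatibleFor (M : Submonoid (MvPolynomial (Fin 2) ℂ)) (S : Set (EInf W)) : Prop :=
  ∀ (r : ℕ) (a : Fin r → EInf W), (∀ i, a i ∈ S) → ∃ p ∈ M, CompatibleVia p a

theorem quasiCompatible_iff {S : Set (EInf W)} :
    QuasiCompatible S ↔ CompatibleFor (nonZeroDivisors (MvPolynomial (Fin 2) ℂ)) S := by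
  simp only [QuasiCompatible, QuasiCompatibleSeq, CompatibleFor, mem_nonZeroDivisors_iff_ne_zero]

theorem compatible_iff {S : Set (EInf W)} :
    Compatible S ↔ CompatibleFor
      (Submonoid.powers (MvPolynomial.X 0 - MvPolynomial.X 1 : MvPolynomial (Fin 2) ℂ)) S := by
  simp only [Compatible, CompatibleSeq, CompatibleFor, Submonoid.mem_powers_iff,
    exists_exists_eq_and]

theorem X_sub_X_ne_zero : (MvPolynomial.X 0 - MvPolynomial.X 1 : MvPolynomial (Fin 2) ℂ) ≠ 0 := by
  rw [Ne, sub_eq_zero, MvPolynomial.X_inj]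
  exact zero_ne_one

theorem powers_le_nonZeroDivisors :
    Submonoid.powers (MvPolynomial.X 0 - MvPolynomial.X 1 : MvPolynomial (Fin 2) ℂ) ≤
      nonZeroDivisors _ := by
  rw [Submonoid.powers_le, mem_nonZeroDivisors_iff_ne_zero]
  exact X_sub_X_ne_zero

variable {M : Submonoid (MvPolynomial (Fin 2) ℂ)} {S T : Set (EInf W)}

theorem CompatibleFor.mono (h : CompatibleFor M T) (hST : S ⊆ T) : CompatibleFor M S :=
  fun r a ha => h r a fun i => hST (ha i)

theorem exists_productSeries_update {r : ℕ} (c : Fin r → EInf W) (i : Fin r) (m : Fin r → ℤ) :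
    ∃ L R : Module.End ℂ W, ∀ x w, productSeries (update c i x) w m =
      L (x.coeffX (m i) (R w)) := by
  obtain ⟨L, R, h, -⟩ := exists_prod_ofFn_update i fun k => (c k).coeffX (m k)
  refine ⟨L, R, fun x w => ?_⟩
  have : (fun k => (update c i x k).coeffX (m k)) =
      update (fun k => (c k).coeffX (m k)) i (x.coeffX (m i)) := by
    funext k
    by_cases hk : k = i
    · subst hk; simp
    · simp [hk]
  rw [productSeries_apply, this, h]
  rfl

/-- The operators which can be put at position `i` form a subspace. -/
def compatibleAt (M : Submonoid (MvPolynomial (Fin 2) ℂ)) {r : ℕ} (c : Fin r → EInf W)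
    (i : Fin r) : Submodule ℂ (EInf W) where
  carrier := {x | ∃ p ∈ M, CompatibleVia p (update c i x)}
  add_mem' := by
    rintro x y ⟨p, hp, hx⟩ ⟨q, hq, hy⟩
    refine ⟨p * q, mul_mem hp hq, fun w => ?_⟩
    have hx := hx.of_dvd (dvd_mul_right p q) w
    have hy := hy.of_dvd (dvd_mul_left q p) w
    rw [clearedProduct_apply] at *
    have : productSeries (update c i (x + y)) w =
        productSeries (update c i x) w + productSeries (update c i y) w := by
      funext m
      obtain ⟨L, R, h⟩ := exists_productSeries_update c i m
      rw [Pi.add_apply, h, h, h, ← map_add]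
      rfl
    rw [this, map_add]
    exact add_mem hx hy
  zero_mem' := by
    refine ⟨1, one_mem _, fun w => ?_⟩
    rw [clearedProduct_apply, productSeries_eq_zero _ i (update_self _ _ _), map_zero]
    exact zero_mem _
  smul_mem' := by
    rintro z x ⟨p, hp, hx⟩
    refine ⟨p, hp, fun w => ?_⟩
    have hx := hx w
    rw [clearedProduct_apply] at *
    have : productSeries (update c i (z • x)) w = z • productSeries (update c i x) w := by
      funext m
      obtain ⟨L, R, h⟩ := exists_productSeries_update c i m
      rw [Pi.smul_apply, h, h, ← map_smul]
      rfl
    rw [this, map_smul]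
    exact Submodule.smul_mem _ _ hx

/-- Induction on the set of positions allowed to leave S for its span. With the other entries fixed,
the admissible entries at one position form a subspace. -/
theorem CompatibleFor.span (h : CompatibleFor M S) :
    CompatibleFor M (Submodule.span ℂ S : Set (EInf W)) := by
  intro r a ha
  suffices H : ∀ (s : Finset (Fin r)) (a : Fin r → EInf W), (∀ i ∈ s, a i ∈ Submodule.span ℂ S) →
      (∀ i ∉ s, a i ∈ S) → ∃ p ∈ M, CompatibleVia p a from
    H Finset.univ a (fun i _ => ha i) fun i hi => absurd (Finset.mem_univ i) hi
  intro s
  induction s using Finset.induction_on with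
  | empty => exact fun a _ ha => h r a fun i => ha i (Finset.notMem_empty i)
  | insert i s hi ih =>
    intro a hs hs'
    have : Submodule.span ℂ S ≤ compatibleAt M a i := by
      rw [Submodule.span_le]
      intro x hx
      refine ih _ (fun k hk => ?_) fun k hk => ?_
      · rw [update_of_ne (by rintro rfl; exact hi hk)]
        exact hs k (Finset.mem_insert_of_mem hk)
      · by_cases hki : k = i
        · subst hki; rwa [update_self]
        · rw [update_of_ne hki]
          exact hs' k (by simp [hki, hk])
    have h1 := this (hs i (Finset.mem_insert_self i s))
    change ∃ p ∈ M, CompatibleVia p (update a i (a i)) at h1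
    rwa [update_eq_self] at h1

theorem CompatibleFor.insert_idW (h : CompatibleFor M S) :
    CompatibleFor M (insert (EInf.idW W) S) := by
  intro r
  induction r with
  | zero => exact fun a _ => h 0 a fun i => i.elim0
  | succ r ih =>
    intro a ha
    by_cases hS : ∀ i, a i ∈ S
    · exact h _ a hS
    · push Not at hS
      obtain ⟨i, hi⟩ := hS
      obtain ⟨p, hp, hc⟩ := ih (i.removeNth a) fun k => ha _
      refine ⟨p, hp, ?_⟩
      have := compatibleVia_insertNth_idW hc i
      rw [← (ha i).resolve_right hi] at this
      simpa using this

/-- Induction on the number of entries outside S. Replacing one such entry by its pair a, b lowers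
this number but lengthens the sequence, so the length must vary in the induction. -/
theorem CompatibleFor.union_yCoeff (hM : M ≤ nonZeroDivisors _) (h : CompatibleFor M S) :
    CompatibleFor M (S ∪ {x | ∃ a ∈ S, ∃ b ∈ S, ∃ k, x = yCoeff a b k}) := by
  classical
  suffices H : ∀ (n r : ℕ) (c : Fin r → EInf W),
      (∀ i, c i ∈ S ∪ {x | ∃ a ∈ S, ∃ b ∈ S, ∃ k, x = yCoeff a b k}) →
      (Finset.univ.filter fun i => c i ∉ S).card ≤ n → ∃ p ∈ M, CompatibleVia p c from
    fun r c hc => H _ r c hc le_rfl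
  intro n
  induction n with
  | zero =>
    intro r c _ hn
    refine h r c fun i => ?_
    rw [Nat.le_zero, Finset.card_eq_zero, Finset.filter_eq_empty_iff] at hn
    simpa using hn (Finset.mem_univ i)
  | succ n ih =>
    intro r c hc hn
    by_cases hS : ∀ i, c i ∈ S
    · exact h r c hS
    push Not at hS
    obtain ⟨i, hi⟩ := hS
    obtain ⟨a, ha, b, hb, k, hk⟩ := (hc i).resolve_left hi
    obtain ⟨p, hp, hpc⟩ := ih (r + 1) (i.castSucc.insertNth a (update c i b)) (fun j => by
      induction j using i.castSucc.succAboveCases with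
      | x => rw [Fin.insertNth_apply_same]; exact Or.inl ha
      | p t =>
        rw [Fin.insertNth_apply_succAbove]
        by_cases ht : t = i
        · subst ht; rw [update_self]; exact Or.inl hb
        · rw [update_of_ne ht]; exact hc t) (by
      rw [Finset.card_filter, Fin.sum_univ_succAbove _ i.castSucc]
      simp only [Fin.insertNth_apply_same, Fin.insertNth_apply_succAbove]
      rw [if_neg (not_not.mpr ha), zero_add, ← Finset.card_filter]
      have hlt : (Finset.univ.filter fun t => update c i b t ∉ S).card <
          (Finset.univ.filter fun i => c i ∉ S).card := by
        refine Finset.card_lt_card ⟨fun t ht => ?_, fun hsub => ?_⟩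
        · simp only [Finset.mem_filter, Finset.mem_univ, true_and] at ht ⊢
          by_cases hti : t = i
          · subst hti; exact hi
          · rwa [update_of_ne hti] at ht
        · have := hsub (Finset.mem_filter.mpr ⟨Finset.mem_univ i, hi⟩)
          simp [hb] at this
      omega)
    obtain ⟨q, hq, hqc⟩ := h 2 ![a, b] (by rw [Fin.forall_fin_two]; exact ⟨ha, hb⟩)
    -- One polynomial has to clear both the longer sequence and the pair a, b.
    obtain ⟨m, hm⟩ := compatibleVia_update_yCoeff (P := p * q)
      (mem_nonZeroDivisors_iff_ne_zero.mp (hM (mul_mem hp hq))) c i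
      (hqc.of_dvd (dvd_mul_left q p)) (hpc.of_dvd (dvd_mul_right p q)) k
    refine ⟨(p * q) ^ m, pow_mem (mul_mem hp hq) m, ?_⟩
    rwa [← hk, update_eq_self] at hm

/-- The span of K with 1_W adjoined still satisfies the condition, so by maximality it is contained
in K. The next lemma argues alike with coefficients. -/
theorem idW_mem_of_maximal {K : Submodule ℂ (EInf W)}
    (hK : Maximal (fun U : Submodule ℂ (EInf W) => CompatibleFor M (U : Set (EInf W))) K) :
    EInf.idW W ∈ K :=
  hK.2 hK.1.insert_idW.span (fun _ hx => Submodule.subset_span (Or.inr hx))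
    (Submodule.subset_span (Or.inl rfl))

theorem nthProduct_mem_of_maximal (hM : M ≤ nonZeroDivisors _) {K : Submodule ℂ (EInf W)}
    (hK : Maximal (fun U : Submodule ℂ (EInf W) => CompatibleFor M (U : Set (EInf W))) K)
    {a b : EInf W} (ha : a ∈ K) (hb : b ∈ K) (n : ℤ) : nthProduct a b n ∈ K :=
  hK.2 (hK.1.union_yCoeff hM).span (fun _ hx => Submodule.subset_span (Or.inl hx))
    (Submodule.subset_span (Or.inr ⟨a, ha, b, hb, -n - 1, rfl⟩))

/-- Zorn's lemma applies because the condition concerns finite sequences, and each of these lies in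
one member of a chain. -/
theorem CompatibleFor.exists_maximal (h : CompatibleFor M S) :
    ∃ K : Submodule ℂ (EInf W), S ⊆ K ∧
      Maximal (fun U : Submodule ℂ (EInf W) => CompatibleFor M (U : Set (EInf W))) K := by
  obtain ⟨K, hK, hmax⟩ := zorn_le_nonempty₀
    {U : Submodule ℂ (EInf W) | CompatibleFor M (U : Set (EInf W))} (fun c hc hchain y hy => by
      refine ⟨sSup c, fun r a ha => ?_, fun z hz => le_sSup hz⟩
      have hdir := hchain.directedOn
      have hne : c.Nonempty := ⟨y, hy⟩
      have : ∀ i, ∃ U ∈ c, a i ∈ U := fun i =>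
        (Submodule.mem_sSup_of_directed hne hdir).mp (ha i)
      choose U hU haU using this
      have : Nonempty c := ⟨⟨y, hy⟩⟩
      obtain ⟨z, hz⟩ := (directedOn_iff_directed.mp hdir).finite_le fun i => (⟨U i, hU i⟩ : c)
      exact hc z.2 r a fun i => hz i (haU i)) _ h.span
  exact ⟨K, Submodule.subset_span.trans hK, hmax⟩

theorem CompatibleFor.mono_submonoid {M' : Submonoid (MvPolynomial (Fin 2) ℂ)}
    (h : CompatibleFor M S) (hM : M ≤ M') : CompatibleFor M' S := fun r a ha =>
  let ⟨p, hp, hc⟩ := h r a ha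
  ⟨p, hM hp, hc⟩

theorem isClosedQuasiCompatible_of_maximal (hM : M ≤ nonZeroDivisors _)
    {K : Submodule ℂ (EInf W)}
    (hK : Maximal (fun U : Submodule ℂ (EInf W) => CompatibleFor M (U : Set (EInf W))) K) :
    IsClosedQuasiCompatible K where
  quasiCompatible := quasiCompatible_iff.mpr (hK.1.mono_submonoid hM)
  closed _ ha _ hb n := nthProduct_mem_of_maximal hM hK ha hb n

/-- The smallest closed quasi-compatible subspace containing `S` and `1_W`. -/
def generatedSubspace (S : Set (EInf W)) : Submodule ℂ (EInf W) :=
  sInf {U | IsClosedQuasiCompatible U ∧ S ⊆ U ∧ EInf.idW W ∈ U}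

/-- A subspace that is maximal for M is closed, quasi-compatible and contains 1_W, hence contains
⟨S⟩. With M the powers of x_1 - x_2 this shows that ⟨S⟩ is compatible when S is. -/
theorem generatedSubspace_le_of_compatibleFor (hM : M ≤ nonZeroDivisors _)
    (h : CompatibleFor M S) :
    CompatibleFor M (generatedSubspace S : Set (EInf W)) := by
  obtain ⟨K, hSK, hK⟩ := h.exists_maximal
  exact hK.1.mono (sInf_le (a := K)
    ⟨isClosedQuasiCompatible_of_maximal hM hK, hSK, idW_mem_of_maximal hK⟩)

theorem isLeast_generatedSubspace (h : QuasiCompatible S) :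
    IsLeast {U | IsClosedQuasiCompatible U ∧ S ⊆ U ∧ EInf.idW W ∈ U} (generatedSubspace S) := by
  refine ⟨⟨⟨quasiCompatible_iff.mpr (generatedSubspace_le_of_compatibleFor le_rfl
    (quasiCompatible_iff.mp h)), fun a ha b hb n => ?_⟩, fun x hx => ?_, ?_⟩,
    fun U hU => sInf_le hU⟩
  · rw [generatedSubspace, Submodule.mem_sInf] at *
    exact fun U hU => hU.1.closed a (ha U hU) b (hb U hU) n
  · exact Submodule.mem_sInf.mpr fun U hU => hU.2.1 hx
  · exact Submodule.mem_sInf.mpr fun U hU => hU.2.2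

end CompatibleFor

/-! ### Agreement of two iterated expansions. -/

section Expansions

variable {W : Type*} [AddCommGroup W] [Module ℂ W]

theorem binomOp_zero_one (c : ℤ → ℤ → ℤ) (F : (Fin 3 → ℤ) → W) (i j n : ℤ) :
    binomOp c 0 1 F ![i, j, n] = ∑ᶠ l, c l i • F ![l, j + i - l, n] := by
  refine finsum_congr fun l => ?_
  congr 2
  ext t; fin_cases t <;> simp

theorem binomOp_zero_two (c : ℤ → ℤ → ℤ) (F : (Fin 3 → ℤ) → W) (i j n : ℤ) :
    binomOp c 0 2 F ![i, j, n] = ∑ᶠ l, c l i • F ![l, j, n + i - l] := by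
  refine finsum_congr fun l => ?_
  congr 2
  ext t; fin_cases t <;> simp

theorem binomOp_one_two (c : ℤ → ℤ → ℤ) (F : (Fin 3 → ℤ) → W) (i j n : ℤ) :
    binomOp c 1 2 F ![i, j, n] = ∑ᶠ l, c l j • F ![i, l, n + j - l] := by
  refine finsum_congr fun l => ?_
  congr 2
  ext t; fin_cases t <;> simp

theorem chooseLeft_of_neg {k : ℤ} (l : ℤ) (hk : k < 0) : chooseLeft l k = 0 :=
  if_neg hk.not_ge

theorem chooseLeft_natCast (l : ℤ) (k : ℕ) : chooseLeft l k = Ring.choose l k := by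
  simp [chooseLeft]

/-- Put k = i + u. Then C(k, i) C(s, k) = C(s, i) C(s - i, u), and the sum over u is Vandermonde's
identity for (s - i) + t. The boundary cases with i or j negative give zero on both sides. -/
theorem sum_chooseLeft_mul (s t i j : ℤ) :
    ∑ k ∈ Finset.Icc i (i + j), chooseRight k i * (chooseLeft s k * chooseLeft t (j + i - k)) =
      chooseLeft (t + s - i) j * chooseLeft s i := by
  rcases lt_or_ge j 0 with hj | hj
  · rw [chooseLeft_of_neg _ hj, zero_mul, Finset.Icc_eq_empty (by omega), Finset.sum_empty]
  rcases lt_or_ge i 0 with hi | hi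
  · rw [chooseLeft_of_neg _ hi, mul_zero]
    refine Finset.sum_eq_zero fun k hk => ?_
    rw [Finset.mem_Icc] at hk
    rcases lt_or_ge k 0 with hk0 | hk0
    · rw [chooseLeft_of_neg _ hk0, zero_mul, mul_zero]
    · obtain ⟨k, rfl⟩ := Int.eq_ofNat_of_zero_le hk0
      rw [chooseRight, chooseLeft, if_pos (by omega), Ring.choose_natCast,
        Nat.choose_eq_zero_of_lt (by omega), Nat.cast_zero, zero_mul]
  obtain ⟨i, rfl⟩ := Int.eq_ofNat_of_zero_le hi
  obtain ⟨j, rfl⟩ := Int.eq_ofNat_of_zero_le hj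
  have hsum : ∑ k ∈ Finset.Icc (i : ℤ) (i + j),
      chooseRight k i * (chooseLeft s k * chooseLeft t (j + i - k)) =
      ∑ u ∈ Finset.range (j + 1), chooseRight (i + u) i *
        (chooseLeft s (i + u) * chooseLeft t (j - u)) := by
    symm
    refine Finset.sum_bij (fun u _ => (i : ℤ) + u) (fun u hu => ?_) (fun u _ v _ h => ?_)
      (fun k hk => ?_) fun u _ => ?_
    · rw [Finset.mem_range] at hu
      rw [Finset.mem_Icc]
      omega
    · simpa using h
    · rw [Finset.mem_Icc] at hk
      exact ⟨(k - i).toNat, by rw [Finset.mem_range]; omega, by omega⟩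
    · congr 3
      ring
  rw [hsum, chooseLeft_natCast, chooseLeft_natCast, show t + s - i = (s - i) + t by ring,
    Ring.add_choose_eq _ (Commute.all _ _), Finset.Nat.sum_antidiagonal_eq_sum_range_succ
      (fun u v => Ring.choose (s - (i : ℤ)) u * Ring.choose t v), Finset.sum_mul]
  refine Finset.sum_congr rfl fun u hu => ?_
  rw [Finset.mem_range] at hu
  have h1 : chooseRight (i + u) i = (Nat.choose (i + u) i : ℤ) := by
    rw [chooseRight, add_sub_cancel_left, chooseLeft_natCast, ← Nat.cast_add, Ring.choose_natCast,
      Nat.choose_symm_add]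
  have h2 : chooseLeft s (i + u) = Ring.choose s (i + u) := by
    rw [← Nat.cast_add, chooseLeft_natCast]
  have h3 : chooseLeft t (j - u) = Ring.choose t (j - u) := by
    rw [← Nat.cast_sub (by omega), chooseLeft_natCast]
  have h4 := Ring.choose_smul_choose s (n := i + u) (k := i) (by omega)
  rw [h1, h2, h3, ← mul_assoc]
  rw [nsmul_eq_mul, add_tsub_cancel_left] at h4
  rw [h4]
  ring

/-- Expanding in `x_2 = x + x_2`, then `x_1 = x_2 + x_0`, agrees with the expansion obtained by
substituting `x_0 + x_2` for `x_0'` in `x_1 = x + x_0'`. -/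
theorem binomOp_comp {G : (Fin 3 → ℤ) → W} (hG : G ∈ LaurentAtInfinity 3 W) :
    binomOp chooseRight 0 1 (binomOp chooseLeft 0 2 (binomOp chooseLeft 1 2 G)) =
      binomOp chooseLeft 1 2 (binomOp chooseLeft 0 1 G) := by
  obtain ⟨N, hN⟩ := hG
  funext m
  obtain ⟨i, j, n, rfl⟩ : ∃ i j n, m = ![i, j, n] :=
    ⟨m 0, m 1, m 2, by ext t; fin_cases t <;> rfl⟩
  -- All substitutions preserve total degree. In degree A, exponents bounded above by N are bounded
  -- below by A - 2N, so all sums run over a finite interval.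
  set A := n + i + j with hA
  set I := Finset.Icc (A - 2 * N) N with hI
  have hG0 : ∀ s t, ¬ (s ∈ I ∧ t ∈ I) → G ![s, t, A - s - t] = 0 := by
    intro s t hst
    by_contra h
    have h0 := hN _ h 0
    have h1 := hN _ h 1
    have h2 := hN _ h 2
    simp only [Matrix.cons_val_zero, Matrix.cons_val_one, Matrix.cons_val] at h0 h1 h2
    apply hst
    simp only [hI, Finset.mem_Icc]
    omega
  have hL1 : ∀ k s, binomOp chooseLeft 1 2 G ![s, j + i - k, n + k - s] =
      ∑ t ∈ I, chooseLeft t (j + i - k) • G ![s, t, A - s - t] := by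
    intro k s
    rw [binomOp_one_two]
    have : ∀ t, n + k - s + (j + i - k) - t = A - s - t := fun t => by rw [hA]; ring
    simp only [this]
    refine finsum_eq_sum_of_support_subset _ fun t ht => ?_
    by_contra h
    exact ht (by simp only; rw [hG0 s t fun h' => h h'.2, smul_zero])
  have hL2 : ∀ k, binomOp chooseLeft 0 2 (binomOp chooseLeft 1 2 G) ![k, j + i - k, n] =
      ∑ s ∈ I, chooseLeft s k • ∑ t ∈ I, chooseLeft t (j + i - k) • G ![s, t, A - s - t] := by
    intro k
    rw [binomOp_zero_two]
    simp only [hL1]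
    refine finsum_eq_sum_of_support_subset _ fun s hs => ?_
    by_contra h
    refine hs ?_
    simp only
    rw [Finset.sum_eq_zero, smul_zero]
    intro t _
    rw [hG0 s t fun h' => h h'.1, smul_zero]
  have hL : binomOp chooseRight 0 1 (binomOp chooseLeft 0 2 (binomOp chooseLeft 1 2 G)) ![i, j, n] =
      ∑ s ∈ I, ∑ t ∈ I, (∑ k ∈ Finset.Icc i (i + j),
        chooseRight k i * (chooseLeft s k * chooseLeft t (j + i - k))) • G ![s, t, A - s - t] := by
    rw [binomOp_zero_one]
    simp only [hL2]
    rw [finsum_eq_sum_of_support_subset (s := Finset.Icc i (i + j))]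
    · simp only [Finset.smul_sum, Finset.sum_smul, smul_smul]
      rw [Finset.sum_comm]
      refine Finset.sum_congr rfl fun s _ => ?_
      rw [Finset.sum_comm]
    · intro k hk
      rw [Finset.coe_Icc, Set.mem_Icc]
      by_contra h
      refine hk ?_
      simp only
      by_cases hk1 : i ≤ k
      · rw [Finset.sum_eq_zero, smul_zero]
        intro s _
        rw [Finset.sum_eq_zero, smul_zero]
        intro t _
        rw [chooseLeft_of_neg t (by omega), zero_smul]
      · rw [chooseRight, chooseLeft_of_neg k (by omega), zero_smul]
  have hR1 : ∀ l, binomOp chooseLeft 0 1 G ![i, l, n + j - l] =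
      ∑ s ∈ I, chooseLeft s i • G ![s, l + i - s, n + j - l] := by
    intro l
    rw [binomOp_zero_one]
    refine finsum_eq_sum_of_support_subset _ fun s hs => ?_
    by_contra h
    refine hs ?_
    have := hG0 s (l + i - s) fun h' => h h'.1
    rw [show A - s - (l + i - s) = n + j - l by rw [hA]; ring] at this
    simp only
    rw [this, smul_zero]
  have hR : binomOp chooseLeft 1 2 (binomOp chooseLeft 0 1 G) ![i, j, n] =
      ∑ s ∈ I, ∑ t ∈ I, (chooseLeft (t + s - i) j * chooseLeft s i) • G ![s, t, A - s - t] := by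
    rw [binomOp_one_two]
    simp only [hR1, Finset.smul_sum, smul_smul]
    have hfin : ∀ s, (support fun t => (chooseLeft (t + s - i) j * chooseLeft s i) •
        G ![s, t, A - s - t]) ⊆ I := by
      intro s t ht
      by_contra h
      exact ht (by simp only; rw [hG0 s t fun h' => h h'.2, smul_zero])
    have hcomp : ∀ s l, (chooseLeft l j * chooseLeft s i) • G ![s, l + i - s, n + j - l] =
        (chooseLeft ((l + (i - s)) + s - i) j * chooseLeft s i) •
          G ![s, l + (i - s), A - s - (l + (i - s))] := by
      intro s l
      rw [show l + (i - s) + s - i = l by ring, show l + (i - s) = l + i - s by ring,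
        show A - s - (l + i - s) = n + j - l by rw [hA]; ring]
    rw [finsum_sum_comm]
    · refine Finset.sum_congr rfl fun s _ => ?_
      rw [← finsum_eq_sum_of_support_subset _ (hfin s)]
      simp only [hcomp]
      exact finsum_comp_equiv (Equiv.addRight (i - s))
        (f := fun t => (chooseLeft (t + s - i) j * chooseLeft s i) • G ![s, t, A - s - t])
    · intro s _
      simp only [hcomp]
      exact ((I.finite_toSet.subset (hfin s)).preimage
        (Equiv.addRight (i - s)).injective.injOn)
  rw [hL, hR]
  simp only [sum_chooseLeft_mul]

end Expansions

/-! ### Three-variable identities from identities of slices. -/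

section SliceRecovery

variable {σ M : Type*} [DecidableEq σ] [AddCommGroup M] [Module ℂ M]

/-- Series in which the exponents of `x_j` are bounded below when the exponent of `x_i` is
fixed. -/
def sliceBddBelow (i j : σ) (M : Type*) [AddCommGroup M] [Module ℂ M] :
    Submodule ℂ ((σ → ℤ) → M) where
  carrier := {F | ∀ a, ∃ B, ∀ m, m i = a → m j ≤ B → F m = 0}
  add_mem' := by
    intro F G hF hG a
    obtain ⟨B, hB⟩ := hF a
    obtain ⟨B', hB'⟩ := hG a
    refine ⟨min B B', fun m hm hm' => ?_⟩
    rw [Pi.add_apply, hB m hm (hm'.trans (min_le_left _ _)),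
      hB' m hm (hm'.trans (min_le_right _ _)), add_zero]
  zero_mem' := fun _ => ⟨0, fun _ _ _ => rfl⟩
  smul_mem' := by
    intro c F hF a
    obtain ⟨B, hB⟩ := hF a
    exact ⟨B, fun m hm hm' => by rw [Pi.smul_apply, hB m hm hm', smul_zero]⟩

theorem polyMul_mem_sliceBddBelow {i j : σ} (hij : i ≠ j) (p : MvPolynomial σ ℂ)
    {F : (σ → ℤ) → M} (hF : F ∈ sliceBddBelow i j M) : polyMul p F ∈ sliceBddBelow i j M := by
  refine polyMul_mem _ (fun k F hF a => ?_) p hF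
  by_cases hki : k = i
  · subst hki
    obtain ⟨B, hB⟩ := hF (a - 1)
    refine ⟨B, fun m hm hm' => ?_⟩
    rw [polyMul_X_apply]
    exact hB _ (by rw [update_self, hm]) (by rwa [update_of_ne hij.symm])
  · obtain ⟨B, hB⟩ := hF a
    refine ⟨B, fun m hm hm' => ?_⟩
    rw [polyMul_X_apply]
    refine hB _ (by rwa [update_of_ne (Ne.symm hki)]) ?_
    by_cases hkj : k = j
    · subst hkj; rw [update_self]; omega
    · rwa [update_of_ne (Ne.symm hkj)]

theorem binomOp_mem_sliceBdd {F : (Fin 2 → ℤ) → M} (hF : F ∈ LaurentAtInfinity 2 M) :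
    binomOp chooseLeft 0 1 F ∈ sliceBdd 1 M := by
  intro m
  obtain ⟨N, hN⟩ := hF
  refine ⟨2 * N - m 0, fun n hn => finsum_eq_zero_of_forall_eq_zero fun l => ?_⟩
  by_contra h
  have h' : F _ ≠ 0 := fun h' => h (by rw [h', smul_zero])
  have h0 := hN _ h' 0
  have h1 := hN _ h' 1
  simp at h0 h1
  omega

theorem binomOp_insertNth {c : ℤ → ℤ → ℤ} {r : ℕ} (k : Fin (r + 1)) (i j : Fin r)
    (F : (Fin (r + 1) → ℤ) → M) (e : ℤ) :
    (fun n => binomOp c (k.succAbove i) (k.succAbove j) F (k.insertNth e n)) =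
      binomOp c i j fun n => F (k.insertNth e n) := by
  funext n
  simp only [insertNth_eq_extend]
  exact binomOp_extend Fin.succAbove_right_injective i j F n _

/-- An identity between series in three variables follows from identities between their
coefficients with respect to `x_k`, each of which only holds after multiplication by some
polynomial. -/
theorem polyMul_eq_binomOp_of_slices (k : Fin 3) {R C : (Fin 3 → ℤ) → M}
    {K : MvPolynomial (Fin 3) ℂ} {k₀ : ℤ} (hC : C ∈ halfZero k k₀ M) (hR : R ∈ halfZero k k₀ M)
    (hRb : R ∈ sliceBddBelow k (k.succAbove 0) M) (hRs : R ∈ sliceBdd (k.succAbove 1) M)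
    (hq : ∀ e, ∃ q : MvPolynomial (Fin 2) ℂ, q ≠ 0 ∧
      polyMul q (fun n => C (k.insertNth e n)) ∈ LaurentAtInfinity 2 M ∧
      polyMul (substAdd 0 1 q) (fun n => R (k.insertNth e n)) =
        binomOp chooseLeft 0 1 (polyMul q fun n => C (k.insertNth e n)))
    (hK : ∀ e, (fun n => polyMul K C (k.insertNth e n)) ∈ LaurentAtInfinity 2 M) :
    polyMul (substAdd (k.succAbove 0) (k.succAbove 1) K) R =
      binomOp chooseLeft (k.succAbove 0) (k.succAbove 1) (polyMul K C) := by
  choose q hq0 hqC hqR using hq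
  have h01 : (0 : Fin 2) ≠ 1 := zero_ne_one
  have hinj : Injective k.succAbove := Fin.succAbove_right_injective
  have hk01 : k.succAbove 0 ≠ k.succAbove 1 := hinj.ne h01
  suffices H : ∀ e, (fun n => polyMul (substAdd (k.succAbove 0) (k.succAbove 1) K) R
      (k.insertNth e n)) = fun n =>
        binomOp chooseLeft (k.succAbove 0) (k.succAbove 1) (polyMul K C) (k.insertNth e n) by
    funext m
    have := congrFun (H (m k)) (k.removeNth m)
    simpa using this
  intro e
  rw [binomOp_insertNth]
  -- The clearing polynomials vary with the slice without any uniform bound, but slice e of a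
  -- product with a polynomial involves only slices up to e, and those below k₀ vanish. So a finite
  -- product suffices.
  let Q := ∏ e' ∈ Finset.Icc k₀ e, q e'
  have hQ0 : Q ≠ 0 := Finset.prod_ne_zero_iff.mpr fun e' _ => hq0 e'
  let trunc : ((Fin 3 → ℤ) → M) → (Fin 3 → ℤ) → M := fun F m => if m k ≤ e then F m else 0
  have htr : ∀ F e', (fun n => trunc F (k.insertNth e' n)) =
      if e' ≤ e then fun n => F (k.insertNth e' n) else 0 := by
    intro F e'
    funext n
    simp only [trunc, Fin.insertNth_apply_same]
    split_ifs <;> rfl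
  have htr' : ∀ F p n, polyMul p (trunc F) (k.insertNth e n) = polyMul p F (k.insertNth e n) := by
    intro F p n
    have : trunc F - F ∈ halfZero k e M := by
      intro m hm
      simp [trunc, hm]
    have := polyMul_mem_halfZero p this (k.insertNth e n) (by rw [Fin.insertNth_apply_same])
    rw [map_sub] at this
    exact sub_eq_zero.mp this
  have hslice : ∀ e', polyMul Q (fun n => trunc C (k.insertNth e' n)) ∈ LaurentAtInfinity 2 M ∧
      polyMul (substAdd 0 1 Q) (fun n => trunc R (k.insertNth e' n)) =
        binomOp chooseLeft 0 1 (polyMul Q fun n => trunc C (k.insertNth e' n)) := by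
    have hzero : binomOp chooseLeft 0 1 (0 : (Fin 2 → ℤ) → M) = 0 := by
      funext n
      simp [binomOp]
    intro e'
    rw [htr, htr]
    split_ifs with he
    · by_cases hk₀ : k₀ ≤ e'
      · obtain ⟨T, hT⟩ : q e' ∣ Q := Finset.dvd_prod_of_mem q (Finset.mem_Icc.mpr ⟨hk₀, he⟩)
        rw [hT, mul_comm, polyMul_mul, map_mul, polyMul_mul, hqR, binomOp_polyMul
          isPascal_chooseLeft h01 _ (laurentAtInfinity_le_binomDom _ h01 (hqC e'))]
        exact ⟨polyMul_mem_laurentAtInfinity T (hqC e'), rfl⟩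
      · have hC0 : (fun n => C (k.insertNth e' n)) = 0 := by
          funext n
          exact hC _ (by rw [Fin.insertNth_apply_same]; omega)
        have hR0 : (fun n => R (k.insertNth e' n)) = 0 := by
          funext n
          exact hR _ (by rw [Fin.insertNth_apply_same]; omega)
        rw [hC0, hR0, map_zero, map_zero, hzero]
        exact ⟨zero_mem _, rfl⟩
    · rw [map_zero, map_zero, hzero]
      exact ⟨zero_mem _, rfl⟩
  have hdom : polyMul (MvPolynomial.rename k.succAbove Q) (trunc C) ∈
      binomDom chooseLeft (k.succAbove 0) (k.succAbove 1) M := by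
    refine mem_binomDom_of_slices hinj fun m => ?_
    have : ∀ n, extend k.succAbove n m = k.insertNth (m k) n := by
      intro n
      symm
      rw [Fin.insertNth_eq_iff]
      constructor
      · rw [extend_apply']
        rintro ⟨t, ht⟩
        exact Fin.succAbove_ne k t ht
      · funext t
        exact (hinj.extend_apply _ _ _).symm
    simp only [this]
    rw [polyMul_rename_succAbove]
    exact laurentAtInfinity_le_binomDom _ h01 (hslice _).1
  have hrel : polyMul (MvPolynomial.rename k.succAbove (substAdd 0 1 Q)) (trunc R) =
      binomOp chooseLeft (k.succAbove 0) (k.succAbove 1)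
        (polyMul (MvPolynomial.rename k.succAbove Q) (trunc C)) := by
    funext m
    have h1 := congrFun (polyMul_rename_succAbove k (substAdd 0 1 Q) (trunc R) (m k))
      (k.removeNth m)
    have h2 := congrFun (binomOp_insertNth (c := chooseLeft) k 0 1
      (polyMul (MvPolynomial.rename k.succAbove Q) (trunc C)) (m k)) (k.removeNth m)
    rw [polyMul_rename_succAbove, ← (hslice _).2, ← h1] at h2
    simpa using h2.symm
  have h3 := congrArg (polyMul (substAdd (k.succAbove 0) (k.succAbove 1) K)) hrel
  rw [← binomOp_polyMul isPascal_chooseLeft hk01 _ hdom, polyMul_comm,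
    polyMul_comm K] at h3
  have h4 : polyMul (substAdd 0 1 Q) (fun n => polyMul (substAdd (k.succAbove 0) (k.succAbove 1) K)
      R (k.insertNth e n)) = polyMul (substAdd 0 1 Q)
        (binomOp chooseLeft 0 1 fun n => polyMul K C (k.insertNth e n)) := by
    rw [← binomOp_polyMul isPascal_chooseLeft h01 _ (laurentAtInfinity_le_binomDom _ h01 (hK e))]
    have e1 : (fun n => polyMul (substAdd (k.succAbove 0) (k.succAbove 1) K) R
        (k.insertNth e n)) = fun n => polyMul (substAdd (k.succAbove 0) (k.succAbove 1) K) (trunc R)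
          (k.insertNth e n) := funext fun n => (htr' _ _ n).symm
    have e2 : (fun n => polyMul K C (k.insertNth e n)) = fun n => polyMul K (trunc C)
        (k.insertNth e n) := funext fun n => (htr' _ _ n).symm
    rw [e1, e2, ← polyMul_rename_succAbove, ← polyMul_rename_succAbove, h3, binomOp_insertNth]
  have hsub : Q ≠ 0 → substAdd 0 1 Q ≠ 0 := by
    rw [Ne, Ne, map_eq_zero_iff _ (substAdd_injective h01)]
    exact id
  rw [← sub_eq_zero]
  obtain ⟨B, hB⟩ := polyMul_mem_sliceBddBelow (Fin.succAbove_ne k 0).symm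
    (substAdd (k.succAbove 0) (k.succAbove 1) K) hRb e
  -- B bounds the slice of R from below; -1 serves for the expansion, which has no negative powers.
  refine polyMul_cancel (hsub hQ0) (N := min B (-1)) (sub_mem ?_ ?_) (sub_mem ?_ ?_) ?_
  · intro n hn
    exact hB _ (Fin.insertNth_apply_same _ _ _) (by
      rw [Fin.insertNth_apply_succAbove]
      exact hn.trans (min_le_left _ _))
  · intro n hn
    exact binomOp_chooseLeft_of_neg _ (by
      have := hn.trans (min_le_right _ _)
      omega)
  · intro n
    obtain ⟨N, hN⟩ := polyMul_mem_sliceBdd (substAdd (k.succAbove 0) (k.succAbove 1) K) hRs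
      (k.insertNth e n)
    refine ⟨N, fun t ht => ?_⟩
    change polyMul _ R (k.insertNth e (update n 1 t) : Fin 3 → ℤ) = 0
    rw [Fin.insertNth_update]
    exact hN t ht
  · exact binomOp_mem_sliceBdd (hK e)
  · rw [map_sub, h4, sub_self]

end SliceRecovery

/-! ### The clearing polynomial for three operators after substitution. -/

section Factorization

theorem aeval_substAdd {A : Type*} [CommRing A] [Algebra ℂ A] (x y : A)
    (p : MvPolynomial (Fin 2) ℂ) :
    MvPolynomial.aeval ![x, y] (substAdd 0 1 p) = MvPolynomial.aeval ![x + y, y] p := by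
  suffices h : (MvPolynomial.aeval ![x, y]).comp (substAdd 0 1) =
      (MvPolynomial.aeval ![x + y, y] : MvPolynomial (Fin 2) ℂ →ₐ[ℂ] A) from
    DFunLike.congr_fun h p
  refine MvPolynomial.algHom_ext fun k => ?_
  fin_cases k
  · simp [substAdd_X_self]
  · simp [substAdd_X_of_ne]

/-- The substitution `x_1 ↦ x_0 + x_1 + x_2`, `x_2 ↦ x_1 + x_2`, in two steps. -/
theorem substAdd_comp (q : MvPolynomial (Fin 3) ℂ) :
    substAdd 1 2 (substAdd 0 1 q) = substAdd 0 1 (substAdd 0 2 (substAdd 1 2 q)) := by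
  suffices h : (substAdd (1 : Fin 3) 2).comp (substAdd 0 1) =
      (substAdd 0 1).comp ((substAdd 0 2).comp (substAdd 1 2)) from
    DFunLike.congr_fun h q
  refine MvPolynomial.algHom_ext fun k => ?_
  fin_cases k
  · simp [substAdd_X_self, substAdd_X_of_ne]
    ring
  · simp [substAdd_X_self, substAdd_X_of_ne]
  · simp [substAdd_X_of_ne]

theorem pairProd_three (P : MvPolynomial (Fin 2) ℂ) :
    pairProd P 3 = MvPolynomial.rename ![0, 1] P * MvPolynomial.rename ![0, 2] P *
      MvPolynomial.rename ![1, 2] P := by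
  have h0 : Finset.Ioi (0 : Fin 3) = {1, 2} := rfl
  have h1 : Finset.Ioi (1 : Fin 3) = {2} := rfl
  have h2 : Finset.Ioi (2 : Fin 3) = ∅ := rfl
  rw [pairProd, Fin.prod_univ_three, h0, h1, h2, Finset.prod_pair (by decide),
    Finset.prod_singleton, Finset.prod_empty, mul_one]

/-- Write P(x_0 + x, x) = x_0^l q(x_0, x). The three pair differences become x_0, x_0 + x_1 and x_1,
whose l-th powers split off. The three remaining values of q are all f(x_2) modulo (x_0, x_1), so
their product is f(x_2)^3 there. -/
theorem substAdd_pairProd_three {P : MvPolynomial (Fin 2) ℂ} (hP : P ≠ 0) :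
    ∃ (l : ℕ) (f : Polynomial ℂ) (g h : MvPolynomial (Fin 3) ℂ), f ≠ 0 ∧
      substAdd 1 2 (substAdd 0 1 (pairProd P 3)) =
        (MvPolynomial.X 0 ^ l * (MvPolynomial.X 1 ^ l *
          (MvPolynomial.X 0 + MvPolynomial.X 1) ^ l)) *
        (Polynomial.aeval (MvPolynomial.X 2) f + MvPolynomial.X 0 * g + MvPolynomial.X 1 * h) := by
  obtain ⟨l, q, s, f, hf, hPl, hq⟩ := mvPolynomial_exists_eq_X_pow_mul
    (p := substAdd 0 1 P) (by
      rw [Ne, map_eq_zero_iff _ (substAdd_injective zero_ne_one)]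
      exact hP)
  let E : MvPolynomial (Fin 3) ℂ → MvPolynomial (Fin 3) ℂ → MvPolynomial (Fin 3) ℂ :=
    fun x y => MvPolynomial.aeval ![x, y] q
  have hE : ∀ x y, MvPolynomial.aeval ![x + y, y] P = x ^ l * E x y := by
    intro x y
    rw [← aeval_substAdd, hPl, map_mul, map_pow, MvPolynomial.aeval_X]
    rfl
  have hr : ∀ i j : Fin 3, substAdd 1 2 (substAdd 0 1 (MvPolynomial.rename ![i, j] P)) =
      MvPolynomial.aeval ![substAdd 1 2 (substAdd 0 1 (MvPolynomial.X i)),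
        substAdd 1 2 (substAdd 0 1 (MvPolynomial.X j))] P := by
    intro i j
    suffices h : ((substAdd 1 2).comp (substAdd 0 1)).comp (MvPolynomial.rename ![i, j]) =
        (MvPolynomial.aeval ![substAdd 1 2 (substAdd 0 1 (MvPolynomial.X i)),
          substAdd 1 2 (substAdd 0 1 (MvPolynomial.X j))] :
            MvPolynomial (Fin 2) ℂ →ₐ[ℂ] MvPolynomial (Fin 3) ℂ) from DFunLike.congr_fun h P
    refine MvPolynomial.algHom_ext fun k => ?_
    fin_cases k <;> simp
  let X : Fin 3 → MvPolynomial (Fin 3) ℂ := MvPolynomial.X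
  have x0 : substAdd 1 2 (substAdd 0 1 (MvPolynomial.X 0)) = X 0 + (X 1 + X 2) := by
    simp [X, substAdd_X_self, substAdd_X_of_ne]
  have x1 : substAdd 1 2 (substAdd 0 1 (MvPolynomial.X 1)) = X 1 + X 2 := by
    simp [X, substAdd_X_self, substAdd_X_of_ne]
  have x2 : substAdd 1 2 (substAdd 0 1 (MvPolynomial.X 2)) = X 2 := by
    simp [X, substAdd_X_of_ne]
  let I : Ideal (MvPolynomial (Fin 3) ℂ) := Ideal.span {X 0, X 1}
  have hI0 : X 0 ∈ I := Ideal.subset_span (by simp)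
  have hI1 : X 1 ∈ I := Ideal.subset_span (by simp)
  have hmod : ∀ x y, x ∈ I → y - X 2 ∈ I →
      Ideal.Quotient.mk I (E x y) = Ideal.Quotient.mk I (Polynomial.aeval (X 2) f) := by
    intro x y hx hy
    rw [Ideal.Quotient.eq]
    have h0 : (Polynomial.aeval (X 2) f : MvPolynomial (Fin 3) ℂ) =
        MvPolynomial.aeval ![0, X 2] q := by
      rw [hq]
      simp [← Polynomial.aeval_algHom_apply]
    rw [h0]
    refine mvPolynomial_algHom_sub_mem I _ _ (fun k => ?_) q
    fin_cases k
    · simpa using hx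
    · simpa using hy
  have hu : E (X 0) (X 1 + X 2) * E (X 0 + X 1) (X 2) * E (X 1) (X 2) -
      Polynomial.aeval (X 2) (f ^ 3) ∈ I := by
    rw [← Ideal.Quotient.eq, map_mul, map_mul, hmod _ _ hI0 (by simpa using hI1),
      hmod _ _ (add_mem hI0 hI1) (by simp), hmod _ _ hI1 (by simp), map_pow, map_pow]
    ring
  obtain ⟨g, h, hgh⟩ := Ideal.mem_span_pair.mp hu
  refine ⟨l, f ^ 3, g, h, pow_ne_zero _ hf, ?_⟩
  have hgh' := (sub_eq_iff_eq_add.mp hgh.symm)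
  rw [pairProd_three, map_mul, map_mul, map_mul, map_mul, hr, hr, hr, x0, x1, x2, ← add_assoc,
    add_assoc (X 0), hE, ← add_assoc, hE, hE]
  calc _ = X 0 ^ l * (X 1 ^ l * (X 0 + X 1) ^ l) *
        (E (X 0) (X 1 + X 2) * E (X 0 + X 1) (X 2) * E (X 1) (X 2)) := by ring
    _ = _ := by rw [hgh']; simp only [X]; ring

end Factorization

/-! ### Weak associativity. -/

section WeakAssociativity

variable {W : Type*} [AddCommGroup W] [Module ℂ W]

theorem polyMul_pairProd_insertYE {r : ℕ} {P : MvPolynomial (Fin 2) ℂ} (hP : P ≠ 0)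
    (c : Fin r → EInf W) (i : Fin r) {a b : EInf W} (h : CompatibleVia P ![a, b]) (w : W) :
    polyMul (substAdd i.castSucc (i.castSucc.succAbove i) (pairProd P (r + 1)))
        (insertYE c i a b w) =
      binomOp chooseLeft i.castSucc (i.castSucc.succAbove i) (polyMul (pairProd P (r + 1))
        (productSeries (i.castSucc.insertNth a (update c i b)) w)) := by
  obtain ⟨hD, hE⟩ := polyMul_insertYE hP c i h w
  have hpi : i.castSucc ≠ i.castSucc.succAbove i := (Fin.succAbove_ne _ i).symm
  have hρ := substAdd_rename (injective_pair i.castSucc i) 0 1 P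
  simp only [Matrix.cons_val_zero, Matrix.cons_val_one] at hρ
  rw [pairProd_castSucc P i, mul_assoc, mul_comm, map_mul, polyMul_mul, hρ, hE, polyMul_mul,
    binomOp_polyMul isPascal_chooseLeft hpi _ hD]

theorem yCoeff_zero_left (b : EInf W) (k : ℤ) : yCoeff 0 b k = 0 := by
  have h : QuasiCompatibleSeq ![0, b] := ⟨1, one_ne_zero, fun w => by
    rw [clearedProduct_apply, productSeries_eq_zero _ 0 rfl, map_zero]
    exact zero_mem _⟩
  have := YE_smul_left 0 h
  rw [zero_smul] at this
  unfold yCoeff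
  rw [this]
  exact zero_smul ℂ _

theorem yCoeff_zero_right (a : EInf W) (k : ℤ) : yCoeff a 0 k = 0 := by
  have h : QuasiCompatibleSeq ![a, 0] := ⟨1, one_ne_zero, fun w => by
    rw [clearedProduct_apply, productSeries_eq_zero _ 1 rfl, map_zero]
    exact zero_mem _⟩
  have := YE_smul_right 0 h
  rw [zero_smul] at this
  unfold yCoeff
  rw [this]
  exact zero_smul ℂ _

/-- The series `Y(Y(a, x_0) b, x_2) c (x) w`. -/
def rightSeries (a b c : EInf W) (w : W) : (Fin 3 → ℤ) → W := fun m =>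
  (yCoeff (yCoeff a b (m 0)) c (m 1)).coeffX (m 2) w

/-- The series `Y(a, x_0) Y(b, x_2) c (x) w`. -/
def leftSeries (a b c : EInf W) (w : W) : (Fin 3 → ℤ) → W := fun m =>
  (yCoeff a (yCoeff b c (m 1)) (m 0)).coeffX (m 2) w

variable {a b c : EInf W} (w : W)

theorem coeffX_zero (n : ℤ) : (0 : EInf W).coeffX n w = 0 := rfl

theorem coeffX_mem_sliceBdd (u : ℤ → ℤ → EInf W) :
    (fun m : Fin 3 → ℤ => (u (m 0) (m 1)).coeffX (m 2) w) ∈ sliceBdd 2 W := by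
  intro m
  obtain ⟨N, hN⟩ := (u (m 0) (m 1)).exists_bound w
  refine ⟨N, fun n hn => ?_⟩
  have h0 : update m 2 n 0 = m 0 := update_of_ne (by decide) _ _
  have h1 : update m 2 n 1 = m 1 := update_of_ne (by decide) _ _
  change (u (update m 2 n 0) (update m 2 n 1)).coeffX (update m 2 n 2) w = 0
  rw [h0, h1, update_self]
  exact hN n hn

theorem rightSeries_mem_halfZero (a b c : EInf W) :
    ∃ N, ∀ w, rightSeries a b c w ∈ halfZero 0 N W := by
  obtain ⟨N, hN⟩ := exists_yCoeff_eq_zero a b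
  refine ⟨N, fun w m hm => ?_⟩
  rw [rightSeries, hN _ hm, yCoeff_zero_left, coeffX_zero]

theorem leftSeries_mem_halfZero (a b c : EInf W) :
    ∃ N, ∀ w, leftSeries a b c w ∈ halfZero 1 N W := by
  obtain ⟨N, hN⟩ := exists_yCoeff_eq_zero b c
  refine ⟨N, fun w m hm => ?_⟩
  rw [leftSeries, hN _ hm, yCoeff_zero_right, coeffX_zero]

theorem rightSeries_mem_sliceBddBelow (a b c : EInf W) :
    rightSeries a b c w ∈ sliceBddBelow 0 1 W := by
  intro k
  obtain ⟨N, hN⟩ := exists_yCoeff_eq_zero (yCoeff a b k) c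
  refine ⟨N, fun m hm hm' => ?_⟩
  rw [rightSeries, hm, hN _ hm', coeffX_zero]

theorem leftSeries_mem_sliceBddBelow (a b c : EInf W) :
    leftSeries a b c w ∈ sliceBddBelow 1 0 W := by
  intro k
  obtain ⟨N, hN⟩ := exists_yCoeff_eq_zero a (yCoeff b c k)
  refine ⟨N, fun m hm hm' => ?_⟩
  rw [leftSeries, hm, hN _ hm', coeffX_zero]

/-- The inner vertex operator is handled by insertion into the triple product. The outer one is
known only for each x_0-coefficient, with its own clearing polynomial, and
`polyMul_eq_binomOp_of_slices` assembles these. -/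
theorem polyMul_rightSeries {P : MvPolynomial (Fin 2) ℂ} (hP : P ≠ 0)
    (hab : CompatibleVia P ![a, b]) (habc : CompatibleVia P ![a, b, c])
    (hQ : ∀ k, QuasiCompatibleSeq ![yCoeff a b k, c]) :
    polyMul (substAdd 1 2 (substAdd 0 1 (pairProd P 3))) (rightSeries a b c w) =
      binomOp chooseLeft 1 2 (binomOp chooseLeft 0 1
        (polyMul (pairProd P 3) (productSeries ![a, b, c] w))) := by
  obtain ⟨k₀, hk₀⟩ := exists_yCoeff_eq_zero a b
  have hY := polyMul_pairProd_insertYE hP ![b, c] 0 hab w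
  have he : ((0 : Fin 2).castSucc.insertNth a (update ![b, c] 0 b) : Fin 3 → EInf W) =
      ![a, b, c] := by
    ext t; fin_cases t <;> rfl
  rw [he] at hY
  have hs : ∀ k, (fun n => insertYE ![b, c] 0 a b w ((0 : Fin 3).insertNth k n)) =
      productSeries ![yCoeff a b k, c] w := by
    intro k
    funext n
    refine (insertYE_insertNth ![b, c] 0 a b w k n).trans ?_
    congr 2
  have h := polyMul_eq_binomOp_of_slices (M := W) 0 (R := rightSeries a b c w)
    (C := insertYE ![b, c] 0 a b w) (K := substAdd 0 1 (pairProd P 3)) (k₀ := k₀) ?_ ?_ ?_ ?_ ?_ ?_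
  · refine h.trans ?_
    exact congrArg (binomOp chooseLeft 1 2) hY
  · intro m hm
    unfold insertYE
    rw [productSeries_eq_zero _ 0 (by rw [update_self]; exact hk₀ _ hm)]
    rfl
  · intro m hm
    rw [rightSeries, hk₀ _ hm, yCoeff_zero_left, coeffX_zero]
  · exact rightSeries_mem_sliceBddBelow w a b c
  · exact coeffX_mem_sliceBdd w fun i j => yCoeff (yCoeff a b i) c j
  · intro k
    obtain ⟨q, hq, hqc⟩ := hQ k
    refine ⟨q, hq, ?_, ?_⟩
    · rw [hs]
      exact compatibleVia_pair.mp hqc w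
    · rw [hs, ← polyMul_toSeries_YE hq hqc]
      rfl
  · intro k
    have hG : polyMul (pairProd P 3) (productSeries ![a, b, c] w) ∈ LaurentAtInfinity 3 W :=
      habc w
    have := binomOp_mem_sliceLaurent (p := (0 : Fin 3)) (e := k) hG 0 k le_rfl
    convert this using 3
    exact congrFun hY _

theorem polyMul_leftSeries {P : MvPolynomial (Fin 2) ℂ} (hP : P ≠ 0)
    (hbc : CompatibleVia P ![b, c]) (habc : CompatibleVia P ![a, b, c])
    (hQ : ∀ k, QuasiCompatibleSeq ![a, yCoeff b c k]) :
    polyMul (substAdd 0 2 (substAdd 1 2 (pairProd P 3))) (leftSeries a b c w) =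
      binomOp chooseLeft 0 2 (binomOp chooseLeft 1 2
        (polyMul (pairProd P 3) (productSeries ![a, b, c] w))) := by
  obtain ⟨k₀, hk₀⟩ := exists_yCoeff_eq_zero b c
  have hY := polyMul_pairProd_insertYE hP ![a, b] 1 hbc w
  have he : ((1 : Fin 2).castSucc.insertNth b (update ![a, b] 1 c) : Fin 3 → EInf W) =
      ![a, b, c] := by
    ext t; fin_cases t <;> rfl
  rw [he] at hY
  have hs : ∀ k, (fun n => insertYE ![a, b] 1 b c w ((1 : Fin 3).insertNth k n)) =
      productSeries ![a, yCoeff b c k] w := by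
    intro k
    funext n
    refine (insertYE_insertNth ![a, b] 1 b c w k n).trans ?_
    congr 2
  have h := polyMul_eq_binomOp_of_slices (M := W) 1 (R := leftSeries a b c w)
    (C := insertYE ![a, b] 1 b c w) (K := substAdd 1 2 (pairProd P 3)) (k₀ := k₀) ?_ ?_ ?_ ?_ ?_ ?_
  · refine h.trans ?_
    exact congrArg (binomOp chooseLeft 0 2) hY
  · intro m hm
    unfold insertYE
    rw [productSeries_eq_zero _ 1 (by rw [update_self]; exact hk₀ _ hm)]
    rfl
  · intro m hm
    rw [leftSeries, hk₀ _ hm, yCoeff_zero_right, coeffX_zero]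
  · exact leftSeries_mem_sliceBddBelow w a b c
  · exact coeffX_mem_sliceBdd w fun i j => yCoeff a (yCoeff b c j) i
  · intro k
    obtain ⟨q, hq, hqc⟩ := hQ k
    refine ⟨q, hq, ?_, ?_⟩
    · rw [hs]
      exact compatibleVia_pair.mp hqc w
    · rw [hs, ← polyMul_toSeries_YE hq hqc]
      rfl
  · intro k
    have hG : polyMul (pairProd P 3) (productSeries ![a, b, c] w) ∈ LaurentAtInfinity 3 W :=
      habc w
    have := binomOp_mem_sliceLaurent (p := (1 : Fin 3)) (e := k) hG 1 k le_rfl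
    convert this using 3
    exact congrFun hY _

/-- The substitution of `x_0 + x_1` for `x_0` is defined on series whose exponents of `x_1` are
bounded below. -/
theorem halfZero_le_binomDom {σ : Type*} [DecidableEq σ] {i j : σ} (N : ℤ) :
    halfZero j N W ≤ binomDom chooseRight i j W := by
  intro F hF m
  refine (Set.finite_Icc (m i) (m j + m i - N)).subset fun l hl => ?_
  by_contra h
  refine hl ?_
  simp only
  rw [Set.mem_Icc, not_and_or] at h
  rcases h with h | h
  · rw [chooseRight, chooseLeft_of_neg _ (by omega), zero_smul]
  · rw [hF _ (by rw [update_self]; omega), smul_zero]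

/-- This and the next two lemmas carry the one-sided support needed for cancellation through the
substitution x_0 + x_1 for x_0. -/
theorem binomOp_chooseRight_mem_halfZero {F : (Fin 3 → ℤ) → W} {N : ℤ} (hF : F ∈ halfZero 1 N W) :
    binomOp chooseRight 0 1 F ∈ halfZero 1 N W := by
  intro m hm
  refine finsum_eq_zero_of_forall_eq_zero fun l => ?_
  by_cases h : m 0 ≤ l
  · rw [hF _ (by rw [update_self]; omega), smul_zero]
  · rw [chooseRight, chooseLeft_of_neg _ (by omega), zero_smul]

theorem binomOp_chooseRight_mem_sliceBddBelow {F : (Fin 3 → ℤ) → W} {N : ℤ}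
    (hF : F ∈ halfZero 1 N W) (hF' : F ∈ sliceBddBelow 1 0 W) :
    binomOp chooseRight 0 1 F ∈ sliceBddBelow 1 0 W := by
  intro k
  choose B hB using hF'
  obtain ⟨C, hC⟩ : ∃ C, ∀ k' ∈ Finset.Icc N k, C ≤ B k' := by
    obtain ⟨C, hC⟩ := ((Finset.Icc N k).image B).bddBelow
    exact ⟨C, fun k' hk' => hC (Finset.mem_coe.mpr (Finset.mem_image_of_mem B hk'))⟩
  -- A contributing term has x_1-exponent k' in (N, k] and l = m_0 + k - k' ≤ C + N - k' < C ≤ B k'.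
  refine ⟨C - k + N, fun m hm hm' => finsum_eq_zero_of_forall_eq_zero fun l => ?_⟩
  by_cases h : m 0 ≤ l
  · by_cases h' : m 1 + m 0 - l ≤ N
    · rw [hF _ (by rwa [update_self]), smul_zero]
    · have := hC (m 1 + m 0 - l) (by rw [Finset.mem_Icc]; omega)
      rw [hB (m 1 + m 0 - l) _ (by rw [update_self]) (by
        rw [update_of_ne (by decide), update_self]
        omega), smul_zero]
  · rw [chooseRight, chooseLeft_of_neg _ (by omega), zero_smul]

theorem binomOp_chooseRight_mem_sliceBdd {F : (Fin 3 → ℤ) → W} {N : ℤ}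
    (hF : F ∈ halfZero 1 N W) (hF' : F ∈ sliceBdd 2 W) :
    binomOp chooseRight 0 1 F ∈ sliceBdd 2 W := by
  intro m
  choose B hB using fun l => hF' (update (update m 0 l) 1 (m 1 + m 0 - l))
  obtain ⟨C, hC⟩ : ∃ C, ∀ l ∈ Finset.Icc (m 0) (m 1 + m 0 - N), B l ≤ C := by
    obtain ⟨C, hC⟩ := ((Finset.Icc (m 0) (m 1 + m 0 - N)).image B).bddAbove
    exact ⟨C, fun k' hk' => hC (Finset.mem_coe.mpr (Finset.mem_image_of_mem B hk'))⟩
  refine ⟨C, fun n hn => finsum_eq_zero_of_forall_eq_zero fun l => ?_⟩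
  have h0 : update m 2 n 0 = m 0 := update_of_ne (by decide) _ _
  have h1 : update m 2 n 1 = m 1 := update_of_ne (by decide) _ _
  rw [h0, h1]
  by_cases h : m 0 ≤ l
  · by_cases h' : m 1 + m 0 - l ≤ N
    · rw [hF _ (by rwa [update_self]), smul_zero]
    · have hc := hC l (by rw [Finset.mem_Icc]; omega)
      have e : update (update (update m 2 n) 0 l) 1 (m 1 + m 0 - l) =
          update (update (update m 0 l) 1 (m 1 + m 0 - l)) 2 n := by
        ext t; fin_cases t <;> simp
      rw [e, hB l n (by omega), smul_zero]
  · rw [chooseRight, chooseLeft_of_neg _ (by omega), zero_smul]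

/-- The exponent l comes from P alone, hence is uniform in w. -/
theorem exists_polyMul_leftSeries_eq {P : MvPolynomial (Fin 2) ℂ} (hP : P ≠ 0)
    (hab : CompatibleVia P ![a, b]) (hbc : CompatibleVia P ![b, c])
    (habc : CompatibleVia P ![a, b, c])
    (hQ : ∀ k, QuasiCompatibleSeq ![yCoeff a b k, c])
    (hQ' : ∀ k, QuasiCompatibleSeq ![a, yCoeff b c k]) :
    ∃ l : ℕ, ∀ w, polyMul ((MvPolynomial.X 0 + MvPolynomial.X 1) ^ l)
        (binomOp chooseRight 0 1 (leftSeries a b c w)) =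
      polyMul ((MvPolynomial.X 0 + MvPolynomial.X 1) ^ l) (rightSeries a b c w) := by
  obtain ⟨l, f, g, h, hf, hK⟩ := substAdd_pairProd_three hP
  obtain ⟨NR, hNR⟩ := rightSeries_mem_halfZero a b c
  obtain ⟨NL, hNL⟩ := leftSeries_mem_halfZero a b c
  refine ⟨l, fun w => ?_⟩
  have h01 : (0 : Fin 3) ≠ 1 := by decide
  have h02 : (0 : Fin 3) ≠ 2 := by decide
  have h12 : (1 : Fin 3) ≠ 2 := by decide
  set G := polyMul (pairProd P 3) (productSeries ![a, b, c] w) with hGdef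
  have hG : G ∈ LaurentAtInfinity 3 W := habc w
  set H := binomOp chooseLeft 1 2 (binomOp chooseLeft 0 1 G) with hHdef
  set D := (MvPolynomial.X 0 ^ l * (MvPolynomial.X 1 ^ l *
    (MvPolynomial.X 0 + MvPolynomial.X 1) ^ l) : MvPolynomial (Fin 3) ℂ)
  set u := (Polynomial.aeval (MvPolynomial.X 2) f + MvPolynomial.X 0 * g +
    MvPolynomial.X 1 * h : MvPolynomial (Fin 3) ℂ)
  set L := binomOp chooseRight 0 1 (leftSeries a b c w)
  set R := rightSeries a b c w
  have hR : polyMul u (polyMul D R) = H := by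
    rw [← polyMul_mul, mul_comm, ← hK]
    exact polyMul_rightSeries w hP hab habc hQ
  have hL : polyMul u (polyMul D L) = H := by
    rw [← polyMul_mul, mul_comm, ← hK, substAdd_comp, ← binomOp_polyMul isPascal_chooseRight h01 _
      (halfZero_le_binomDom NL (hNL w)), polyMul_leftSeries w hP hbc habc hQ',
      binomOp_comp hG]
  have hH : ∀ m, m 0 < 0 ∨ m 1 < 0 → H m = 0 := by
    rintro m (hm | hm)
    · refine finsum_eq_zero_of_forall_eq_zero fun t => ?_
      rw [binomOp_chooseLeft_of_neg, smul_zero]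
      rwa [update_of_ne h02, update_of_ne h01]
    · exact binomOp_chooseLeft_of_neg _ hm
  -- L and R are bounded below in opposite orders of the two variables, so u cannot be cancelled
  -- from their difference at once. Each is first shown separately to vanish, after multiplication
  -- by D, wherever H has no terms.
  have hRz : ∀ m, m 0 < 0 ∨ m 1 < 0 → polyMul D R m = 0 := by
    refine polyMul_cancel_of_lower h01 h02 h12 hf g h (polyMul_mem_halfZero D (hNR w))
      (polyMul_mem_sliceBddBelow h01 D (rightSeries_mem_sliceBddBelow w a b c))
      (polyMul_mem_sliceBdd D (coeffX_mem_sliceBdd w fun i j => yCoeff (yCoeff a b i) c j))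
      (Q := fun i j => i < 0 ∨ j < 0) (fun _ _ _ => by omega) (fun _ _ _ => by omega)
      fun m hm => ?_
    rw [← hH m hm, ← hR]
  have hLz : ∀ m, m 0 < 0 ∨ m 1 < 0 → polyMul D L m = 0 := by
    have := polyMul_cancel_of_lower h01.symm h12 h02 hf h g (F := polyMul D L)
      (polyMul_mem_halfZero D (binomOp_chooseRight_mem_halfZero (hNL w)))
      (polyMul_mem_sliceBddBelow h01.symm D (binomOp_chooseRight_mem_sliceBddBelow (hNL w)
        (leftSeries_mem_sliceBddBelow w a b c)))
      (polyMul_mem_sliceBdd D (binomOp_chooseRight_mem_sliceBdd (hNL w)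
        (coeffX_mem_sliceBdd w fun i j => yCoeff a (yCoeff b c j) i)))
      (Q := fun j i => i < 0 ∨ j < 0) (fun _ _ _ => by omega) (fun _ _ _ => by omega)
      fun m hm => by
        rw [add_right_comm, ← hH m hm, ← hL]
    exact this
  -- The difference is now supported in nonnegative exponents of both variables, so u cancels
  -- everywhere.
  have hD : polyMul D (L - R) = 0 := by
    funext m
    have hz : ∀ m : Fin 3 → ℤ, m 0 < 0 ∨ m 1 < 0 → polyMul D (L - R) m = 0 := by
      intro m hm
      rw [map_sub, Pi.sub_apply, hLz m hm, hRz m hm, sub_zero]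
    refine polyMul_cancel_of_lower h01 h02 h12 hf g h (N := -1) (F := polyMul D (L - R))
      (fun m hm => hz m (Or.inl (by omega))) (fun _ => ⟨-1, fun m _ hm => hz m (Or.inr (by omega))⟩)
      (polyMul_mem_sliceBdd D (sub_mem (binomOp_chooseRight_mem_sliceBdd (hNL w)
        (coeffX_mem_sliceBdd w fun i j => yCoeff a (yCoeff b c j) i))
        (coeffX_mem_sliceBdd w fun i j => yCoeff (yCoeff a b i) c j)))
      (Q := fun _ _ => True) (fun _ _ _ => trivial) (fun _ _ _ => trivial) (fun m _ => ?_) m trivial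
    change polyMul u (polyMul D (L - R)) m = 0
    rw [map_sub, map_sub, hL, hR, sub_self]
    rfl
  rw [polyMul_mul, polyMul_mul] at hD
  have := polyMul_X_pow_cancel (polyMul_X_pow_cancel hD)
  rwa [map_sub, sub_eq_zero] at this

end WeakAssociativity

/-! ### The nonlocal vertex algebra and its module. -/

section Structure

variable {W : Type*} [AddCommGroup W] [Module ℂ W] {V : Submodule ℂ (EInf W)}

theorem QuasiCompatible.pair {S : Set (EInf W)} (h : QuasiCompatible S) {a b : EInf W}
    (ha : a ∈ S) (hb : b ∈ S) : QuasiCompatibleSeq ![a, b] :=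
  h 2 _ (by rw [Fin.forall_fin_two]; exact ⟨ha, hb⟩)

theorem IsClosedQuasiCompatible.yCoeff_mem (hV : IsClosedQuasiCompatible V) {a b : EInf W}
    (ha : a ∈ V) (hb : b ∈ V) (k : ℤ) : yCoeff a b k ∈ V := by
  have := hV.closed a ha b hb (-k - 1)
  unfold nthProduct at this
  rwa [show -(-k - 1) - 1 = k by ring] at this

theorem yCoeff_add_left {a a' b : EInf W} (h : QuasiCompatibleSeq ![a, b])
    (h' : QuasiCompatibleSeq ![a', b]) (k : ℤ) :
    yCoeff (a + a') b k = yCoeff a b k + yCoeff a' b k := by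
  unfold yCoeff
  rw [YE_add_left h h']
  rfl

theorem yCoeff_smul_left (z : ℂ) {a b : EInf W} (h : QuasiCompatibleSeq ![a, b]) (k : ℤ) :
    yCoeff (z • a) b k = z • yCoeff a b k := by
  unfold yCoeff
  rw [YE_smul_left z h]
  rfl

theorem yCoeff_add_right {a b b' : EInf W} (h : QuasiCompatibleSeq ![a, b])
    (h' : QuasiCompatibleSeq ![a, b']) (k : ℤ) :
    yCoeff a (b + b') k = yCoeff a b k + yCoeff a b' k := by
  unfold yCoeff
  rw [YE_add_right h h']
  rfl

theorem yCoeff_smul_right (z : ℂ) {a b : EInf W} (h : QuasiCompatibleSeq ![a, b]) (k : ℤ) :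
    yCoeff a (z • b) k = z • yCoeff a b k := by
  unfold yCoeff
  rw [YE_smul_right z h]
  rfl

theorem yCoeff_bddBelow (hV : IsClosedQuasiCompatible V) (a b : V) :
    BddBelow (support fun k : ℤ =>
      (⟨yCoeff (a : EInf W) b k, hV.yCoeff_mem a.2 b.2 k⟩ : V)) := by
  obtain ⟨N, hN⟩ := exists_yCoeff_eq_zero (a : EInf W) b
  refine ⟨N, fun k hk => le_of_not_ge fun h => hk (Subtype.ext (hN k h))⟩

/-- The vertex operator map `Y_{ℰᵒ}` on a closed quasi-compatible subspace. -/
def vertexMap (hV : IsClosedQuasiCompatible V) : V →ₗ[ℂ] VertexOperator ℂ V :=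
  LinearMap.mk₂ ℂ (fun a b => HahnModule.of ℂ (HahnSeries.ofSuppBddBelow _ (yCoeff_bddBelow hV a b)))
    (fun a a' b => by
      ext k : 2
      exact Subtype.ext (yCoeff_add_left (hV.quasiCompatible.pair a.2 b.2)
        (hV.quasiCompatible.pair a'.2 b.2) k))
    (fun z a b => by
      ext k : 2
      exact Subtype.ext (yCoeff_smul_left z (hV.quasiCompatible.pair a.2 b.2) k))
    (fun a b b' => by
      ext k : 2
      exact Subtype.ext (yCoeff_add_right (hV.quasiCompatible.pair a.2 b.2)
        (hV.quasiCompatible.pair a.2 b'.2) k))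
    (fun z a b => by
      ext k : 2
      exact Subtype.ext (yCoeff_smul_right z (hV.quasiCompatible.pair a.2 b.2) k))

theorem coeff_vertexMap (hV : IsClosedQuasiCompatible V) (a b : V) (k : ℤ) :
    HVertexOperator.coeff (vertexMap hV a) k b =
      ⟨yCoeff (a : EInf W) b k, hV.yCoeff_mem a.2 b.2 k⟩ := rfl

/-- The coefficient of `x^n` in `a(x) w`, as a linear function of `a(x)`. -/
def evalCoeff (V : Submodule ℂ (EInf W)) (n : ℤ) (w : W) : V →ₗ[ℂ] W where
  toFun a := (a : EInf W).coeffX n w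
  map_add' _ _ := rfl
  map_smul' _ _ := rfl

theorem coeff_coeff_vertexMap (hV : IsClosedQuasiCompatible V) (u v z : V) (k l n : ℤ) (w : W) :
    evalCoeff V n w (HVertexOperator.coeff (vertexMap hV u) k
      (HVertexOperator.coeff (vertexMap hV v) l z)) = leftSeries (u : EInf W) v z w ![k, l, n] :=
  rfl

theorem evalCoeff_iterateRight (hV : IsClosedQuasiCompatible V) (u v z : V) (n : ℤ) (w : W)
    (m : Fin 2 → ℤ) : evalCoeff V n w (iterateRight (vertexMap hV) u v z m) =
      rightSeries (u : EInf W) v z w ((2 : Fin 3).insertNth n m) := rfl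

theorem evalCoeff_iterateLeft (hV : IsClosedQuasiCompatible V) (u v z : V) (n : ℤ) (w : W)
    (m : Fin 2 → ℤ) : evalCoeff V n w (iterateLeft (vertexMap hV) u v z m) =
      binomOp chooseRight 0 1 (leftSeries (u : EInf W) v z w) ((2 : Fin 3).insertNth n m) := by
  classical
  have e : ((2 : Fin 3).insertNth n m : Fin 3 → ℤ) = ![m 0, m 1, n] := by
    ext t; fin_cases t <;> rfl
  obtain ⟨N, hN⟩ := exists_yCoeff_eq_zero (v : EInf W) z
  have hfin : (support fun i : ℕ => (Ring.choose (m 0 + i) i) •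
      HVertexOperator.coeff (vertexMap hV u) (m 0 + i)
        (HVertexOperator.coeff (vertexMap hV v) (m 1 - i) z)).Finite := by
    refine (Set.finite_Iio (m 1 - N).toNat).subset fun i hi => ?_
    by_contra h
    refine hi ?_
    have : HVertexOperator.coeff (vertexMap hV v) (m 1 - i) z = 0 :=
      Subtype.ext (hN _ (by rw [Set.mem_Iio] at h; omega))
    simp only
    rw [this, map_zero, smul_zero]
  rw [e, binomOp_zero_one]
  unfold iterateLeft
  refine (AddMonoidHom.map_finsum (evalCoeff V n w).toAddMonoidHom hfin).trans ?_
  have hterm : ∀ i : ℕ, (evalCoeff V n w).toAddMonoidHom ((Ring.choose (m 0 + i) i) •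
      HVertexOperator.coeff (vertexMap hV u) (m 0 + i)
        (HVertexOperator.coeff (vertexMap hV v) (m 1 - i) z)) =
      chooseRight (m 0 + i) (m 0) •
        leftSeries (u : EInf W) v z w ![m 0 + i, m 1 + m 0 - (m 0 + i), n] := by
    intro i
    refine (map_zsmul (evalCoeff V n w) (Ring.choose (m 0 + (i : ℤ)) i) _).trans ?_
    have hc : chooseRight (m 0 + i) (m 0) = Ring.choose (m 0 + (i : ℤ)) i := by
      rw [chooseRight, add_sub_cancel_left, chooseLeft_natCast]
    rw [hc, show m 1 + m 0 - (m 0 + i) = m 1 - i by ring]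
    exact congrArg _ (coeff_coeff_vertexMap hV u v z _ _ n w)
  simp only [hterm]
  -- The sum over i ≥ 0 is the sum over l = m_0 + i; terms with l < m_0 vanish because `chooseRight`
  -- does.
  let g : ℤ → W := fun l => chooseRight l (m 0) •
    leftSeries (u : EInf W) v z w ![l, m 1 + m 0 - l, n]
  have hinj : Injective fun i : ℕ => m 0 + (i : ℤ) := fun i j h => by simpa using h
  refine (finsum_mem_range (f := g) hinj).symm.trans ?_
  refine finsum_congr fun l => ?_
  by_cases hl : l ∈ Set.range fun i : ℕ => m 0 + (i : ℤ)
  · rw [finsum_eq_if, if_pos hl]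
  · rw [finsum_eq_if, if_neg hl, chooseRight, chooseLeft_of_neg, zero_smul]
    by_contra h
    exact hl ⟨(l - m 0).toNat, by simp only; omega⟩

theorem vertexMap_weak_assoc (hV : IsClosedQuasiCompatible V) (u v z : V) : ∃ l : ℕ,
    polyMul ((MvPolynomial.X 0 + MvPolynomial.X 1) ^ l) (iterateLeft (vertexMap hV) u v z) =
      polyMul ((MvPolynomial.X 0 + MvPolynomial.X 1) ^ l) (iterateRight (vertexMap hV) u v z) := by
  have hQ := hV.quasiCompatible
  obtain ⟨p, hp, huv⟩ := hQ.pair u.2 v.2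
  obtain ⟨q, hq, hvz⟩ := hQ.pair v.2 z.2
  obtain ⟨s, hs, huvz⟩ := hQ 3 ![(u : EInf W), v, z] (by
    intro i
    fin_cases i
    exacts [u.2, v.2, z.2])
  -- A single polynomial must clear both pairs and the triple. The identity is then checked on each
  -- coefficient of x^n applied to each w.
  obtain ⟨l, hl⟩ := exists_polyMul_leftSeries_eq (P := p * q * s)
    (mul_ne_zero (mul_ne_zero hp hq) hs)
    (huv.of_dvd (Dvd.intro (q * s) (by ring))) (hvz.of_dvd (Dvd.intro (p * s) (by ring)))
    (huvz.of_dvd (dvd_mul_left s _))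
    (fun k => hQ.pair (hV.yCoeff_mem u.2 v.2 k) z.2) fun k => hQ.pair u.2 (hV.yCoeff_mem v.2 z.2 k)
  refine ⟨l, ?_⟩
  funext m
  refine Subtype.ext (EInf.ext fun n w => ?_)
  change evalCoeff V n w _ = evalCoeff V n w _
  refine (polyMul_map (M := V) (evalCoeff V n w) _ _ m).symm.trans
    (Eq.trans ?_ (polyMul_map (M := V) (evalCoeff V n w) _ _ m))
  simp only [evalCoeff_iterateLeft, evalCoeff_iterateRight]
  rw [← polyMul_rename_succAbove, ← polyMul_rename_succAbove]
  have e : MvPolynomial.rename (2 : Fin 3).succAbove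
      ((MvPolynomial.X 0 + MvPolynomial.X 1 : MvPolynomial (Fin 2) ℂ) ^ l) =
      (MvPolynomial.X 0 + MvPolynomial.X 1) ^ l := by
    rw [map_pow, map_add, MvPolynomial.rename_X, MvPolynomial.rename_X]
    rfl
  rw [e, hl]

/-- The nonlocal vertex algebra `(V, Y_{ℰᵒ}, 1_W)`. -/
def vertexAlgebra (hV : IsClosedQuasiCompatible V) (h1 : EInf.idW W ∈ V) :
    NonlocalVertexAlgebra V where
  Y := vertexMap hV
  vac := ⟨EInf.idW W, h1⟩
  vac_left v := by
    ext k : 2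
    refine Subtype.ext ?_
    change ((HahnModule.of LaurentInf).symm (YE (EInf.idW W) v)).coeff k = _
    rw [YE_idW_left]
    change (HahnSeries.single 0 (v : EInf W)).coeff k = ((HahnSeries.single 0 v).coeff k : V)
    by_cases hk : k = 0
    · subst hk; rw [HahnSeries.coeff_single_same, HahnSeries.coeff_single_same]
    · rw [HahnSeries.coeff_single_of_ne hk, HahnSeries.coeff_single_of_ne hk]
      rfl
  creation_regular v n hn := by
    rw [coeff_vertexMap]
    refine Subtype.ext (EInf.ext fun k w => ?_)
    refine (toSeries_YE_idW_right (v : EInf W) w ![n, k]).trans ?_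
    rw [chooseLeft_of_neg _ (by simpa using hn), zero_smul]
    rfl
  creation v := by
    rw [coeff_vertexMap]
    refine Subtype.ext (EInf.ext fun k w => ?_)
    refine (toSeries_YE_idW_right (v : EInf W) w ![0, k]).trans ?_
    simp [chooseLeft]
  weak_assoc := vertexMap_weak_assoc hV

theorem mapCoeff_vertexAlgebra (hV : IsClosedQuasiCompatible V) (h1 : EInf.idW W ∈ V) (a b : V) :
    mapCoeff V.subtype ((vertexAlgebra hV h1).Y a b) = YE (a : EInf W) b := rfl

/-- Any p clearing the pair serves, so for compatible V a power of x_1 - x_2 may be taken. -/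
theorem associativeVia_vertexAlgebra (hV : IsClosedQuasiCompatible V) (h1 : EInf.idW W ∈ V)
    {p : MvPolynomial (Fin 2) ℂ} (hp : p ≠ 0) {a b : V}
    (h : CompatibleVia p ![(a : EInf W), b]) :
    AssociativeVia (vertexAlgebra hV h1) V.subtype p a b :=
  ⟨h, by rw [mapCoeff_vertexAlgebra, iotaDiag_smul_YE hp h]; rfl⟩

theorem exists_vertexAlgebra (hV : IsClosedQuasiCompatible V) (h1 : EInf.idW W ∈ V) :
    ∃ A : NonlocalVertexAlgebra V, IsYEStructure V A ∧
      IsQuasiModuleAtInfinity A V.subtype ∧ Function.Injective V.subtype ∧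
      (Compatible (V : Set (EInf W)) → IsModuleAtInfinity A V.subtype) := by
  have hm : IsQuasiModuleAtInfinity (vertexAlgebra hV h1) V.subtype :=
    ⟨rfl, fun a b => by
      obtain ⟨p, hp, h⟩ := hV.quasiCompatible.pair a.2 b.2
      exact ⟨p, hp, associativeVia_vertexAlgebra hV h1 hp h⟩⟩
  refine ⟨vertexAlgebra hV h1, ⟨rfl, mapCoeff_vertexAlgebra hV h1⟩, hm, V.injective_subtype,
    fun hc => ⟨hm, fun a b => ?_⟩⟩
  obtain ⟨k, hk⟩ := hc 2 ![(a : EInf W), b] (by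
    rw [Fin.forall_fin_two]
    exact ⟨a.2, b.2⟩)
  exact ⟨k, associativeVia_vertexAlgebra hV h1 (pow_ne_zero k X_sub_X_ne_zero) hk⟩

end Structure

end

end NonlocalVA

theorem theorem3p11 (W : Type*) [AddCommGroup W] [Module ℂ W] :
    -- maximal quasi-compatible subspaces are closed and contain the identity
    (∀ K : Submodule ℂ (EInf W),
      Maximal (fun U : Submodule ℂ (EInf W) => QuasiCompatible (U : Set (EInf W))) K →
        IsClosedQuasiCompatible K ∧ EInf.idW W ∈ K) ∧
    -- closed quasi-compatible subspaces containing the identity are nonlocal vertex algebras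
    (∀ V : Submodule ℂ (EInf W), IsClosedQuasiCompatible V → EInf.idW W ∈ V →
      ∃ A : NonlocalVertexAlgebra V, IsYEStructure V A ∧
        IsQuasiModuleAtInfinity A V.subtype ∧ Function.Injective V.subtype ∧
        (Compatible (V : Set (EInf W)) → IsModuleAtInfinity A V.subtype)) ∧
    -- the nonlocal vertex algebra generated by a quasi-compatible subset
    (∀ S : Set (EInf W), QuasiCompatible S →
      ∃! V : Submodule ℂ (EInf W),
        IsLeast {U | IsClosedQuasiCompatible U ∧ S ⊆ U ∧ EInf.idW W ∈ U} V ∧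
        ∃ A : NonlocalVertexAlgebra V, IsYEStructure V A ∧
          IsQuasiModuleAtInfinity A V.subtype ∧ Function.Injective V.subtype ∧
          (Compatible S → IsModuleAtInfinity A V.subtype)) := by
  refine ⟨fun K hK => ?_, fun V hV h1 => exists_vertexAlgebra hV h1, fun S hS => ?_⟩
  · simp only [quasiCompatible_iff] at hK
    exact ⟨isClosedQuasiCompatible_of_maximal le_rfl hK, idW_mem_of_maximal hK⟩
  · have hL := isLeast_generatedSubspace hS
    obtain ⟨A, hY, hm, hinj, hc⟩ := exists_vertexAlgebra hL.1.1 hL.1.2.2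
    refine ⟨generatedSubspace S, ⟨hL, A, hY, hm, hinj, fun h => hc ?_⟩, fun V hV =>
      hV.1.unique hL⟩
    rw [compatible_iff] at h ⊢
    exact generatedSubspace_le_of_compatibleFor powers_le_nonZeroDivisors h
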